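/- Let $n\ge 2$, let $\mathcal S^n=\{x\in\mathbb R^{n+1}:|x|=1\}$ with surface measure $\sigma$, $\Sigma_n=\sigma(\mathcal S^n)$, and let $\Delta^\ast$ be the Laplace--Beltrami operator on $\mathcal S^n$. For $0\le r<1$ let $$P(r,x)=\frac1{\Sigma_n}\,\frac{1-r^2}{|\zeta-x|^{n+1}},\qquad \zeta=(r,0,\dots,0),\ x\in\mathcal S^n,$$ be the Poisson kernel. For $\rho>0$ and $m\in\mathbb N=\{1,2,\dots\}$ the Poisson wavelet of order $m$ at scale $\rho$ is $$g_\rho^m(x)=\rho^m\,\bigl[(r\,\partial_r)^m P(r,x)\bigr]_{r=e^{-\rho}}.$$ For $f\in C^2(\mathcal S^n)$ with values in $\mathbb C$ and $\int_{\mathcal S^n}x|f(x)|^2\,d\sigma(x)\neq0$ put $$\mathrm{var}_S(f)=\left(\frac{\int|f|^2\,d\sigma}{\left|\int x|f(x)|^2\,d\sigma(x)\right|}\right)^2-1,\qquad \mathrm{var}_M(f)=-\frac{\int\Delta^\ast f\cdot\bar f\,d\sigma}{\int|f|^2\,d\sigma},\qquad U(f)=\sqrt{\mathrm{var}_S(f)}\,\sqrt{\mathrm{var}_M(f)}.$$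 (a) For all $n\ge2$ and $m\ge1$, the function $g_\rho^m$ is of class $C^2$, depends only on the first coordinate of $x$, and satisfies $\int x|g_\rho^m|^2\,d\sigma\ne0$ for all sufficiently small $\rho>0$; moreover the limit $\lim_{\rho\to0^+}U(g_\rho^m)$ exists and $$\lim_{\rho\to0^+}U(g_\rho^m)=\tfrac12\sqrt{F(m)},\qquad F(m)=\frac{(n+2m)(n+2m+1)\,[\,n^2-3n+2(m+1)\,]}{(n+2m-1)(n+2m-2)}.$$ (b) For $n\ge5$, $$\min_{m\in\mathbb N}\ \lim_{\rho\to0^+}U(g_\rho^m)=\frac12\sqrt{\frac{n(n-1)(2n-1)}{2n-3}},$$ and the minimum is attained at $m=\left[\frac{n-1}2\right]$, where $[\cdot]$ is the integer part. (c) The value in (b) behaves like $n/2$ as $n\to\infty$: its ratio to $n/2$ tends to $1$, and its difference from $n/2$ tends to $0$. (d) For every $n\ge2$, the number $n/2$ is the optimal lower bound (the infimum) of $U(f)$ over all $f\in C^2(\mathcal S^n)$, $f:\mathcal S^n\to\mathbb C$, that depend only on the first coordinate and satisfy $\int x|f(x)|^2\,d\sigma(x)\ne0$. (e) For $n=2,3,4$,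 the limit $\lim_{\rho\to0^+}U(g_\rho^m)$ is strictly increasing in $m\in\mathbb N$. -/

import Mathlib

open MeasureTheory Filter Topology
open scoped Manifold ContDiff InnerProductSpace

noncomputable section

namespace PoissonWavelet

/-- The unit sphere `S^n` in `ℝ^(n+1)`. -/
abbrev Sph (n : ℕ) : Type := Metric.sphere (0 : EuclideanSpace ℝ (Fin (n + 1))) 1

/-- The (unnormalized) surface measure on `S^n`. -/
def surf (n : ℕ) : Measure (Sph n) :=
  (volume : Measure (EuclideanSpace ℝ (Fin (n + 1)))).toSphere

/-- Extension of a function on the sphere to `ℝ^(n+1)`, constant along rays from the origin. -/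
def radialExt (n : ℕ) (f : Sph n → ℂ) (y : EuclideanSpace ℝ (Fin (n + 1))) : ℂ :=
  if h : y = 0 then 0
  else f ⟨‖y‖⁻¹ • y, by
    rw [mem_sphere_zero_iff_norm, norm_smul, norm_inv, norm_norm,
      inv_mul_cancel₀ (norm_ne_zero_iff.mpr h)]⟩

/-- The Laplace-Beltrami operator of `S^n`: the Euclidean Laplacian of the extension that is
constant along rays, restricted to the sphere. -/
def laplaceBeltrami (n : ℕ) (f : Sph n → ℂ) (x : Sph n) : ℂ :=
  Laplacian.laplacian (radialExt n f) (x : EuclideanSpace ℝ (Fin (n + 1)))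

/-- The vector `∫ x |f(x)|² dσ(x)` of `ℝ^(n+1)`. -/
def firstMoment (n : ℕ) (f : Sph n → ℂ) : EuclideanSpace ℝ (Fin (n + 1)) :=
  ∫ x : Sph n, ‖f x‖ ^ 2 • (x : EuclideanSpace ℝ (Fin (n + 1))) ∂(surf n)

/-- Variance in space domain. -/
def varS (n : ℕ) (f : Sph n → ℂ) : ℝ :=
  ((∫ x, ‖f x‖ ^ 2 ∂(surf n)) / ‖firstMoment n f‖) ^ 2 - 1

/-- Variance in momentum domain. (The first integral is real for every `C²` function, by Green's
formula, so that taking its real part only changes its type.) -/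
def varM (n : ℕ) (f : Sph n → ℂ) : ℝ :=
  -(∫ x, laplaceBeltrami n f x * (starRingEnd ℂ) (f x) ∂(surf n)).re /
    ∫ x, ‖f x‖ ^ 2 ∂(surf n)

/-- The uncertainty product. -/
def uncertainty (n : ℕ) (f : Sph n → ℂ) : ℝ :=
  Real.sqrt (varS n f) * Real.sqrt (varM n f)

/-- `f` is invariant under the rotations that fix the first coordinate axis, i.e. `f(x)` depends
only on the first coordinate of `x`. -/
def IsZonal (n : ℕ) (f : Sph n → ℂ) : Prop :=
  ∃ φ : ℝ → ℂ, ∀ x : Sph n, f x = φ ((x : EuclideanSpace ℝ (Fin (n + 1))) 0)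

/-- Zonal `C²` functions whose uncertainty product is defined. -/
def IsAdmissible (n : ℕ) (f : Sph n → ℂ) : Prop :=
  ContMDiff (𝓡 n) 𝓘(ℝ, ℂ) 2 f ∧ IsZonal n f ∧ firstMoment n f ≠ 0

/-- The Poisson kernel with pole `ζ = (r, 0, …, 0)`. -/
def poissonKernel (n : ℕ) (r : ℝ) (x : Sph n) : ℝ :=
  1 / (surf n).real Set.univ *
    ((1 - r ^ 2) /
      ‖EuclideanSpace.single (0 : Fin (n + 1)) r - (x : EuclideanSpace ℝ (Fin (n + 1)))‖ ^ (n + 1))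

/-- The operator `ρ r ∂_r`, where the scale `ρ` is a fixed number. -/
def scaledRadialDeriv (n : ℕ) (ρ : ℝ) (G : ℝ → Sph n → ℝ) : ℝ → Sph n → ℝ :=
  fun r x => ρ * r * deriv (fun s => G s x) r

/-- The Poisson wavelet `g_ρ^m` of order `m ≥ 1` at scale `ρ > 0`: the operator `ρ r ∂_r` applied
`m` times to the Poisson kernel, evaluated at `r = e^(-ρ)`. -/
def wavelet (n m : ℕ) (ρ : ℝ) (x : Sph n) : ℂ :=
  (((scaledRadialDeriv n ρ)^[m] (poissonKernel n) (Real.exp (-ρ)) x : ℝ) : ℂ)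

/-- The rational function `F(m)` (for the sphere `S^n`). -/
def F (n m : ℕ) : ℝ :=
  ((n : ℝ) + 2 * m) * (n + 2 * m + 1) * ((n : ℝ) ^ 2 - 3 * n + 2 * (m + 1)) /
    (((n : ℝ) + 2 * m - 1) * (n + 2 * m - 2))

/-- The number `½ √(n(n-1)(2n-1)/(2n-3))`. -/
def minValue (n : ℕ) : ℝ :=
  1 / 2 * Real.sqrt ((n : ℝ) * (n - 1) * (2 * n - 1) / (2 * n - 3))

end PoissonWavelet

end

noncomputable section

namespace PoissonWavelet

open Set Metric

open scoped ENNReal Pointwise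

/-! Under projection to the first coordinate the surface measure becomes a multiple of `sin^(n-1) θ
dθ`. For a zonal function with polar-angle profile `h` the uncertainty product is therefore
`√((N/M)² - 1) √(E/N)`, where `N`, `M`, `E` are the integrals of `|h|²`, `cos θ |h|²`, `|h'|²`
against this weight (`uncertainty_zonal`).

Lower bound (`half_dimension_le`): integrating the derivative of `sin^n |h|²` gives `n M = -2 ∫
sin^n ⟪h, h'⟫`. With `P = ∫ sin^(n+1) |h|²`, Cauchy-Schwarz yields `n² M² ≤ 4 P E`, and a second use
of it yields `P N ≤ N² - M²`. The powers `(1 + cos θ)^k` have uncertainty product `n/2 ·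
√((n+4k)/(n+4k-2))`, so `n/2` is optimal.

Wavelets: up to a common constant, the product of two Poisson kernels with parameters `r`, `s` has
integral `(1+rs)/(1-rs)^n`, and with the extra factor `cos θ` it has integral `(r+s)/(1-rs)^n`; a
Möbius substitution reduces both to the first two moments of one kernel. Applying `r∂_r` and `s∂_s`
`m` times each and setting `s = r` gives `N` and `M`. Harmonicity of the kernel, `(r∂_r)² + (n-1)
r∂_r + Δ* = 0`, gives `E` (`integral_deriv_angleProfile_mul`). With `q = r²`, `D = q d/dq` and `u =
(1-q)^(-n)` this reads `N ∼ D^(2m) u + q (D+1)^(2m) u` and `M ∼ 2r D^m (D+1)^m u`.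

As `q → 1`, `D^p u` is asymptotic to `n(n+1)⋯(n+p-1) (1-q)^(-n-p)`. The two leading orders of `N`
and `M` coincide, so `N - M` has to be expanded to the third
(`tendsto_waveletMass_sub_waveletMoment`); the resulting factor `(1-q)²` balances `E/N`, of order
`(1-q)^(-2)`.

With `x = n + 2m`, the difference between `F` and its claimed minimum is `(x-2n+1)(x-2n+2)` times a
positive factor. A product of consecutive integers is nonnegative, and one of the two factors
vanishes at `m = [(n-1)/2]`. -/

/-! ### Projection of the surface measure to the first axis. -/

theorem lintegral_fun_norm_eq {E : Type*} [NormedAddCommGroup E] [NormedSpace ℝ E]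
    [MeasurableSpace E] [BorelSpace E] [FiniteDimensional ℝ E] [Nontrivial E]
    (μ : Measure E) [μ.IsAddHaarMeasure] {f : ℝ → ℝ≥0∞} (hf : Measurable f) :
    ∫⁻ x, f ‖x‖ ∂μ = μ.toSphere univ *
      ∫⁻ y in Ioi (0 : ℝ), ENNReal.ofReal (y ^ (Module.finrank ℝ E - 1)) * f y := by
  have h1 : ∫⁻ x, f ‖x‖ ∂μ = ∫⁻ x : ({0}ᶜ : Set E), f ‖(x : E)‖ ∂(μ.comap (↑)) := by
    rw [lintegral_subtype_comap (measurableSet_singleton _).compl (fun x => f ‖x‖),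
      restrict_compl_singleton]
  have h2 := (μ.measurePreserving_homeomorphUnitSphereProd).lintegral_comp_emb
    (Homeomorph.measurableEmbedding _) (fun p => f p.2)
  simp only [homeomorphUnitSphereProd_apply_snd_coe] at h2
  rw [h1, h2, lintegral_prod _ (by fun_prop)]
  simp only [lintegral_const]
  rw [mul_comm, Measure.volumeIoiPow, lintegral_withDensity_eq_lintegral_mul _ (by fun_prop)
    (by fun_prop)]
  congr 1
  rw [← lintegral_subtype_comap measurableSet_Ioi]
  rfl

/-- Euclidean space as the product of the first coordinate axis and its complement. -/
def splitFirst (n : ℕ) : EuclideanSpace ℝ (Fin (n + 1)) ≃ᵐ ℝ × EuclideanSpace ℝ (Fin n) :=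
  ((MeasurableEquiv.toLp 2 (Fin (n + 1) → ℝ)).symm.trans
    (MeasurableEquiv.piFinSuccAbove (fun _ => ℝ) 0)).trans
    ((MeasurableEquiv.refl ℝ).prodCongr (MeasurableEquiv.toLp 2 (Fin n → ℝ)))

theorem splitFirst_norm_sq (n : ℕ) (x : EuclideanSpace ℝ (Fin (n + 1))) :
    ‖x‖ ^ 2 = (x 0) ^ 2 + ‖(splitFirst n x).2‖ ^ 2 := by
  have h : ∀ i, (splitFirst n x).2 i = x i.succ := fun i => rfl
  simp only [EuclideanSpace.norm_sq_eq, Fin.sum_univ_succ, h, Real.norm_eq_abs, sq_abs]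

theorem measurePreserving_splitFirst (n : ℕ) :
    MeasurePreserving (splitFirst n) volume volume := by
  refine ((MeasurePreserving.id volume).prod (PiLp.volume_preserving_toLp (Fin n))).comp
    ((volume_preserving_piFinSuccAbove (fun _ => ℝ) 0).comp
      (EuclideanSpace.volume_preserving_symm_measurableEquiv_toLp (Fin (n + 1))))

/-- Radial integration over the last `n` coordinates leaves a half-plane of pairs `(x₀, |x'|)`,
where planar polar coordinates apply. Their angle runs over `(-π, π)`, and the test `0 < p.2`
selects the half-plane. -/
theorem lintegral_coord_norm (n : ℕ) (hn : 1 ≤ n) {f : ℝ × ℝ → ℝ≥0∞} (hf : Measurable f) :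
    ∫⁻ x : EuclideanSpace ℝ (Fin (n + 1)), f (x 0, ‖(splitFirst n x).2‖) =
      (volume : Measure (EuclideanSpace ℝ (Fin n))).toSphere univ *
      ∫⁻ p in polarCoord.target, ENNReal.ofReal p.1 *
        (if 0 < p.2 then ENNReal.ofReal ((p.1 * Real.sin p.2) ^ (n - 1)) *
          f (p.1 * Real.cos p.2, p.1 * Real.sin p.2) else 0) := by
  have : Nonempty (Fin n) := ⟨⟨0, hn⟩⟩
  have : Nontrivial (EuclideanSpace ℝ (Fin n)) := inferInstance
  have h := (measurePreserving_splitFirst n).lintegral_comp_emb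
    (splitFirst n).measurableEmbedding (fun p => f (p.1, ‖p.2‖))
  have h' : ∫⁻ x : EuclideanSpace ℝ (Fin (n + 1)), f (x 0, ‖(splitFirst n x).2‖) =
    ∫⁻ p : ℝ × EuclideanSpace ℝ (Fin n), f (p.1, ‖p.2‖) := h
  rw [h', Measure.volume_eq_prod, lintegral_prod _ (by fun_prop)]
  have h2 : ∀ a : ℝ, ∫⁻ y : EuclideanSpace ℝ (Fin n), f (a, ‖y‖) =
      (volume : Measure (EuclideanSpace ℝ (Fin n))).toSphere univ *
        ∫⁻ y in Ioi (0 : ℝ), ENNReal.ofReal (y ^ (n - 1)) * f (a, y) := by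
    intro a
    have := lintegral_fun_norm_eq (volume : Measure (EuclideanSpace ℝ (Fin n)))
      (f := fun y => f (a, y)) (by fun_prop)
    simpa using this
  simp_rw [h2]
  rw [lintegral_const_mul' _ _ (measure_ne_top _ _)]
  congr 1
  have hg : Measurable fun p : ℝ × ℝ => if 0 < p.2 then
      ENNReal.ofReal (p.2 ^ (n - 1)) * f p else 0 :=
    Measurable.ite (measurableSet_lt measurable_const measurable_snd) (by fun_prop)
      measurable_const
  have h3 := lintegral_comp_polarCoord_symm (fun p : ℝ × ℝ => if 0 < p.2 then
      ENNReal.ofReal (p.2 ^ (n - 1)) * f p else 0)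
  rw [Measure.volume_eq_prod, lintegral_prod _ hg.aemeasurable] at h3
  have h4 : ∀ a : ℝ, ∫⁻ y in Ioi (0 : ℝ), ENNReal.ofReal (y ^ (n - 1)) * f (a, y) =
      ∫⁻ y, if 0 < y then ENNReal.ofReal (y ^ (n - 1)) * f (a, y) else 0 := by
    intro a
    rw [← lintegral_indicator measurableSet_Ioi]
    rfl
  simp_rw [h4]
  rw [← h3, ← Measure.volume_eq_prod]
  refine setLIntegral_congr_fun polarCoord.open_target.measurableSet (fun p hp => ?_)
  simp only [polarCoord_symm_apply, smul_eq_mul]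
  have hp1 : 0 < p.1 := hp.1
  have : 0 < p.1 * Real.sin p.2 ↔ 0 < p.2 := by
    rw [mul_pos_iff_of_pos_left hp1]
    constructor
    · intro h
      by_contra hc
      exact absurd h (not_lt.mpr (Real.sin_nonpos_of_nonpos_of_neg_pi_le (not_lt.mp hc) hp.2.1.le))
    · intro h
      exact Real.sin_pos_of_pos_of_lt_pi h hp.2.2
  simp only [this]

/-- `Measure.toSphere` measures a set through the volume of the truncated cone over it; this
describes that cone by `y 0` and `‖y‖` alone, the quantities `lintegral_coord_norm` can integrate.
-/
theorem smul_sphere_preimage (n : ℕ) (B : Set ℝ) :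
    Ioo (0 : ℝ) 1 • ((↑) '' ((fun x : Sph n => (x : EuclideanSpace ℝ (Fin (n + 1))) 0) ⁻¹' B)) =
      {y : EuclideanSpace ℝ (Fin (n + 1)) | 0 < ‖y‖ ∧ ‖y‖ < 1 ∧ y 0 / ‖y‖ ∈ B} := by
  ext y
  simp only [Set.mem_smul, mem_image, mem_preimage, mem_ofPred_eq]
  constructor
  · rintro ⟨r, hr, _, ⟨x, hx, rfl⟩, rfl⟩
    have hx1 : ‖(x : EuclideanSpace ℝ (Fin (n + 1)))‖ = 1 := norm_eq_of_mem_sphere x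
    have : ‖r • (x : EuclideanSpace ℝ (Fin (n + 1)))‖ = r := by
      rw [norm_smul, hx1, mul_one, Real.norm_of_nonneg hr.1.le]
    rw [this]
    refine ⟨hr.1, hr.2, ?_⟩
    simpa [mul_div_cancel_left₀ _ hr.1.ne'] using hx
  · rintro ⟨h0, h1, h2⟩
    refine ⟨‖y‖, ⟨h0, h1⟩, ‖y‖⁻¹ • y, ⟨⟨‖y‖⁻¹ • y, ?_⟩, ?_, rfl⟩, ?_⟩
    · rw [mem_sphere_zero_iff_norm, norm_smul, norm_inv, norm_norm, inv_mul_cancel₀ h0.ne']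
    · simpa [div_eq_inv_mul] using h2
    · rw [smul_smul, mul_inv_cancel₀ h0.ne', one_smul]

theorem measurable_first (n : ℕ) :
    Measurable (fun x : Sph n => (x : EuclideanSpace ℝ (Fin (n + 1))) 0) :=
  Continuous.measurable (by fun_prop)

/-- The density `sin^(n-1) θ dθ` on `(0, π)`. -/
def thetaMeasure (n : ℕ) : Measure ℝ :=
  (volume.restrict (Ioo 0 Real.pi)).withDensity fun θ => ENNReal.ofReal (Real.sin θ ^ (n - 1))

open scoped Classical in
-- In polar coordinates the volume of the cone splits into a radial and an angular integral. Only `c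
-- ≠ 0` and `c ≠ ⊤` are recorded: the uncertainty product does not change when the measure is
-- scaled.
theorem map_first_surf (n : ℕ) (hn : 1 ≤ n) : ∃ c : ℝ≥0∞, c ≠ 0 ∧ c ≠ ⊤ ∧
    (surf n).map (fun x : Sph n => (x : EuclideanSpace ℝ (Fin (n + 1))) 0) =
      c • (thetaMeasure n).map Real.cos := by
  have : Nonempty (Fin n) := ⟨⟨0, hn⟩⟩
  have : Nontrivial (EuclideanSpace ℝ (Fin n)) := inferInstance
  set V := (volume : Measure (EuclideanSpace ℝ (Fin n))).toSphere univ with hV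
  have hV0 : V ≠ 0 := by
    rw [hV, Measure.measure_univ_ne_zero]; exact Measure.toSphere_ne_zero _
  set R := ∫⁻ r in Ioo (0 : ℝ) 1, ENNReal.ofReal (r * r ^ (n - 1)) with hR
  have hR0 : R ≠ 0 := by
    rw [hR]
    refine (setLIntegral_pos_iff (by fun_prop)).2 ?_ |>.ne'
    have : Function.support (fun r : ℝ => ENNReal.ofReal (r * r ^ (n - 1))) ∩ Ioo 0 1 =
        Ioo 0 1 := by
      apply inter_eq_right.2
      intro r hr
      have : 0 < r * r ^ (n - 1) := mul_pos hr.1 (pow_pos hr.1 _)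
      simpa using this
    rw [this]; simp
  have hRt : R ≠ ⊤ := by
    rw [hR]
    refine ne_of_lt (lt_of_le_of_lt (setLIntegral_mono (g := fun _ => 1) measurable_const ?_)
      (by simp))
    intro r hr
    rw [ENNReal.ofReal_le_one]
    exact mul_le_one₀ hr.2.le (pow_nonneg hr.1.le _) (pow_le_one₀ hr.1.le hr.2.le)
  refine ⟨(n + 1 : ℕ) * (V * R), ?_, ?_, ?_⟩
  · exact mul_ne_zero (by exact_mod_cast Nat.succ_ne_zero n) (mul_ne_zero hV0 hR0)
  · exact ENNReal.mul_ne_top (ENNReal.natCast_ne_top _)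
      (ENNReal.mul_ne_top (measure_ne_top _ _) hRt)
  ext B hB
  rw [Measure.map_apply (measurable_first n) hB, surf,
    Measure.toSphere_apply' _ (measurable_first n hB), smul_sphere_preimage]
  simp only [finrank_euclideanSpace, Fintype.card_fin, Measure.smul_apply, smul_eq_mul]
  rw [Measure.map_apply Real.measurable_cos hB, mul_assoc]
  congr 1
  set f : ℝ × ℝ → ℝ≥0∞ := indicator {p | 0 < Real.sqrt (p.1 ^ 2 + p.2 ^ 2) ∧
    Real.sqrt (p.1 ^ 2 + p.2 ^ 2) < 1 ∧ p.1 / Real.sqrt (p.1 ^ 2 + p.2 ^ 2) ∈ B} 1 with hf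
  have hfa : ∀ a b, f (a, b) = if 0 < Real.sqrt (a ^ 2 + b ^ 2) ∧
      Real.sqrt (a ^ 2 + b ^ 2) < 1 ∧ a / Real.sqrt (a ^ 2 + b ^ 2) ∈ B then 1 else 0 := by
    intro a b
    simp only [hf, indicator, mem_ofPred_eq, Pi.one_apply]
  have hfm : Measurable f := by
    refine measurable_one.indicator ?_
    have h0 : Measurable fun p : ℝ × ℝ => Real.sqrt (p.1 ^ 2 + p.2 ^ 2) := by fun_prop
    refine (measurableSet_lt measurable_const h0).inter
      ((measurableSet_lt h0 measurable_const).inter ?_)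
    have : Measurable fun p : ℝ × ℝ => p.1 / Real.sqrt (p.1 ^ 2 + p.2 ^ 2) := by fun_prop
    exact this hB
  have hsm : MeasurableSet {y : EuclideanSpace ℝ (Fin (n + 1)) |
      0 < ‖y‖ ∧ ‖y‖ < 1 ∧ y 0 / ‖y‖ ∈ B} := by
    refine (measurableSet_lt measurable_const measurable_norm).inter
      ((measurableSet_lt measurable_norm measurable_const).inter ?_)
    have : Measurable fun y : EuclideanSpace ℝ (Fin (n + 1)) => y 0 / ‖y‖ := by fun_prop
    exact this hB
  rw [← lintegral_indicator_one hsm]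
  have h1 : ∀ y : EuclideanSpace ℝ (Fin (n + 1)),
      indicator {y : EuclideanSpace ℝ (Fin (n + 1)) | 0 < ‖y‖ ∧ ‖y‖ < 1 ∧ y 0 / ‖y‖ ∈ B}
        (1 : EuclideanSpace ℝ (Fin (n + 1)) → ℝ≥0∞) y = f (y 0, ‖(splitFirst n y).2‖) := by
    intro y
    have : Real.sqrt ((y 0) ^ 2 + ‖(splitFirst n y).2‖ ^ 2) = ‖y‖ := by
      rw [← splitFirst_norm_sq, Real.sqrt_sq (norm_nonneg _)]
    simp only [hfa, indicator, mem_ofPred_eq, this, Pi.one_apply]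
  simp_rw [h1]
  rw [lintegral_coord_norm n hn hfm, mul_assoc]
  congr 1
  rw [thetaMeasure, withDensity_apply _ (Real.measurable_cos hB),
    Measure.restrict_restrict (Real.measurable_cos hB)]
  have h2 : ∀ p ∈ polarCoord.target, ENNReal.ofReal p.1 *
        (if 0 < p.2 then ENNReal.ofReal ((p.1 * Real.sin p.2) ^ (n - 1)) *
          f (p.1 * Real.cos p.2, p.1 * Real.sin p.2) else 0) =
      (Ioo (0 : ℝ) 1).indicator (fun r => ENNReal.ofReal (r * r ^ (n - 1))) p.1 *
      (Real.cos ⁻¹' B ∩ Ioo 0 Real.pi).indicator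
        (fun θ => ENNReal.ofReal (Real.sin θ ^ (n - 1))) p.2 := by
    rintro ⟨r, θ⟩ ⟨hr, hθ⟩
    simp only [mem_Ioi] at hr
    have hθ2 : θ < Real.pi := hθ.2
    have hs : Real.sqrt ((r * Real.cos θ) ^ 2 + (r * Real.sin θ) ^ 2) = r := by
      rw [show (r * Real.cos θ) ^ 2 + (r * Real.sin θ) ^ 2 =
        r ^ 2 * (Real.sin θ ^ 2 + Real.cos θ ^ 2) by ring, Real.sin_sq_add_cos_sq, mul_one,
        Real.sqrt_sq hr.le]
    simp only [hfa, indicator, hs, mul_div_cancel_left₀ _ hr.ne', mem_inter_iff,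
      mem_preimage, mem_Ioo, hr, true_and, hθ2, and_true]
    by_cases a1 : 0 < θ <;> by_cases a2 : r < 1 <;> by_cases a3 : Real.cos θ ∈ B <;>
      simp [a1, a2, a3]
    rw [mul_pow, ENNReal.ofReal_mul hr.le, ENNReal.ofReal_mul (pow_nonneg hr.le _), mul_assoc]
  rw [setLIntegral_congr_fun polarCoord.open_target.measurableSet h2, polarCoord_target,
    Measure.volume_eq_prod, ← Measure.prod_restrict,
    lintegral_prod_mul (f := (Ioo (0 : ℝ) 1).indicator _)
      ((by fun_prop : Measurable fun r : ℝ => ENNReal.ofReal (r * r ^ (n - 1))).indicator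
        measurableSet_Ioo).aemeasurable
      ((by fun_prop : Measurable fun r : ℝ => ENNReal.ofReal (Real.sin r ^ (n - 1))).indicator
        ((Real.measurable_cos hB).inter measurableSet_Ioo)).aemeasurable]
  congr 1
  · rw [setLIntegral_indicator measurableSet_Ioo, hR,
      inter_eq_left.2 (Ioo_subset_Ioi_self)]
  · rw [setLIntegral_indicator ((Real.measurable_cos hB).inter measurableSet_Ioo),
      inter_eq_left.2
        (inter_subset_right.trans (Ioo_subset_Ioo_left (by linarith [Real.pi_pos])))]

/-- The factor relating integrals of zonal functions over the sphere to integrals over `(0, π)`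
against `sin^(n-1)`. -/
def zonalConst (n : ℕ) (hn : 1 ≤ n) : ℝ := (map_first_surf n hn).choose.toReal

theorem zonalConst_pos (n : ℕ) (hn : 1 ≤ n) : 0 < zonalConst n hn :=
  ENNReal.toReal_pos (map_first_surf n hn).choose_spec.1 (map_first_surf n hn).choose_spec.2.1

theorem cos_mem_Ioo {θ : ℝ} (hθ : θ ∈ Ioo 0 Real.pi) : Real.cos θ ∈ Ioo (-1 : ℝ) 1 := by
  constructor
  · rw [← Real.cos_pi]
    exact Real.cos_lt_cos_of_nonneg_of_le_pi hθ.1.le le_rfl hθ.2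
  · rw [← Real.cos_zero]
    exact Real.cos_lt_cos_of_nonneg_of_le_pi le_rfl hθ.2.le hθ.1

theorem ae_map_first_mem (n : ℕ) (hn : 1 ≤ n) :
    ∀ᵐ t ∂((surf n).map (fun x : Sph n => (x : EuclideanSpace ℝ (Fin (n + 1))) 0)),
      t ∈ Ioo (-1 : ℝ) 1 := by
  rw [(map_first_surf n hn).choose_spec.2.2]
  refine Measure.ae_smul_measure ?_ _
  refine (ae_map_iff (p := fun t => t ∈ Ioo (-1 : ℝ) 1)
    Real.measurable_cos.aemeasurable measurableSet_Ioo).2 ?_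
  refine (withDensity_absolutelyContinuous _ _).ae_le ?_
  filter_upwards [ae_restrict_mem measurableSet_Ioo] with θ hθ using cos_mem_Ioo hθ

/-- The poles are a null set, so everything is asked on the open interval only. This matters because
a profile is arbitrary outside `[-1, 1]` and so has no two-sided regularity at `±1`. -/
theorem integral_zonal {E : Type*} [NormedAddCommGroup E] [NormedSpace ℝ E]
    (n : ℕ) (hn : 1 ≤ n) {g : Sph n → E} {ψ : ℝ → E}
    (hg : ∀ x : Sph n, (x : EuclideanSpace ℝ (Fin (n + 1))) 0 ∈ Ioo (-1 : ℝ) 1 →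
      g x = ψ ((x : EuclideanSpace ℝ (Fin (n + 1))) 0))
    (hψ : ContinuousOn ψ (Ioo (-1) 1)) :
    ∫ x, g x ∂(surf n) = zonalConst n hn •
      ∫ θ in (0 : ℝ)..Real.pi, Real.sin θ ^ (n - 1) • ψ (Real.cos θ) := by
  have hae := ae_map_first_mem n hn
  have hm : AEStronglyMeasurable ψ
      ((surf n).map (fun x : Sph n => (x : EuclideanSpace ℝ (Fin (n + 1))) 0)) := by
    rw [← Measure.restrict_eq_self_of_ae_mem hae]
    exact hψ.aestronglyMeasurable measurableSet_Ioo
  have h1 : ∫ x, g x ∂(surf n) =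
      ∫ x : Sph n, ψ ((x : EuclideanSpace ℝ (Fin (n + 1))) 0) ∂(surf n) := by
    refine integral_congr_ae ?_
    filter_upwards [ae_of_ae_map (measurable_first n).aemeasurable hae] with x hx using hg x hx
  rw [h1, ← integral_map (measurable_first n).aemeasurable hm]
  have hs := (map_first_surf n hn).choose_spec
  have hm2 : AEStronglyMeasurable ψ ((thetaMeasure n).map Real.cos) := by
    rw [hs.2.2] at hm
    refine hm.mono_ac ?_
    exact Measure.absolutelyContinuous_smul hs.1
  rw [hs.2.2, integral_smul_measure, integral_map Real.measurable_cos.aemeasurable hm2,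
    ← zonalConst.eq_1 n hn, thetaMeasure,
    integral_withDensity_eq_integral_toReal_smul (by fun_prop) (by simp),
    intervalIntegral.integral_of_le Real.pi_pos.le, integral_Ioc_eq_integral_Ioo]
  congr 1
  refine setIntegral_congr_fun measurableSet_Ioo (fun θ hθ => ?_)
  rw [ENNReal.toReal_ofReal (pow_nonneg (Real.sin_pos_of_pos_of_lt_pi hθ.1 hθ.2).le _)]

/-! ### The first moment of a zonal function points along the first axis. -/

/-- The reflection of `ℝ^(n+1)` in the `i`-th coordinate. -/
def coordReflection (n : ℕ) (i : Fin (n + 1)) :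
    EuclideanSpace ℝ (Fin (n + 1)) ≃ₗᵢ[ℝ] EuclideanSpace ℝ (Fin (n + 1)) :=
  LinearIsometryEquiv.piLpCongrRight 2
    (fun j => if j = i then LinearIsometryEquiv.neg ℝ else LinearIsometryEquiv.refl ℝ ℝ)

theorem coordReflection_self (n : ℕ) (i : Fin (n + 1)) (x : EuclideanSpace ℝ (Fin (n + 1))) :
    coordReflection n i x i = - x i := by
  simp [coordReflection]

theorem coordReflection_of_ne (n : ℕ) {i j : Fin (n + 1)} (h : j ≠ i)
    (x : EuclideanSpace ℝ (Fin (n + 1))) : coordReflection n i x j = x j := by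
  simp [coordReflection, h]

/-- A linear isometry acting on the sphere. -/
def sphMap (n : ℕ) (T : EuclideanSpace ℝ (Fin (n + 1)) ≃ₗᵢ[ℝ] EuclideanSpace ℝ (Fin (n + 1))) :
    Sph n ≃ₜ Sph n where
  toFun x := ⟨T x, by simp⟩
  invFun x := ⟨T.symm x, by simp⟩
  left_inv x := by simp
  right_inv x := by simp
  continuous_toFun := by fun_prop
  continuous_invFun := by fun_prop

theorem measurePreserving_sphMap (n : ℕ)
    (T : EuclideanSpace ℝ (Fin (n + 1)) ≃ₗᵢ[ℝ] EuclideanSpace ℝ (Fin (n + 1))) :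
    MeasurePreserving (sphMap n T) (surf n) (surf n) := by
  refine ⟨(sphMap n T).measurable, ?_⟩
  ext A hA
  rw [Measure.map_apply (sphMap n T).measurable hA, surf, Measure.toSphere_apply' _ hA,
    Measure.toSphere_apply' _ ((sphMap n T).measurable hA)]
  congr 1
  rw [← T.measurePreserving.measure_preimage_equiv (f := T.toMeasurableEquiv)
    (Ioo (0 : ℝ) 1 • (Subtype.val '' A))]
  congr 1
  ext y
  simp only [Set.mem_smul, mem_preimage]
  constructor
  · rintro ⟨r, hr, _, ⟨x, hx, rfl⟩, rfl⟩
    exact ⟨r, hr, T x, ⟨sphMap n T x, hx, rfl⟩, by simp⟩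
  · rintro ⟨r, hr, _, ⟨x, hx, rfl⟩, h⟩
    refine ⟨r, hr, T.symm x, ⟨(sphMap n T).symm x, by simpa using hx, rfl⟩, ?_⟩
    have h' : T y = r • (x : EuclideanSpace ℝ (Fin (n + 1))) := h.symm
    rw [← T.symm_apply_apply y, h']
    simp

/-- The reflection in the `i`-th coordinate preserves the measure and reverses the sign of the
integrand. -/
theorem integral_zonal_coord (n : ℕ) (φ : ℝ → ℝ) {i : Fin (n + 1)} (hi : i ≠ 0) :
    ∫ x : Sph n, φ ((x : EuclideanSpace ℝ (Fin (n + 1))) 0) *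
      (x : EuclideanSpace ℝ (Fin (n + 1))) i ∂(surf n) = 0 := by
  have h := (measurePreserving_sphMap n (coordReflection n i)).integral_comp
    (sphMap n (coordReflection n i)).measurableEmbedding
    (fun x : Sph n => φ ((x : EuclideanSpace ℝ (Fin (n + 1))) 0) *
      (x : EuclideanSpace ℝ (Fin (n + 1))) i)
  have h2 : ∀ x : Sph n, φ ((sphMap n (coordReflection n i) x : EuclideanSpace ℝ (Fin (n + 1))) 0) *
      (sphMap n (coordReflection n i) x : EuclideanSpace ℝ (Fin (n + 1))) i =
      - (φ ((x : EuclideanSpace ℝ (Fin (n + 1))) 0) *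
      (x : EuclideanSpace ℝ (Fin (n + 1))) i) := by
    intro x
    have a : (sphMap n (coordReflection n i) x : EuclideanSpace ℝ (Fin (n + 1))) =
      coordReflection n i x := rfl
    rw [a, coordReflection_self, coordReflection_of_ne n hi.symm]
    ring
  simp_rw [h2, integral_neg] at h
  linarith

instance (n : ℕ) : IsFiniteMeasure (surf n) := by unfold surf; infer_instance

theorem first_mem_Icc (n : ℕ) (x : Sph n) :
    (x : EuclideanSpace ℝ (Fin (n + 1))) 0 ∈ Icc (-1 : ℝ) 1 := by
  have h1 : ‖(x : EuclideanSpace ℝ (Fin (n + 1)))‖ = 1 := norm_eq_of_mem_sphere x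
  have h2 := PiLp.norm_apply_le (x : EuclideanSpace ℝ (Fin (n + 1))) 0
  rw [h1, Real.norm_eq_abs, abs_le] at h2
  exact h2

theorem norm_firstMoment (n : ℕ) (hn : 1 ≤ n) {f : Sph n → ℂ} (hf : Continuous f) {φ : ℝ → ℂ}
    (hφ : ∀ x : Sph n, f x = φ ((x : EuclideanSpace ℝ (Fin (n + 1))) 0))
    (hc : ContinuousOn φ (Ioo (-1) 1)) :
    ‖firstMoment n f‖ = |zonalConst n hn * ∫ θ in (0 : ℝ)..Real.pi,
      Real.sin θ ^ (n - 1) * (Real.cos θ * ‖φ (Real.cos θ)‖ ^ 2)| := by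
  have hint : Integrable (fun x : Sph n =>
      ‖f x‖ ^ 2 • (x : EuclideanSpace ℝ (Fin (n + 1)))) (surf n) := by
    refine Continuous.integrable_of_hasCompactSupport (by fun_prop) ?_
    exact HasCompactSupport.of_compactSpace _
  have hcomp : ∀ i, firstMoment n f i = ∫ x : Sph n, ‖f x‖ ^ 2 *
      (x : EuclideanSpace ℝ (Fin (n + 1))) i ∂(surf n) := by
    intro i
    have := (EuclideanSpace.proj (𝕜 := ℝ) i).integral_comp_comm hint
    rw [firstMoment]
    simpa using this.symm
  have h0 : firstMoment n f = EuclideanSpace.single 0 (firstMoment n f 0) := by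
    ext i
    by_cases hi : i = 0
    · subst hi; simp
    · rw [hcomp]
      simp_rw [hφ]
      rw [integral_zonal_coord n (fun t => ‖φ t‖ ^ 2) hi]
      simp [hi]
  rw [h0, PiLp.norm_single, Real.norm_eq_abs, hcomp,
    integral_zonal n hn (ψ := fun t => ‖φ t‖ ^ 2 * t) (fun x _ => by rw [hφ]) (by fun_prop)]
  simp only [smul_eq_mul]
  simp_rw [mul_comm (Real.cos _)]

/-! ### Profiles of zonal functions and the Laplace-Beltrami operator. -/

/-- The great circle through the pole `e₀` in the plane of the first two coordinates. -/
def meridian (n : ℕ) (θ : ℝ) : EuclideanSpace ℝ (Fin (n + 1)) :=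
  Real.cos θ • EuclideanSpace.single 0 1 + Real.sin θ • EuclideanSpace.single (Fin.last n) 1

theorem meridian_zero (n : ℕ) (hn : 1 ≤ n) (θ : ℝ) : meridian n θ 0 = Real.cos θ := by
  have : (0 : Fin (n + 1)) ≠ Fin.last n := by
    intro h; have := congrArg Fin.val h; simp at this; omega
  simp [meridian, this]

theorem meridian_mem (n : ℕ) (hn : 1 ≤ n) (θ : ℝ) :
    meridian n θ ∈ sphere (0 : EuclideanSpace ℝ (Fin (n + 1))) 1 := by
  have h0 : (0 : Fin (n + 1)) ≠ Fin.last n := by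
    intro h; have := congrArg Fin.val h; simp at this; omega
  rw [mem_sphere_zero_iff_norm, ← pow_left_inj₀ (norm_nonneg _) zero_le_one two_ne_zero, one_pow,
    meridian, norm_add_sq_real]
  simp [norm_smul, inner_smul_left, inner_smul_right, h0, EuclideanSpace.inner_single_left]

/-- Restriction of `f` to a great circle through the pole. In the angle the profile is regular at
the poles too, which the boundary terms of later integrations by parts require; in `t = cos θ` it is
controlled only on `(-1, 1)`. -/
theorem contDiff_zonal (n : ℕ) (hn : 1 ≤ n) {f : Sph n → ℂ} (hf : ContMDiff (𝓡 n) 𝓘(ℝ, ℂ) 2 f)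
    {φ : ℝ → ℂ} (hφ : ∀ x : Sph n, f x = φ ((x : EuclideanSpace ℝ (Fin (n + 1))) 0)) :
    ContDiff ℝ 2 (fun θ => φ (Real.cos θ)) := by
  have : Fact (Module.finrank ℝ (EuclideanSpace ℝ (Fin (n + 1))) = n + 1) := ⟨by simp⟩
  have h1 : ContMDiff 𝓘(ℝ, ℝ) 𝓘(ℝ, EuclideanSpace ℝ (Fin (n + 1))) 2 (meridian n) := by
    apply ContDiff.contMDiff
    unfold meridian
    exact (Real.contDiff_cos.smul contDiff_const).add (Real.contDiff_sin.smul contDiff_const)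
  have h2 := h1.codRestrict_sphere (n := n) (meridian_mem n hn)
  have h3 := (hf.comp h2).contDiff
  convert h3 using 1
  ext θ
  simp only [Function.comp_apply, hφ, Set.codRestrict]
  rw [← meridian_zero n hn]

theorem contDiffOn_profile {φ : ℝ → ℂ} (h : ContDiff ℝ 2 (fun θ => φ (Real.cos θ))) :
    ContDiffOn ℝ 2 φ (Ioo (-1) 1) := by
  have h1 : ContDiffOn ℝ 2 Real.arccos (Ioo (-1) 1) := fun t ht =>
    (Real.contDiffAt_arccos ht.1.ne' ht.2.ne).contDiffWithinAt
  refine (h.comp_contDiffOn h1).congr (fun t ht => ?_)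
  simp [Real.cos_arccos ht.1.le ht.2.le]

theorem iteratedFDeriv_two_of_line {E F : Type*} [NormedAddCommGroup E] [NormedSpace ℝ E]
    [NormedAddCommGroup F] [NormedSpace ℝ F] {g : E → F} {x v : E} {G : ℝ → F} {c : F}
    (hg : ContDiffAt ℝ 2 g x)
    (hG : ∀ᶠ s in 𝓝 (0 : ℝ), HasDerivAt (fun s => g (x + s • v)) (G s) s)
    (hc : HasDerivAt G c 0) : iteratedFDeriv ℝ 2 g x ![v, v] = c := by
  have hl : ∀ s : ℝ, HasDerivAt (fun s : ℝ => x + s • v) v s := fun s => by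
    simpa using ((hasDerivAt_id s).smul_const v).const_add x
  have hl0 : Tendsto (fun s : ℝ => x + s • v) (𝓝 0) (𝓝 x) := by
    have := (hl 0).continuousAt.tendsto
    simpa using this
  have hd : ∀ᶠ y in 𝓝 x, DifferentiableAt ℝ g y := by
    filter_upwards [hg.eventually (by simp)] with y hy using hy.differentiableAt two_ne_zero
  have h1 : G =ᶠ[𝓝 0] fun s => fderiv ℝ g (x + s • v) v := by
    filter_upwards [hG, hl0.eventually hd] with s hs hs'
    exact hs.unique (hs'.hasFDerivAt.comp_hasDerivAt s (hl s))
  have h2 : DifferentiableAt ℝ (fderiv ℝ g) x :=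
    (hg.fderiv_right (m := 1) one_add_one_eq_two.le).differentiableAt one_ne_zero
  have h3 : HasDerivAt (fun s : ℝ => fderiv ℝ g (x + s • v) v) (fderiv ℝ (fderiv ℝ g) x v v) 0 := by
    have h2' : HasFDerivAt (fderiv ℝ g) (fderiv ℝ (fderiv ℝ g) x) (x + (0 : ℝ) • v) := by
      simpa using h2.hasFDerivAt
    have h4 : HasDerivAt (fun s : ℝ => fderiv ℝ g (x + s • v)) (fderiv ℝ (fderiv ℝ g) x v) 0 :=
      HasFDerivAt.comp_hasDerivAt (f := fun s : ℝ => x + s • v) (0 : ℝ) h2' (hl 0)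
    exact ((ContinuousLinearMap.apply ℝ F v).hasFDerivAt).comp_hasDerivAt (0 : ℝ) h4
  rw [iteratedFDeriv_two_apply]
  simpa using (h3.congr_of_eventuallyEq h1).unique hc

theorem hasDerivAt_profile {φ : ℝ → ℂ} (hc : ContDiffOn ℝ 2 φ (Ioo (-1) 1)) {t : ℝ}
    (ht : t ∈ Ioo (-1 : ℝ) 1) : HasDerivAt φ (deriv φ t) t :=
  ((hc.contDiffAt (Ioo_mem_nhds ht.1 ht.2)).differentiableAt two_ne_zero).hasDerivAt

theorem hasDerivAt_deriv_profile {φ : ℝ → ℂ} (hc : ContDiffOn ℝ 2 φ (Ioo (-1) 1)) {t : ℝ}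
    (ht : t ∈ Ioo (-1 : ℝ) 1) : HasDerivAt (deriv φ) (deriv (deriv φ) t) t :=
  (((hc.deriv_of_isOpen (m := 1) isOpen_Ioo one_add_one_eq_two.le).contDiffAt
    (Ioo_mem_nhds ht.1 ht.2)).differentiableAt one_ne_zero).hasDerivAt

theorem norm_add_smul_single (n : ℕ) (x : Sph n) (i : Fin (n + 1)) (s : ℝ) :
    ‖(x : EuclideanSpace ℝ (Fin (n + 1))) + s • EuclideanSpace.single i (1 : ℝ)‖ =
      Real.sqrt (1 + 2 * s * (x : EuclideanSpace ℝ (Fin (n + 1))) i + s ^ 2) := by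
  have h1 : ‖(x : EuclideanSpace ℝ (Fin (n + 1)))‖ = 1 := norm_eq_of_mem_sphere x
  have h2 : ‖(x : EuclideanSpace ℝ (Fin (n + 1))) + s • EuclideanSpace.single i (1 : ℝ)‖ ^ 2 =
      1 + 2 * s * (x : EuclideanSpace ℝ (Fin (n + 1))) i + s ^ 2 := by
    rw [norm_add_sq_real, h1, inner_smul_right, norm_smul, EuclideanSpace.inner_single_right]
    simp
    ring
  rw [← h2, Real.sqrt_sq (norm_nonneg _)]

/-- Near `x` the radial extension is `φ(y₀/|y|)`; its second derivatives along the coordinate lines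
are summed using `|x| = 1`. -/
theorem laplaceBeltrami_zonal (n : ℕ) {f : Sph n → ℂ} {φ : ℝ → ℂ}
    (hφ : ∀ x : Sph n, f x = φ ((x : EuclideanSpace ℝ (Fin (n + 1))) 0))
    (hc : ContDiffOn ℝ 2 φ (Ioo (-1) 1)) (x : Sph n) {t : ℝ}
    (hxt : (x : EuclideanSpace ℝ (Fin (n + 1))) 0 = t) (ht : t ∈ Ioo (-1 : ℝ) 1) :
    laplaceBeltrami n f x = (1 - t ^ 2) • deriv (deriv φ) t - (n * t) • deriv φ t := by
  have h1 : ‖(x : EuclideanSpace ℝ (Fin (n + 1)))‖ = 1 := norm_eq_of_mem_sphere x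
  have hx0 : (x : EuclideanSpace ℝ (Fin (n + 1))) ≠ 0 := by
    intro h; rw [h, norm_zero] at h1; exact zero_ne_one h1
  set g : EuclideanSpace ℝ (Fin (n + 1)) → ℂ := fun y => φ (‖y‖⁻¹ * y 0) with hg
  have hev : radialExt n f =ᶠ[𝓝 (x : EuclideanSpace ℝ (Fin (n + 1)))] g := by
    filter_upwards [isOpen_ne.mem_nhds hx0] with y hy
    have hy' : y ≠ 0 := hy
    rw [radialExt, dif_neg hy', hφ]
    simp [hg]
  have hu : ContDiffAt ℝ 2 (fun y : EuclideanSpace ℝ (Fin (n + 1)) => ‖y‖⁻¹ * y 0) x := by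
    have h2 : ContDiffAt ℝ 2 (fun y : EuclideanSpace ℝ (Fin (n + 1)) => y 0) x := by fun_prop
    exact ((contDiffAt_norm ℝ hx0).inv (by rw [h1]; exact one_ne_zero)).mul h2
  have hgc : ContDiffAt ℝ 2 g x := by
    have h3 : ContDiffAt ℝ 2 φ (‖(x : EuclideanSpace ℝ (Fin (n + 1)))‖⁻¹ *
        (x : EuclideanSpace ℝ (Fin (n + 1))) 0) := by
      rw [h1, hxt, inv_one, one_mul]
      exact hc.contDiffAt (Ioo_mem_nhds ht.1 ht.2)
    exact h3.comp (x : EuclideanSpace ℝ (Fin (n + 1))) hu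
  -- On the line `x + s eᵢ` the argument of `φ` is `U(s) = (t + s δ)/|x + s eᵢ|` with `δ = δ_{i0}`,
  -- and `U'(0) = δ - t xᵢ`, `U''(0) = -2 δ xᵢ - t + 3 t xᵢ²`.
  have key : ∀ i : Fin (n + 1), iteratedFDeriv ℝ 2 g x
      ![EuclideanSpace.single i (1 : ℝ), EuclideanSpace.single i (1 : ℝ)] =
      (((if i = 0 then 1 else 0) - t * (x : EuclideanSpace ℝ (Fin (n + 1))) i) ^ 2) •
        deriv (deriv φ) t +
      (-2 * (if i = 0 then 1 else 0) * (x : EuclideanSpace ℝ (Fin (n + 1))) i - t +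
        3 * t * (x : EuclideanSpace ℝ (Fin (n + 1))) i ^ 2) • deriv φ t := by
    intro i
    set d : ℝ := if i = 0 then 1 else 0 with hd
    set a : ℝ := (x : EuclideanSpace ℝ (Fin (n + 1))) i with ha
    set R : ℝ → ℝ := fun s => Real.sqrt (1 + 2 * s * a + s ^ 2) with hR
    set U : ℝ → ℝ := fun s => (R s)⁻¹ * (t + s * d) with hU
    set V : ℝ → ℝ := fun s => (R s)⁻¹ * d - (t + s * d) * (a + s) * (R s)⁻¹ ^ 3 with hV
    have hline : ∀ s : ℝ, g (x + s • EuclideanSpace.single i (1 : ℝ)) = φ (U s) := by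
      intro s
      simp only [hg, hU, hR]
      rw [norm_add_smul_single, PiLp.add_apply, hxt]
      congr 3
      simp [hd, eq_comm]
    have hR0 : R 0 = 1 := by simp [hR]
    have hRc : Continuous R := by fun_prop
    have hRpos : ∀ᶠ s in 𝓝 (0 : ℝ), 0 < R s :=
      hRc.continuousAt.eventually_const_lt (by rw [hR0]; exact one_pos)
    have hRd : ∀ s, 0 < R s → HasDerivAt R ((a + s) * (R s)⁻¹) s := by
      intro s hs
      have hN : 0 < 1 + 2 * s * a + s ^ 2 := Real.sqrt_pos.1 hs
      have h := (((((hasDerivAt_id s).const_mul 2).mul_const a).const_add 1).add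
        ((hasDerivAt_id s).pow 2)).sqrt hN.ne'
      refine h.congr_deriv ?_
      change (2 * 1 * a + ((2 : ℕ) : ℝ) * s ^ (2 - 1) * 1) / (2 * R s) = _
      field_simp
      norm_num
      ring
    have hRid : ∀ s, 0 < R s → HasDerivAt (fun s => (R s)⁻¹) (-(a + s) * (R s)⁻¹ ^ 3) s := by
      intro s hs
      refine ((hRd s hs).inv hs.ne').congr_deriv ?_
      field_simp
    have hl : ∀ s, HasDerivAt (fun s => t + s * d) d s := fun s => by
      simpa using ((hasDerivAt_id s).mul_const d).const_add t
    have hUd : ∀ s, 0 < R s → HasDerivAt U (V s) s := by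
      intro s hs
      refine ((hRid s hs).mul (hl s)).congr_deriv ?_
      simp only [hV]
      ring
    have hU0 : U 0 = t := by simp [hU, hR0]
    have hUmem : ∀ᶠ s in 𝓝 (0 : ℝ), U s ∈ Ioo (-1 : ℝ) 1 := by
      have : ContinuousAt U 0 := (hUd 0 (by rw [hR0]; exact one_pos)).continuousAt
      exact this.eventually (by rw [hU0]; exact Ioo_mem_nhds ht.1 ht.2)
    refine iteratedFDeriv_two_of_line (G := fun s => V s • deriv φ (U s)) hgc ?_ ?_
    · filter_upwards [hRpos, hUmem] with s hs hm
      simp_rw [hline]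
      exact (hasDerivAt_profile hc hm).scomp s (hUd s hs)
    · have h0 : 0 < R 0 := by rw [hR0]; exact one_pos
      have hV0 : V 0 = d - t * a := by simp [hV, hR0]
      have hVd : HasDerivAt V (-2 * d * a - t + 3 * t * a ^ 2) 0 := by
        have e1 := (hRid 0 h0).mul_const d
        have e2 := ((hl 0).mul ((hasDerivAt_id (0 : ℝ)).const_add a)).mul ((hRid 0 h0).pow 3)
        refine (e1.sub e2).congr_deriv ?_
        simp [hR0]
        ring
      have hUm0 : U 0 ∈ Ioo (-1 : ℝ) 1 := by rw [hU0]; exact ht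
      have e3 := hVd.smul ((hasDerivAt_deriv_profile hc hUm0).scomp (0 : ℝ) (hUd 0 h0))
      refine e3.congr_deriv ?_
      simp only [Function.comp_apply, hV0, hU0, smul_smul]
      rw [sq (d - t * a)]
  rw [laplaceBeltrami, (InnerProductSpace.laplacian_congr_nhds hev).eq_of_nhds,
    InnerProductSpace.laplacian_eq_iteratedFDeriv_orthonormalBasis g
      (EuclideanSpace.basisFun (Fin (n + 1)) ℝ)]
  simp only [EuclideanSpace.basisFun_apply]
  rw [Finset.sum_congr rfl (fun i _ => key i), Finset.sum_add_distrib, ← Finset.sum_smul,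
    ← Finset.sum_smul]
  have hs : ∑ i, (x : EuclideanSpace ℝ (Fin (n + 1))) i ^ 2 = 1 := by
    have := EuclideanSpace.norm_sq_eq (x : EuclideanSpace ℝ (Fin (n + 1)))
    rw [h1] at this
    simpa using this.symm
  have hs' : t ^ 2 + ∑ i : Fin n, (x : EuclideanSpace ℝ (Fin (n + 1))) i.succ ^ 2 = 1 := by
    rw [Fin.sum_univ_succ, hxt] at hs; exact hs
  have c1 : ∑ i : Fin (n + 1), (((if i = 0 then 1 else 0) - t *
      (x : EuclideanSpace ℝ (Fin (n + 1))) i) ^ 2) = 1 - t ^ 2 := by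
    rw [Fin.sum_univ_succ]
    simp only [Fin.succ_ne_zero, if_true, if_false, zero_sub, neg_sq, mul_pow, hxt]
    rw [← Finset.mul_sum]
    linear_combination t ^ 2 * hs'
  have c2 : ∑ i : Fin (n + 1), (-2 * (if i = 0 then 1 else 0) *
      (x : EuclideanSpace ℝ (Fin (n + 1))) i - t +
        3 * t * (x : EuclideanSpace ℝ (Fin (n + 1))) i ^ 2) = - (n * t) := by
    rw [Fin.sum_univ_succ]
    simp only [Fin.succ_ne_zero, if_true, if_false, hxt, mul_zero, zero_mul, zero_sub]
    rw [Finset.sum_add_distrib, ← Finset.mul_sum]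
    simp only [Finset.sum_const, Finset.card_univ, Fintype.card_fin, nsmul_eq_mul]
    linear_combination 3 * t * hs'
  rw [c1, c2, neg_smul, ← sub_eq_add_neg]

/-- `(sin^(n-1) h')'`, the Laplace-Beltrami operator on zonal functions in the polar angle,
multiplied by the weight. -/
def lapTheta {𝕜 : Type*} [RCLike 𝕜] (n : ℕ) (h : ℝ → 𝕜) (θ : ℝ) : 𝕜 :=
  Real.sin θ ^ (n - 1) • deriv (deriv h) θ +
    (((n - 1 : ℕ) : ℝ) * Real.sin θ ^ (n - 1 - 1) * Real.cos θ) • deriv h θ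

section

variable {𝕜 : Type*} [RCLike 𝕜]

theorem hasDerivAt_of_contDiff_two {h : ℝ → 𝕜} (hh : ContDiff ℝ 2 h) (θ : ℝ) :
    HasDerivAt h (deriv h θ) θ :=
  (hh.differentiable two_ne_zero θ).hasDerivAt

theorem hasDerivAt_deriv_of_contDiff_two {h : ℝ → 𝕜} (hh : ContDiff ℝ 2 h) (θ : ℝ) :
    HasDerivAt (deriv h) (deriv (deriv h) θ) θ := by
  have : ContDiff ℝ 1 (deriv h) := (contDiff_succ_iff_deriv (n := 1)).1 hh |>.2.2
  exact (this.differentiable one_ne_zero θ).hasDerivAt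

theorem continuous_deriv_of_contDiff_two {h : ℝ → 𝕜} (hh : ContDiff ℝ 2 h) :
    Continuous (deriv h) := hh.continuous_deriv one_le_two

theorem continuous_deriv_deriv_of_contDiff_two {h : ℝ → 𝕜} (hh : ContDiff ℝ 2 h) :
    Continuous (deriv (deriv h)) := by
  have : ContDiff ℝ 1 (deriv h) := (contDiff_succ_iff_deriv (n := 1)).1 hh |>.2.2
  exact this.continuous_deriv le_rfl

theorem continuous_lapTheta (n : ℕ) {h : ℝ → 𝕜} (hh : ContDiff ℝ 2 h) :
    Continuous (lapTheta n h) := by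
  have h1 := continuous_deriv_of_contDiff_two hh
  have h2 := continuous_deriv_deriv_of_contDiff_two hh
  unfold lapTheta
  fun_prop

theorem hasDerivAt_weight_deriv (n : ℕ) {h : ℝ → 𝕜} (hh : ContDiff ℝ 2 h) (θ : ℝ) :
    HasDerivAt (fun θ => Real.sin θ ^ (n - 1) • deriv h θ) (lapTheta n h θ) θ :=
  ((Real.hasDerivAt_sin θ).pow (n - 1)).smul (hasDerivAt_deriv_of_contDiff_two hh θ)

/-- Green's formula: the boundary terms carry `sin^(n-1)`, which vanishes at `0` and `π` since `n ≥
2`. -/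
theorem integral_lapTheta_mul (n : ℕ) (hn : 2 ≤ n) {h k : ℝ → 𝕜} (hh : ContDiff ℝ 2 h)
    (hk : ContDiff ℝ 2 k) :
    ∫ θ in (0 : ℝ)..Real.pi, lapTheta n h θ * k θ =
      -∫ θ in (0 : ℝ)..Real.pi, Real.sin θ ^ (n - 1) • (deriv h θ * deriv k θ) := by
  have h1 := continuous_deriv_of_contDiff_two hh
  have h2 := continuous_deriv_of_contDiff_two hk
  have h3 := continuous_lapTheta n hh
  have h4 := intervalIntegral.integral_deriv_mul_eq_sub
    (a := 0) (b := Real.pi) (u := fun θ => Real.sin θ ^ (n - 1) • deriv h θ) (v := k)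
    (fun θ _ => hasDerivAt_weight_deriv n hh θ)
    (fun θ _ => hasDerivAt_of_contDiff_two hk θ)
    (h3.intervalIntegrable _ _) (h2.intervalIntegrable _ _)
  have h5 : n - 1 ≠ 0 := by omega
  simp only [Real.sin_pi, Real.sin_zero, zero_pow h5, zero_smul, zero_mul, sub_zero] at h4
  simp only [smul_mul_assoc] at h4
  have hkc := hk.continuous
  rw [intervalIntegral.integral_add (Continuous.intervalIntegrable (by fun_prop) _ _)
    (Continuous.intervalIntegrable (by fun_prop) _ _)] at h4
  exact eq_neg_of_add_eq_zero_left h4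

end

theorem lapTheta_profile (n : ℕ) (hn : 2 ≤ n) {φ : ℝ → ℂ} (hc : ContDiffOn ℝ 2 φ (Ioo (-1) 1))
    {θ : ℝ} (hθ : θ ∈ Ioo 0 Real.pi) :
    lapTheta n (fun θ => φ (Real.cos θ)) θ = Real.sin θ ^ (n - 1) •
      ((1 - Real.cos θ ^ 2) • deriv (deriv φ) (Real.cos θ) -
        (n * Real.cos θ) • deriv φ (Real.cos θ)) := by
  have hd : ∀ θ ∈ Ioo 0 Real.pi, HasDerivAt (fun θ => φ (Real.cos θ))
      ((-Real.sin θ) • deriv φ (Real.cos θ)) θ := fun θ hθ =>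
    (hasDerivAt_profile hc (cos_mem_Ioo hθ)).scomp θ (Real.hasDerivAt_cos θ)
  have hev : deriv (fun θ => φ (Real.cos θ)) =ᶠ[𝓝 θ]
      fun θ => (-Real.sin θ) • deriv φ (Real.cos θ) := by
    filter_upwards [Ioo_mem_nhds hθ.1 hθ.2] with s hs using (hd s hs).deriv
  have hd2 := (Real.hasDerivAt_sin θ).neg.smul
    ((hasDerivAt_deriv_profile hc (cos_mem_Ioo hθ)).scomp θ (Real.hasDerivAt_cos θ))
  rw [lapTheta, hev.deriv_eq, (hd θ hθ).deriv]
  erw [hd2.deriv]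
  -- This turns the truncated exponents `n - 1` and `n - 1 - 1` into `m + 1` and `m`.
  obtain ⟨m, rfl⟩ : ∃ m, n = m + 2 := ⟨n - 2, by omega⟩
  have h3 : m + 2 - 1 = m + 1 := rfl
  simp only [h3, Nat.add_sub_cancel, smul_smul, smul_sub, smul_add, Function.comp_apply, Pi.neg_apply]
  have : 1 - Real.cos θ ^ 2 = Real.sin θ ^ 2 := by rw [Real.sin_sq]
  rw [this]
  simp only [Complex.real_smul]
  push_cast
  ring

/-! ### The uncertainty product as an expression in three integrals. -/

/-- The integrals that determine the uncertainty product of a zonal function with profile `h` in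
the polar angle. -/
def massInt (n : ℕ) (h : ℝ → ℂ) : ℝ :=
  ∫ θ in (0 : ℝ)..Real.pi, Real.sin θ ^ (n - 1) * ‖h θ‖ ^ 2

/-- The first moment of a profile. -/
def momentInt (n : ℕ) (h : ℝ → ℂ) : ℝ :=
  ∫ θ in (0 : ℝ)..Real.pi, Real.sin θ ^ (n - 1) * (Real.cos θ * ‖h θ‖ ^ 2)

/-- The Dirichlet energy of a profile. -/
def energyInt (n : ℕ) (h : ℝ → ℂ) : ℝ :=
  ∫ θ in (0 : ℝ)..Real.pi, Real.sin θ ^ (n - 1) * ‖deriv h θ‖ ^ 2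

theorem integral_laplaceBeltrami_mul_conj (n : ℕ) (hn : 2 ≤ n) {f : Sph n → ℂ} {φ : ℝ → ℂ}
    (hφ : ∀ x : Sph n, f x = φ ((x : EuclideanSpace ℝ (Fin (n + 1))) 0))
    (hh : ContDiff ℝ 2 (fun θ => φ (Real.cos θ))) :
    ∫ x, laplaceBeltrami n f x * (starRingEnd ℂ) (f x) ∂(surf n) =
      -((zonalConst n (by omega) * energyInt n (fun θ => φ (Real.cos θ)) : ℝ) : ℂ) := by
  have hc := contDiffOn_profile hh
  set h : ℝ → ℂ := fun θ => φ (Real.cos θ) with hdef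
  have c0 : ContinuousOn φ (Ioo (-1) 1) := hc.continuousOn
  have c1 : ContinuousOn (deriv φ) (Ioo (-1) 1) := fun t ht =>
    (hasDerivAt_deriv_profile hc ht).continuousAt.continuousWithinAt
  have c2 : ContinuousOn (deriv (deriv φ)) (Ioo (-1) 1) :=
    (hc.deriv_of_isOpen (m := 1) isOpen_Ioo one_add_one_eq_two.le).continuousOn_deriv_of_isOpen
      isOpen_Ioo le_rfl
  have hk : ContDiff ℝ 2 (fun θ => (starRingEnd ℂ) (h θ)) :=
    Complex.conjCLE.contDiff.comp hh
  rw [integral_zonal n (by omega) (ψ := fun t => ((1 - t ^ 2) • deriv (deriv φ) t -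
    (n * t) • deriv φ t) * (starRingEnd ℂ) (φ t))
    (fun x hx => by rw [laplaceBeltrami_zonal n hφ hc x rfl hx, hφ])
    (by
      have d1 : ContinuousOn (fun t : ℝ => 1 - t ^ 2) (Ioo (-1) 1) := by fun_prop
      have d2 : ContinuousOn (fun t : ℝ => n * t) (Ioo (-1) 1) := by fun_prop
      refine ((d1.smul c2).sub (d2.smul c1)).mul ?_
      exact Complex.continuous_conj.comp_continuousOn c0)]
  have e1 : ∫ θ in (0 : ℝ)..Real.pi, Real.sin θ ^ (n - 1) •
      (((1 - Real.cos θ ^ 2) • deriv (deriv φ) (Real.cos θ) -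
    (n * Real.cos θ) • deriv φ (Real.cos θ)) * (starRingEnd ℂ) (φ (Real.cos θ))) =
      ∫ θ in (0 : ℝ)..Real.pi, lapTheta n h θ * (starRingEnd ℂ) (h θ) := by
    rw [intervalIntegral.integral_of_le Real.pi_pos.le,
      intervalIntegral.integral_of_le Real.pi_pos.le, integral_Ioc_eq_integral_Ioo,
      integral_Ioc_eq_integral_Ioo]
    refine setIntegral_congr_fun measurableSet_Ioo (fun θ hθ => ?_)
    simp only [hdef]
    rw [lapTheta_profile n hn hc hθ, smul_mul_assoc]
  rw [e1, integral_lapTheta_mul n hn hh hk, energyInt]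
  rw [Complex.ofReal_mul, ← intervalIntegral.integral_ofReal, Complex.real_smul, ← mul_neg]
  congr 3
  ext θ
  have e2 : deriv (fun θ => (starRingEnd ℂ) (h θ)) θ = (starRingEnd ℂ) (deriv h θ) :=
    (Complex.conjCLE.toContinuousLinearMap.hasFDerivAt.comp_hasDerivAt θ
      (hasDerivAt_of_contDiff_two hh θ)).deriv
  rw [e2, Complex.mul_conj, Complex.normSq_eq_norm_sq, Complex.real_smul]
  push_cast
  rfl

/-- `zonalConst` cancels in every quotient, and the absolute value from the norm of the moment
disappears under the square. -/
theorem uncertainty_zonal (n : ℕ) (hn : 2 ≤ n) {f : Sph n → ℂ}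
    (hf : ContMDiff (𝓡 n) 𝓘(ℝ, ℂ) 2 f) {φ : ℝ → ℂ}
    (hφ : ∀ x : Sph n, f x = φ ((x : EuclideanSpace ℝ (Fin (n + 1))) 0)) :
    (firstMoment n f ≠ 0 ↔ momentInt n (fun θ => φ (Real.cos θ)) ≠ 0) ∧
    uncertainty n f =
      Real.sqrt ((massInt n (fun θ => φ (Real.cos θ)) /
        momentInt n (fun θ => φ (Real.cos θ))) ^ 2 - 1) *
      Real.sqrt (energyInt n (fun θ => φ (Real.cos θ)) /
        massInt n (fun θ => φ (Real.cos θ))) := by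
  have hn1 : 1 ≤ n := by omega
  have hh := contDiff_zonal n hn1 hf hφ
  have hc := contDiffOn_profile hh
  have c0 : ContinuousOn φ (Ioo (-1) 1) := hc.continuousOn
  have hpos := zonalConst_pos n hn1
  have hM := norm_firstMoment n hn1 hf.continuous hφ c0
  have hN : ∫ x, ‖f x‖ ^ 2 ∂(surf n) =
      zonalConst n hn1 * massInt n (fun θ => φ (Real.cos θ)) := by
    rw [integral_zonal n hn1 (ψ := fun t => ‖φ t‖ ^ 2) (fun x _ => by rw [hφ]) (by fun_prop)]
    rfl
  have hE := integral_laplaceBeltrami_mul_conj n hn hφ hh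
  constructor
  · rw [← norm_ne_zero_iff, hM, abs_ne_zero]
    simp only [ne_eq, mul_eq_zero, hpos.ne', false_or]
    rfl
  · have hvS : varS n f = (massInt n (fun θ => φ (Real.cos θ)) /
        momentInt n (fun θ => φ (Real.cos θ))) ^ 2 - 1 := by
      rw [varS, hM, hN, abs_mul, abs_of_pos hpos, mul_div_mul_left _ _ hpos.ne', div_pow, sq_abs,
        div_pow]
      rfl
    have hvM : varM n f = energyInt n (fun θ => φ (Real.cos θ)) /
        massInt n (fun θ => φ (Real.cos θ)) := by
      rw [varM, hE, hN, ← Complex.ofReal_neg, Complex.ofReal_re, neg_neg,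
        mul_div_mul_left _ _ hpos.ne']
    rw [uncertainty, hvS, hvM]

/-! ### The lower bound `n/2`. -/

theorem weight_nonneg (n : ℕ) {θ : ℝ} (hθ : θ ∈ Icc 0 Real.pi) : 0 ≤ Real.sin θ ^ (n - 1) :=
  pow_nonneg (Real.sin_nonneg_of_nonneg_of_le_pi hθ.1 hθ.2) _

theorem sq_integral_weight_mul_le (n : ℕ) {a b : ℝ → ℝ} (ha : Continuous a) (hb : Continuous b) :
    (∫ θ in (0 : ℝ)..Real.pi, Real.sin θ ^ (n - 1) * (a θ * b θ)) ^ 2 ≤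
      (∫ θ in (0 : ℝ)..Real.pi, Real.sin θ ^ (n - 1) * a θ ^ 2) *
      ∫ θ in (0 : ℝ)..Real.pi, Real.sin θ ^ (n - 1) * b θ ^ 2 := by
  set A := ∫ θ in (0 : ℝ)..Real.pi, Real.sin θ ^ (n - 1) * a θ ^ 2
  set B := ∫ θ in (0 : ℝ)..Real.pi, Real.sin θ ^ (n - 1) * b θ ^ 2
  set C := ∫ θ in (0 : ℝ)..Real.pi, Real.sin θ ^ (n - 1) * (a θ * b θ)
  have key : ∀ x : ℝ, 0 ≤ A * (x * x) + 2 * C * x + B := by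
    intro x
    have h1 : 0 ≤ ∫ θ in (0 : ℝ)..Real.pi, Real.sin θ ^ (n - 1) * (x * a θ + b θ) ^ 2 :=
      intervalIntegral.integral_nonneg Real.pi_pos.le
        (fun θ hθ => mul_nonneg (weight_nonneg n hθ) (sq_nonneg _))
    have h2 : ∫ θ in (0 : ℝ)..Real.pi, Real.sin θ ^ (n - 1) * (x * a θ + b θ) ^ 2 =
        A * (x * x) + 2 * C * x + B := by
      have : ∀ θ, Real.sin θ ^ (n - 1) * (x * a θ + b θ) ^ 2 =
        (Real.sin θ ^ (n - 1) * a θ ^ 2) * (x * x) +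
          (Real.sin θ ^ (n - 1) * (a θ * b θ)) * (2 * x) + Real.sin θ ^ (n - 1) * b θ ^ 2 := by
        intro θ; ring
      simp_rw [this]
      rw [intervalIntegral.integral_add (Continuous.intervalIntegrable (by fun_prop) _ _)
        (Continuous.intervalIntegrable (by fun_prop) _ _),
        intervalIntegral.integral_add (Continuous.intervalIntegrable (by fun_prop) _ _)
        (Continuous.intervalIntegrable (by fun_prop) _ _),
        intervalIntegral.integral_mul_const, intervalIntegral.integral_mul_const]
      ring
    rw [← h2]; exact h1
  have := discrim_le_zero key
  unfold discrim at this
  nlinarith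

/-- The function `sin^n |h|²` vanishes at both ends, so its derivative integrates to zero. This
identity plays the part of the commutator relation in the uncertainty principle. -/
theorem dimension_mul_momentInt (n : ℕ) (hn : 2 ≤ n) {h : ℝ → ℂ} (hh : ContDiff ℝ 2 h) :
    n * momentInt n h = -(2 * ∫ θ in (0 : ℝ)..Real.pi, Real.sin θ ^ (n - 1) *
      (Real.sin θ * ⟪h θ, deriv h θ⟫_ℝ)) := by
  have hc := hh.continuous
  have hd := continuous_deriv_of_contDiff_two hh
  have h1 : ∀ θ ∈ uIcc 0 Real.pi, HasDerivAt (fun θ => Real.sin θ ^ n * ‖h θ‖ ^ 2)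
      ((n * Real.sin θ ^ (n - 1) * Real.cos θ) * ‖h θ‖ ^ 2 +
        Real.sin θ ^ n * (2 * ⟪h θ, deriv h θ⟫_ℝ)) θ := fun θ _ =>
    ((Real.hasDerivAt_sin θ).pow n).mul (hasDerivAt_of_contDiff_two hh θ).norm_sq
  have h2 := intervalIntegral.integral_eq_sub_of_hasDerivAt h1
    (Continuous.intervalIntegrable (by fun_prop) _ _)
  have h0 : n ≠ 0 := by omega
  simp only [Real.sin_pi, Real.sin_zero, zero_pow h0, zero_mul, sub_zero] at h2
  have h3 : ∀ θ, (n * Real.sin θ ^ (n - 1) * Real.cos θ) * ‖h θ‖ ^ 2 +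
        Real.sin θ ^ n * (2 * ⟪h θ, deriv h θ⟫_ℝ) =
      n * (Real.sin θ ^ (n - 1) * (Real.cos θ * ‖h θ‖ ^ 2)) +
        2 * (Real.sin θ ^ (n - 1) * (Real.sin θ * ⟪h θ, deriv h θ⟫_ℝ)) := by
    intro θ
    have : Real.sin θ ^ n = Real.sin θ ^ (n - 1) * Real.sin θ := by
      rw [← pow_succ, Nat.sub_add_cancel (by omega)]
    rw [this]; ring
  simp_rw [h3] at h2
  rw [intervalIntegral.integral_add (Continuous.intervalIntegrable (by fun_prop) _ _)
    (Continuous.intervalIntegrable (by fun_prop) _ _), intervalIntegral.integral_const_mul,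
    intervalIntegral.integral_const_mul] at h2
  rw [momentInt]
  linarith

/-- Two Cauchy-Schwarz estimates combine. Pairing `sin θ |h|` with `|h'|` gives `n² M² ≤ 4 P E`;
pairing `cos θ |h|` with `|h|` gives `M² ≤ (N - P) N`. Hence `n² M² N ≤ 4 P N E ≤ 4 (N² - M²) E`. -/
theorem half_dimension_le (n : ℕ) (hn : 2 ≤ n) {h : ℝ → ℂ} (hh : ContDiff ℝ 2 h)
    (hM : momentInt n h ≠ 0) :
    (n : ℝ) / 2 ≤ Real.sqrt ((massInt n h / momentInt n h) ^ 2 - 1) *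
      Real.sqrt (energyInt n h / massInt n h) := by
  have hc := hh.continuous
  have hd := continuous_deriv_of_contDiff_two hh
  set N := massInt n h with hN
  set M := momentInt n h with hMd
  set E := energyInt n h with hE
  set P := ∫ θ in (0 : ℝ)..Real.pi, Real.sin θ ^ (n - 1) * (Real.sin θ * ‖h θ‖) ^ 2 with hP
  have hP0 : 0 ≤ P := intervalIntegral.integral_nonneg Real.pi_pos.le
    (fun θ hθ => mul_nonneg (weight_nonneg n hθ) (sq_nonneg _))
  have hN0 : 0 ≤ N := intervalIntegral.integral_nonneg Real.pi_pos.le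
    (fun θ hθ => mul_nonneg (weight_nonneg n hθ) (sq_nonneg _))
  have hE0 : 0 ≤ E := intervalIntegral.integral_nonneg Real.pi_pos.le
    (fun θ hθ => mul_nonneg (weight_nonneg n hθ) (sq_nonneg _))
  have h1 := sq_integral_weight_mul_le n (a := fun θ => Real.sin θ * ‖h θ‖)
    (b := fun θ => ‖deriv h θ‖) (by fun_prop) (by fun_prop)
  have h2 : |(n : ℝ) * M| ≤ 2 * ∫ θ in (0 : ℝ)..Real.pi, Real.sin θ ^ (n - 1) *
      ((Real.sin θ * ‖h θ‖) * ‖deriv h θ‖) := by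
    rw [hMd, dimension_mul_momentInt n hn hh, abs_neg, abs_mul, abs_two]
    refine mul_le_mul_of_nonneg_left ?_ zero_le_two
    refine (intervalIntegral.abs_integral_le_integral_abs Real.pi_pos.le).trans ?_
    refine intervalIntegral.integral_mono_on Real.pi_pos.le
      (Continuous.intervalIntegrable (by fun_prop) _ _)
      (Continuous.intervalIntegrable (by fun_prop) _ _) (fun θ hθ => ?_)
    have hs := Real.sin_nonneg_of_nonneg_of_le_pi hθ.1 hθ.2
    rw [abs_mul, abs_mul, abs_of_nonneg (weight_nonneg n hθ), abs_of_nonneg hs, mul_assoc]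
    gcongr
    exact abs_real_inner_le_norm _ _
  have h3 : (n : ℝ) ^ 2 * M ^ 2 ≤ 4 * (P * E) := by
    have : ((n : ℝ) * M) ^ 2 ≤ (2 * ∫ θ in (0 : ℝ)..Real.pi, Real.sin θ ^ (n - 1) *
      ((Real.sin θ * ‖h θ‖) * ‖deriv h θ‖)) ^ 2 := by
      rw [← sq_abs ((n : ℝ) * M)]
      exact pow_le_pow_left₀ (abs_nonneg _) h2 2
    rw [mul_pow, mul_pow] at this
    have h1' : (∫ θ in (0 : ℝ)..Real.pi, Real.sin θ ^ (n - 1) *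
      ((Real.sin θ * ‖h θ‖) * ‖deriv h θ‖)) ^ 2 ≤ P * E := h1
    linarith
  have h4 := sq_integral_weight_mul_le n (a := fun θ => Real.cos θ * ‖h θ‖)
    (b := fun θ => ‖h θ‖) (by fun_prop) (by fun_prop)
  have h5 : ∫ θ in (0 : ℝ)..Real.pi, Real.sin θ ^ (n - 1) * (Real.cos θ * ‖h θ‖) ^ 2 = N - P := by
    rw [hN, massInt, hP, ← intervalIntegral.integral_sub
      (Continuous.intervalIntegrable (by fun_prop) _ _)
      (Continuous.intervalIntegrable (by fun_prop) _ _)]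
    congr 1
    ext θ
    rw [mul_pow, mul_pow, Real.cos_sq']
    ring
  have h6 : M ^ 2 ≤ (N - P) * N := by
    have hMi : M = ∫ θ in (0 : ℝ)..Real.pi, Real.sin θ ^ (n - 1) *
        (Real.cos θ * ‖h θ‖ * ‖h θ‖) := by
      rw [hMd, momentInt]
      congr 1
      ext θ
      ring
    rw [← h5, hMi]
    exact h4
  have hM2 : 0 < M ^ 2 := by positivity
  have hNpos : 0 < N := by
    rcases hN0.lt_or_eq with h | h
    · exact h
    · rw [← h, mul_zero] at h6; exact absurd h6 (not_le.2 hM2)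
  have h7 : (N / M) ^ 2 - 1 = (N ^ 2 - M ^ 2) / M ^ 2 := by field_simp
  have h8 : 0 ≤ N ^ 2 - M ^ 2 := by nlinarith [mul_nonneg hP0 hN0]
  rw [h7, ← Real.sqrt_mul (div_nonneg h8 hM2.le), Real.le_sqrt' (by positivity)]
  rw [div_mul_div_comm, le_div_iff₀ (by positivity)]
  have h9 : (n : ℝ) ^ 2 * M ^ 2 * N ≤ 4 * (P * E) * N := mul_le_mul_of_nonneg_right h3 hN0
  have h10 : (P * N) * E ≤ (N ^ 2 - M ^ 2) * E := mul_le_mul_of_nonneg_right (by linarith) hE0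
  nlinarith

/-! ### Optimality of `n/2`. -/

/-- The integrals of powers of `1 + cos θ`. -/
def cosPowInt (n p : ℕ) : ℝ :=
  ∫ θ in (0 : ℝ)..Real.pi, Real.sin θ ^ (n - 1) * (1 + Real.cos θ) ^ p

theorem cosPowInt_pos (n p : ℕ) : 0 < cosPowInt n p := by
  refine intervalIntegral.intervalIntegral_pos_of_pos_on
    (Continuous.intervalIntegrable (by fun_prop) _ _) (fun θ hθ => ?_) Real.pi_pos
  have := (cos_mem_Ioo hθ).1
  exact mul_pos (pow_pos (Real.sin_pos_of_pos_of_lt_pi hθ.1 hθ.2) _) (pow_pos (by linarith) _)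

/-- Integrate the derivative of `sin^n (1 + cos)^p` and write `sin² = (1 + cos)(2 - (1 + cos))`. -/
theorem cosPowInt_succ (n p : ℕ) (hn : 2 ≤ n) :
    ((n : ℝ) + p) * cosPowInt n (p + 1) = (n + 2 * p) * cosPowInt n p := by
  have h1 : ∀ θ ∈ uIcc 0 Real.pi, HasDerivAt (fun θ => Real.sin θ ^ n * (1 + Real.cos θ) ^ p)
      ((n * Real.sin θ ^ (n - 1) * Real.cos θ) * (1 + Real.cos θ) ^ p +
        Real.sin θ ^ n * (p * (1 + Real.cos θ) ^ (p - 1) * (-Real.sin θ))) θ := fun θ _ =>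
    ((Real.hasDerivAt_sin θ).pow n).mul (((Real.hasDerivAt_cos θ).const_add 1).pow p)
  have h2 := intervalIntegral.integral_eq_sub_of_hasDerivAt h1
    (Continuous.intervalIntegrable (by fun_prop) _ _)
  have h0 : n ≠ 0 := by omega
  simp only [Real.sin_pi, Real.sin_zero, zero_pow h0, zero_mul, sub_zero] at h2
  have h3 : ∀ θ, (n * Real.sin θ ^ (n - 1) * Real.cos θ) * (1 + Real.cos θ) ^ p +
        Real.sin θ ^ n * (p * (1 + Real.cos θ) ^ (p - 1) * (-Real.sin θ)) =
      (n + p) * (Real.sin θ ^ (n - 1) * (1 + Real.cos θ) ^ (p + 1)) -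
        (n + 2 * p) * (Real.sin θ ^ (n - 1) * (1 + Real.cos θ) ^ p) := by
    intro θ
    have e1 : Real.sin θ ^ n = Real.sin θ ^ (n - 1) * Real.sin θ := by
      rw [← pow_succ, Nat.sub_add_cancel (by omega)]
    have e2 : Real.sin θ * Real.sin θ = (1 + Real.cos θ) * (1 - Real.cos θ) := by
      rw [← sq, Real.sin_sq]; ring
    rcases p with _ | p
    · simp; ring
    · rw [e1, Nat.add_sub_cancel]
      push_cast
      linear_combination (-(p + 1) * Real.sin θ ^ (n - 1) * (1 + Real.cos θ) ^ p) * e2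
  simp_rw [h3] at h2
  rw [intervalIntegral.integral_sub (Continuous.intervalIntegrable (by fun_prop) _ _)
    (Continuous.intervalIntegrable (by fun_prop) _ _), intervalIntegral.integral_const_mul,
    intervalIntegral.integral_const_mul] at h2
  exact sub_eq_zero.1 h2

/-- The zonal functions `(1 + x₀)^k`, whose uncertainty products tend to the optimal bound. -/
def cosPow (n k : ℕ) (x : Sph n) : ℂ :=
  (((1 + (x : EuclideanSpace ℝ (Fin (n + 1))) 0) ^ k : ℝ) : ℂ)

theorem contMDiff_zonal (n : ℕ) {F : ℝ → ℝ}
    (hF : ∀ t ∈ Icc (-1 : ℝ) 1, ContDiffAt ℝ 2 F t) :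
    ContMDiff (𝓡 n) 𝓘(ℝ, ℂ) 2
      (fun x : Sph n => ((F ((x : EuclideanSpace ℝ (Fin (n + 1))) 0) : ℝ) : ℂ)) := by
  have : Fact (Module.finrank ℝ (EuclideanSpace ℝ (Fin (n + 1))) = n + 1) := ⟨by simp⟩
  intro x
  have h1 : ContDiffAt ℝ 2 (fun y : EuclideanSpace ℝ (Fin (n + 1)) => ((F (y 0) : ℝ) : ℂ)) x := by
    have h2 : ContDiffAt ℝ 2 (fun y : EuclideanSpace ℝ (Fin (n + 1)) => y 0) x := by fun_prop
    have h3 : ContDiffAt ℝ 2 F ((x : EuclideanSpace ℝ (Fin (n + 1))) 0) := hF _ (first_mem_Icc n x)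
    exact Complex.ofRealCLM.contDiff.contDiffAt.comp _
      (ContDiffAt.comp (x : EuclideanSpace ℝ (Fin (n + 1)))
        (f := fun y : EuclideanSpace ℝ (Fin (n + 1)) => y 0) h3 h2)
  exact h1.contMDiffAt.comp x (contMDiff_coe_sphere x)

/-- Mass, moment and energy of `(1 + cos θ)^(j+1)` are combinations of `cosPowInt` at `2j+1`,
`2j+2`, `2j+3`, and the recursion reduces them all to the middle one, which cancels. -/
theorem uncertainty_cosPow (n j : ℕ) (hn : 2 ≤ n) :
    IsAdmissible n (cosPow n (j + 1)) ∧ uncertainty n (cosPow n (j + 1)) =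
      n / 2 * Real.sqrt (((n : ℝ) + 4 * (j + 1)) / (n + 4 * j + 2)) := by
  have hcm : ContMDiff (𝓡 n) 𝓘(ℝ, ℂ) 2 (cosPow n (j + 1)) :=
    contMDiff_zonal n (F := fun t => (1 + t) ^ (j + 1)) (fun t _ => by fun_prop)
  set φ : ℝ → ℂ := fun t => (((1 + t) ^ (j + 1) : ℝ) : ℂ) with hφ
  have hz : ∀ x : Sph n, cosPow n (j + 1) x = φ ((x : EuclideanSpace ℝ (Fin (n + 1))) 0) :=
    fun x => rfl
  obtain ⟨h1, h2⟩ := uncertainty_zonal n hn hcm hz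
  set h : ℝ → ℂ := fun θ => φ (Real.cos θ) with hh
  have hnorm : ∀ θ, ‖h θ‖ ^ 2 = (1 + Real.cos θ) ^ (2 * j + 2) := by
    intro θ
    rw [hh, hφ]
    simp only
    rw [Complex.norm_real, Real.norm_eq_abs, sq_abs]
    ring
  have r1 := cosPowInt_succ n (2 * j + 2) hn
  have r2 := cosPowInt_succ n (2 * j + 1) hn
  have p1 := cosPowInt_pos n (2 * j + 2)
  have p2 := cosPowInt_pos n (2 * j + 1)
  have hN : massInt n h = cosPowInt n (2 * j + 2) := by
    rw [massInt, cosPowInt]; simp_rw [hnorm]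
  have hM : momentInt n h = cosPowInt n (2 * j + 3) - cosPowInt n (2 * j + 2) := by
    rw [momentInt, cosPowInt, cosPowInt, ← intervalIntegral.integral_sub
      (Continuous.intervalIntegrable (by fun_prop) _ _)
      (Continuous.intervalIntegrable (by fun_prop) _ _)]
    simp_rw [hnorm]
    congr 1; ext θ; ring
  have hderiv : ∀ θ, deriv h θ =
      (((j + 1) * (1 + Real.cos θ) ^ j * (-Real.sin θ) : ℝ) : ℂ) := by
    intro θ
    have := (((Real.hasDerivAt_cos θ).const_add 1).pow (j + 1)).ofReal_comp.deriv
    have e : h = fun θ => (((1 + Real.cos θ) ^ (j + 1) : ℝ) : ℂ) := rfl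
    rw [e]
    refine Eq.trans this ?_
    simp
  have hE : energyInt n h = (j + 1) ^ 2 * (2 * cosPowInt n (2 * j + 1) -
      cosPowInt n (2 * j + 2)) := by
    rw [energyInt, cosPowInt, cosPowInt, ← intervalIntegral.integral_const_mul,
      ← intervalIntegral.integral_sub
      (Continuous.intervalIntegrable (by fun_prop) _ _)
      (Continuous.intervalIntegrable (by fun_prop) _ _), ← intervalIntegral.integral_const_mul]
    congr 1; ext θ
    rw [hderiv, Complex.norm_real, Real.norm_eq_abs, sq_abs]
    have e2 : Real.sin θ ^ 2 = (1 + Real.cos θ) * (1 - Real.cos θ) := by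
      rw [Real.sin_sq]; ring
    linear_combination (Real.sin θ ^ (n - 1) * (j + 1) ^ 2 * (1 + Real.cos θ) ^ (2 * j)) * e2
  have hn0 : (0 : ℝ) < n := by exact_mod_cast (by omega : 0 < n)
  set I := cosPowInt n (2 * j + 2) with hI
  push_cast at r1 r2
  have hM' : momentInt n h = I * (2 * (j + 1) / (n + 2 * (j + 1))) := by
    rw [hM, eq_comm, mul_div_assoc', div_eq_iff (by positivity)]
    linarith
  have hE' : energyInt n h = I * ((j + 1) ^ 2 * (n / (n + 4 * j + 2))) := by
    have : 2 * cosPowInt n (2 * j + 1) - I = I * (n / (n + 4 * j + 2)) := by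
      rw [mul_div_assoc', eq_div_iff (by positivity)]
      linarith
    rw [hE, this]; ring
  have hMpos : 0 < momentInt n h := by rw [hM']; positivity
  refine ⟨⟨hcm, ⟨_, hz⟩, h1.2 hMpos.ne'⟩, ?_⟩
  rw [h2, hN, hM', hE', mul_div_cancel_left₀ _ p1.ne', div_mul_eq_div_div, div_self p1.ne']
  have e1 : (1 / (2 * ((j : ℝ) + 1) / (n + 2 * (j + 1)))) ^ 2 - 1 =
      n * (n + 4 * (j + 1)) / (4 * (j + 1) ^ 2) := by
    field_simp
    ring
  rw [e1, ← Real.sqrt_mul (by positivity)]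
  have e2 : (n : ℝ) * (n + 4 * (j + 1)) / (4 * (j + 1) ^ 2) *
      ((j + 1) ^ 2 * (n / (n + 4 * j + 2))) =
      (n / 2) ^ 2 * ((n + 4 * (j + 1)) / (n + 4 * j + 2)) := by
    field_simp
    ring
  rw [e2, Real.sqrt_mul (by positivity), Real.sqrt_sq (by positivity)]

theorem isGLB_uncertainty (n : ℕ) (hn : 2 ≤ n) :
    IsGLB {u : ℝ | ∃ f : Sph n → ℂ, IsAdmissible n f ∧ uncertainty n f = u} ((n : ℝ) / 2) := by
  constructor
  · rintro u ⟨f, ⟨hf, ⟨φ, hφ⟩, hM⟩, rfl⟩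
    obtain ⟨h1, h2⟩ := uncertainty_zonal n hn hf hφ
    rw [h2]
    exact half_dimension_le n hn (contDiff_zonal n (by omega) hf hφ) (h1.1 hM)
  · intro b hb
    have h1 : ∀ j : ℕ, b ≤ n / 2 * Real.sqrt (((n : ℝ) + 4 * (j + 1)) / (n + 4 * j + 2)) :=
      fun j => hb ⟨_, (uncertainty_cosPow n j hn).1, (uncertainty_cosPow n j hn).2⟩
    have h2 : Tendsto (fun j : ℕ => (n : ℝ) / 2 *
        Real.sqrt (((n : ℝ) + 4 * (j + 1)) / (n + 4 * j + 2))) atTop (𝓝 (n / 2 * Real.sqrt 1)) := by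
      refine Tendsto.const_mul _ (Tendsto.sqrt ?_)
      have h3 : Tendsto (fun j : ℕ => 1 + 2 / ((n : ℝ) + 4 * j + 2)) atTop (𝓝 (1 + 0)) := by
        refine Tendsto.const_add _ (Tendsto.const_div_atTop ?_ _)
        refine tendsto_atTop_add_const_right _ _ (tendsto_atTop_add_const_left _ _ ?_)
        exact tendsto_natCast_atTop_atTop.const_mul_atTop (by norm_num)
      rw [add_zero] at h3
      refine h3.congr (fun j => ?_)
      have : (0 : ℝ) < n + 4 * j + 2 := by positivity
      field_simp
      ring
    rw [Real.sqrt_one, mul_one] at h2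
    exact ge_of_tendsto' h2 h1

/-! ### Integrals of one and of two Poisson kernels. -/

theorem hasDerivAt_integral_of_continuousOn {G G' : ℝ → ℝ → ℝ} {U : Set ℝ} (hU : IsOpen U)
    {a b s₀ : ℝ} (hs : s₀ ∈ U)
    (hd : ∀ s ∈ U, ∀ t ∈ uIcc a b, HasDerivAt (fun s => G s t) (G' s t) s)
    (hG : ContinuousOn (Function.uncurry G) (U ×ˢ uIcc a b))
    (hG' : ContinuousOn (Function.uncurry G') (U ×ˢ uIcc a b)) :
    HasDerivAt (fun s => ∫ t in a..b, G s t) (∫ t in a..b, G' s₀ t) s₀ := by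
  obtain ⟨ε, hε, hball⟩ := Metric.nhds_basis_closedBall.mem_iff.1 (hU.mem_nhds hs)
  have hcomp : IsCompact (closedBall s₀ ε ×ˢ uIcc a b) :=
    (isCompact_closedBall _ _).prod isCompact_uIcc
  obtain ⟨C, hC⟩ := hcomp.exists_bound_of_continuousOn (hG'.mono (prod_mono_left hball))
  have hsec : ∀ {H : ℝ → ℝ → ℝ}, ContinuousOn (Function.uncurry H) (U ×ˢ uIcc a b) → ∀ s ∈ U,
      ContinuousOn (H s) (uIcc a b) := fun {H} hH s hs' =>
    hH.comp (f := fun t => (s, t)) (by fun_prop) (fun t ht => ⟨hs', ht⟩)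
  refine (intervalIntegral.hasDerivAt_integral_of_dominated_loc_of_deriv_le (F := G) (F' := G')
    (s := ball s₀ ε) (bound := fun _ => C) (ball_mem_nhds _ hε) ?_ ?_ ?_ ?_ ?_ ?_).2
  · filter_upwards [hU.mem_nhds hs] with s hs'
    exact ((hsec hG s hs').mono uIoc_subset_uIcc).aestronglyMeasurable measurableSet_uIoc
  · exact (hsec hG s₀ hs).intervalIntegrable
  · exact ((hsec hG' s₀ hs).mono uIoc_subset_uIcc).aestronglyMeasurable measurableSet_uIoc
  · exact ae_of_all _ fun t ht s hs' =>
      hC (s, t) ⟨ball_subset_closedBall hs', uIoc_subset_uIcc ht⟩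
  · exact intervalIntegrable_const
  · exact ae_of_all _ fun t ht s hs' =>
      hd s (hball (ball_subset_closedBall hs')) t (uIoc_subset_uIcc ht)

/-- The integral of a zonal function of `t = cos θ` against the weight `√(1-t²)^(n-2)`. -/
def axisInt (n : ℕ) (F : ℝ → ℝ) : ℝ := ∫ t in (-1 : ℝ)..1, Real.sqrt (1 - t ^ 2) ^ (n - 2) * F t

theorem axisInt_congr (n : ℕ) {F G : ℝ → ℝ} (h : ∀ t ∈ Icc (-1 : ℝ) 1, F t = G t) :
    axisInt n F = axisInt n G := by
  refine intervalIntegral.integral_congr (fun t ht => ?_)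
  rw [uIcc_of_le (by norm_num)] at ht
  simp only [h t ht]

theorem axisInt_intervalIntegrable (n : ℕ) {F : ℝ → ℝ} (h : ContinuousOn F (Icc (-1) 1)) :
    IntervalIntegrable (fun t => Real.sqrt (1 - t ^ 2) ^ (n - 2) * F t) volume (-1) 1 := by
  refine ContinuousOn.intervalIntegrable ?_
  rw [uIcc_of_le (by norm_num)]
  exact ContinuousOn.mul (Continuous.continuousOn (by fun_prop)) h

theorem axisInt_add (n : ℕ) {F G : ℝ → ℝ} (hF : ContinuousOn F (Icc (-1) 1))
    (hG : ContinuousOn G (Icc (-1) 1)) :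
    axisInt n (fun t => F t + G t) = axisInt n F + axisInt n G := by
  simp only [axisInt, mul_add]
  exact intervalIntegral.integral_add (axisInt_intervalIntegrable n hF)
    (axisInt_intervalIntegrable n hG)

theorem axisInt_const_mul (n : ℕ) (c : ℝ) (F : ℝ → ℝ) :
    axisInt n (fun t => c * F t) = c * axisInt n F := by
  simp only [axisInt, mul_left_comm _ c]
  exact intervalIntegral.integral_const_mul _ _

theorem axisInt_comp_neg (n : ℕ) (F : ℝ → ℝ) :
    axisInt n (fun t => F (-t)) = axisInt n F := by
  have := intervalIntegral.integral_comp_neg (a := -1) (b := 1)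
    (fun t => Real.sqrt (1 - t ^ 2) ^ (n - 2) * F t)
  simpa [axisInt] using this

theorem axisInt_odd (n : ℕ) : axisInt n (fun t => t) = 0 := by
  have h1 := axisInt_comp_neg n (fun t => t)
  have h2 := axisInt_const_mul n (-1) (fun t => t)
  simp only [neg_one_mul] at h2
  linarith

theorem integral_sin_pow_mul_cos (n : ℕ) (hn : 2 ≤ n) {F : ℝ → ℝ}
    (hF : ContinuousOn F (Icc (-1) 1)) :
    ∫ θ in (0 : ℝ)..Real.pi, Real.sin θ ^ (n - 1) * F (Real.cos θ) = axisInt n F := by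
  have h := intervalIntegral.integral_comp_mul_deriv'' (a := 0) (b := Real.pi) (f := Real.cos)
    (f' := fun θ => -Real.sin θ) (g := fun t => Real.sqrt (1 - t ^ 2) ^ (n - 2) * F t)
    (by fun_prop) (fun θ _ => (Real.hasDerivAt_cos θ).hasDerivWithinAt) (by fun_prop)
    (by
      refine ContinuousOn.mul (Continuous.continuousOn (by fun_prop)) (hF.mono ?_)
      rintro _ ⟨θ, _, rfl⟩
      exact Real.cos_mem_Icc θ)
  rw [Real.cos_zero, Real.cos_pi, intervalIntegral.integral_symm (-1) 1] at h
  rw [axisInt, ← neg_eq_iff_eq_neg.2 h, ← intervalIntegral.integral_neg]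
  refine intervalIntegral.integral_congr (fun θ hθ => ?_)
  rw [uIcc_of_le Real.pi_pos.le] at hθ
  have hs := Real.sin_nonneg_of_nonneg_of_le_pi hθ.1 hθ.2
  have : Real.sqrt (1 - Real.cos θ ^ 2) = Real.sin θ := by
    rw [← Real.sin_sq, Real.sqrt_sq hs]
  simp only [Function.comp_apply, this]
  have h1 : n - 1 = (n - 2) + 1 := by omega
  rw [h1, pow_succ]
  ring

/-- The squared distance between the point at distance `r` from the origin on the first axis and a
point of the sphere with first coordinate `t`. -/
def distSq (r t : ℝ) : ℝ := 1 - 2 * r * t + r ^ 2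

theorem distSq_pos {r t : ℝ} (hr : r ∈ Ioo (-1 : ℝ) 1) (ht : t ∈ Icc (-1 : ℝ) 1) :
    0 < distSq r t := by
  unfold distSq
  rcases le_or_gt 0 r with h | h
  · nlinarith [mul_le_mul_of_nonneg_left ht.2 h, sq_pos_of_pos (sub_pos.2 hr.2)]
  · have : 0 < 1 + r := by linarith [hr.1]
    nlinarith [mul_le_mul_of_nonneg_left ht.1 (neg_nonneg.2 h.le), sq_pos_of_pos this]

/-- The substitution `t = ψ(τ)` is the trace on the axis of the conformal map of the ball that moves
the origin to `r e₀`. With `Q = distSq (-r) τ`, `ψ' = ((1-r²)/Q)²` and `1 - ψ² = ((1-r²)/Q)²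
(1-τ²)`; the weight contributes the remaining `n - 2` powers of `(1-r²)/Q`. -/
theorem axisInt_mobius (n : ℕ) (hn : 2 ≤ n) {F : ℝ → ℝ} (hF : ContinuousOn F (Icc (-1) 1))
    {r : ℝ} (hr : r ∈ Ioo (-1 : ℝ) 1) :
    axisInt n F = axisInt n (fun τ => ((1 - r ^ 2) / distSq (-r) τ) ^ n *
      F (((1 + r ^ 2) * τ + 2 * r) / distSq (-r) τ)) := by
  have hr' : -r ∈ Ioo (-1 : ℝ) 1 := ⟨by linarith [hr.2], by linarith [hr.1]⟩
  have hr2 : 0 < 1 - r ^ 2 := by nlinarith [hr.1, hr.2]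
  have hQ : ∀ τ ∈ Icc (-1 : ℝ) 1, 0 < distSq (-r) τ := fun τ hτ => distSq_pos hr' hτ
  have hQd : ∀ τ, HasDerivAt (distSq (-r)) (2 * r) τ := by
    intro τ
    have := (((hasDerivAt_id τ).const_mul (2 * -r)).const_sub 1).add_const ((-r) ^ 2)
    exact this.congr_deriv (by ring)
  have hQc : Continuous (distSq (-r)) := by unfold distSq; fun_prop
  set ψ : ℝ → ℝ := fun τ => ((1 + r ^ 2) * τ + 2 * r) / distSq (-r) τ with hψ
  have hψd : ∀ τ ∈ Icc (-1 : ℝ) 1, HasDerivAt ψ ((1 - r ^ 2) ^ 2 / distSq (-r) τ ^ 2) τ := by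
    intro τ hτ
    have h1 := ((hasDerivAt_id τ).const_mul (1 + r ^ 2)).add_const (2 * r)
    refine (h1.div (hQd τ) (hQ τ hτ).ne').congr_deriv ?_
    congr 1
    simp only [distSq, id]
    ring
  have hψc : ContinuousOn ψ (Icc (-1) 1) := fun τ hτ =>
    (hψd τ hτ).continuousAt.continuousWithinAt
  have hsq : ∀ τ ∈ Icc (-1 : ℝ) 1,
      1 - ψ τ ^ 2 = ((1 - r ^ 2) / distSq (-r) τ) ^ 2 * (1 - τ ^ 2) := by
    intro τ hτ
    have := (hQ τ hτ).ne'
    simp only [hψ]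
    rw [div_pow, div_pow, eq_comm, div_mul_eq_mul_div, eq_sub_iff_add_eq, ← add_div,
      div_eq_one_iff_eq (pow_ne_zero 2 this)]
    simp only [distSq]
    ring
  have hmem : ∀ τ ∈ Icc (-1 : ℝ) 1, ψ τ ∈ Icc (-1 : ℝ) 1 := by
    intro τ hτ
    have h1 : 0 ≤ 1 - ψ τ ^ 2 := by
      rw [hsq τ hτ]
      exact mul_nonneg (sq_nonneg _) (by nlinarith [hτ.1, hτ.2])
    exact abs_le.1 (abs_le_one_iff_mul_self_le_one.2 (by nlinarith))
  have hI : uIcc (-1 : ℝ) 1 = Icc (-1) 1 := uIcc_of_le (by norm_num)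
  have h := intervalIntegral.integral_comp_mul_deriv'' (a := -1) (b := 1) (f := ψ)
    (f' := fun τ => (1 - r ^ 2) ^ 2 / distSq (-r) τ ^ 2)
    (g := fun t => Real.sqrt (1 - t ^ 2) ^ (n - 2) * F t)
    (by rw [hI]; exact hψc)
    (fun τ hτ => (hψd τ (by
      rw [min_eq_left (by norm_num), max_eq_right (by norm_num)] at hτ
      exact Ioo_subset_Icc_self hτ)).hasDerivWithinAt)
    (by
      rw [hI]
      exact ContinuousOn.div continuousOn_const (by fun_prop)
        (fun τ hτ => pow_ne_zero 2 (hQ τ hτ).ne'))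
    (by
      rw [hI]
      refine ContinuousOn.mul (Continuous.continuousOn (by fun_prop)) (hF.mono ?_)
      rintro _ ⟨τ, hτ, rfl⟩
      exact hmem τ hτ)
  have e1 : ψ (-1) = -1 := by
    have : distSq (-r) (-1) ≠ 0 := (hQ _ (by norm_num)).ne'
    simp only [hψ]
    rw [div_eq_iff this]
    simp only [distSq]; ring
  have e2 : ψ 1 = 1 := by
    have : distSq (-r) 1 ≠ 0 := (hQ _ (by norm_num)).ne'
    simp only [hψ]
    rw [div_eq_iff this]
    simp only [distSq]; ring
  rw [e1, e2] at h
  rw [axisInt, ← h, axisInt]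
  refine intervalIntegral.integral_congr (fun τ hτ => ?_)
  rw [hI] at hτ
  have hpos : 0 ≤ (1 - r ^ 2) / distSq (-r) τ := div_nonneg hr2.le (hQ τ hτ).le
  simp only [Function.comp_apply]
  rw [hsq τ hτ, Real.sqrt_mul (sq_nonneg _), Real.sqrt_sq hpos, mul_pow, ← div_pow]
  have h1 : n = (n - 2) + 2 := by omega
  have h2 : ((1 - r ^ 2) / distSq (-r) τ) ^ n =
    ((1 - r ^ 2) / distSq (-r) τ) ^ (n - 2) * ((1 - r ^ 2) / distSq (-r) τ) ^ 2 := by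
    rw [← pow_add, ← h1]
  rw [h2]
  ring

/-- The Poisson kernel, without its normalizing factor, as a function of `r` and of the first
coordinate. -/
def poissonProfile (n : ℕ) (r t : ℝ) : ℝ := (1 - r ^ 2) / Real.sqrt (distSq r t) ^ (n + 1)

theorem continuousOn_poissonProfile (n : ℕ) {r : ℝ} (hr : r ∈ Ioo (-1 : ℝ) 1) :
    ContinuousOn (poissonProfile n r) (Icc (-1) 1) := by
  unfold poissonProfile distSq
  exact ContinuousOn.div continuousOn_const (Continuous.continuousOn (by fun_prop))
    (fun t ht => pow_ne_zero _ (Real.sqrt_pos.2 (distSq_pos hr ht)).ne')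

theorem continuousOn_inv_dist (k : ℕ) {r : ℝ} (hr : r ∈ Ioo (-1 : ℝ) 1) :
    ContinuousOn (fun t => 1 / Real.sqrt (distSq r t) ^ k) (Icc (-1) 1) := by
  unfold distSq
  exact ContinuousOn.div continuousOn_const (Continuous.continuousOn (by fun_prop))
    (fun t ht => pow_ne_zero _ (Real.sqrt_pos.2 (distSq_pos hr ht)).ne')

/-- Conformal covariance of the distance: the pole `s` is carried back to `(s-r)/(1-rs)`. For `s =
r` this is the origin, and the kernel with parameter `r` becomes a power of `distSq (-r) τ`. -/
theorem distSq_mobius {r s τ : ℝ} (hr : distSq (-r) τ ≠ 0) (hrs : 1 - r * s ≠ 0) :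
    distSq s (((1 + r ^ 2) * τ + 2 * r) / distSq (-r) τ) =
      (1 - r * s) ^ 2 * distSq ((s - r) / (1 - r * s)) τ / distSq (-r) τ := by
  rw [eq_div_iff hr]
  have e : distSq s (((1 + r ^ 2) * τ + 2 * r) / distSq (-r) τ) * distSq (-r) τ =
    (1 + s ^ 2) * distSq (-r) τ - 2 * s * ((1 + r ^ 2) * τ + 2 * r) := by
    rw [distSq.eq_1 s]
    field_simp
    ring
  have e2 : ∀ u : ℝ, u ≠ 0 → u ^ 2 * distSq ((s - r) / u) τ =
      u ^ 2 - 2 * (s - r) * u * τ + (s - r) ^ 2 := by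
    intro u hu
    unfold distSq
    field_simp
  rw [e, e2 _ hrs]
  unfold distSq
  ring

theorem axisInt_poissonProfile_eq (n : ℕ) (hn : 2 ≤ n) {s : ℝ} (hs : s ∈ Ioo (-1 : ℝ) 1) :
    axisInt n (poissonProfile n s) =
      axisInt n (fun t => 1 / Real.sqrt (distSq s t) ^ (n - 1)) := by
  have hs' : -s ∈ Ioo (-1 : ℝ) 1 := ⟨by linarith [hs.2], by linarith [hs.1]⟩
  have hs2 : 0 < 1 - s * s := by nlinarith [hs.1, hs.2]
  rw [axisInt_mobius n hn (continuousOn_poissonProfile n hs) hs,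
    ← axisInt_comp_neg n (fun t => 1 / Real.sqrt (distSq s t) ^ (n - 1))]
  refine axisInt_congr n (fun τ hτ => ?_)
  have hQ := distSq_pos hs' hτ
  have hneg : distSq s (-τ) = distSq (-s) τ := by unfold distSq; ring
  have h0 : distSq ((s - s) / (1 - s * s)) τ = 1 := by simp [distSq]
  rw [hneg, poissonProfile, distSq_mobius hQ.ne' hs2.ne', h0, mul_one,
    Real.sqrt_div (sq_nonneg _), Real.sqrt_sq hs2.le]
  set R := Real.sqrt (distSq (-s) τ) with hR
  have hR0 : R ≠ 0 := (Real.sqrt_pos.2 hQ).ne'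
  have hRR : distSq (-s) τ = R ^ 2 := (Real.sq_sqrt hQ.le).symm
  rw [hRR, div_pow, div_pow, div_div_eq_mul_div, sq s]
  obtain ⟨m, rfl⟩ : ∃ m, n = m + 1 := ⟨n - 1, by omega⟩
  rw [Nat.add_sub_cancel]
  clear_value R
  generalize 1 - s * s = c at *
  have hc : c ≠ 0 := hs2.ne'
  field_simp
  ring

/-- Mean value property of the Newtonian potential `|ζ - x|^(-(n-1))`. Since `2s(s-t) = distSq s t -
(1-s²)`, the integral `I` satisfies `2s I'(s) = (n-1)(∫ P_s - I(s))`, which is zero by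
`axisInt_poissonProfile_eq`. At `s = 0` the factor `2s` cannot be cancelled, and oddness of the
integrand is used instead. -/
theorem axisInt_inv_dist (n : ℕ) (hn : 2 ≤ n) {s : ℝ} (hs : s ∈ Ioo (-1 : ℝ) 1) :
    axisInt n (fun t => 1 / Real.sqrt (distSq s t) ^ (n - 1)) = axisInt n (fun _ => 1) := by
  set I : ℝ → ℝ := fun s => axisInt n (fun t => 1 / Real.sqrt (distSq s t) ^ (n - 1)) with hI
  have hU : uIcc (-1 : ℝ) 1 = Icc (-1) 1 := uIcc_of_le (by norm_num)
  have hder : ∀ s ∈ Ioo (-1 : ℝ) 1, HasDerivAt I (axisInt n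
      (fun t => -((n - 1 : ℕ) : ℝ) * (s - t) / Real.sqrt (distSq s t) ^ (n + 1))) s := by
    intro s₀ hs₀
    have hQc : Continuous fun p : ℝ × ℝ => Real.sqrt (distSq p.1 p.2) := by
      unfold distSq; fun_prop
    have hQ0 : ∀ p ∈ Ioo (-1 : ℝ) 1 ×ˢ uIcc (-1 : ℝ) 1, Real.sqrt (distSq p.1 p.2) ≠ 0 := by
      rintro p ⟨h1, h2⟩
      rw [hU] at h2
      exact (Real.sqrt_pos.2 (distSq_pos h1 h2)).ne'
    refine hasDerivAt_integral_of_continuousOn (U := Ioo (-1) 1)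
      (G := fun s t => Real.sqrt (1 - t ^ 2) ^ (n - 2) *
        (1 / Real.sqrt (distSq s t) ^ (n - 1)))
      (G' := fun s t => Real.sqrt (1 - t ^ 2) ^ (n - 2) *
        (-((n - 1 : ℕ) : ℝ) * (s - t) / Real.sqrt (distSq s t) ^ (n + 1)))
      isOpen_Ioo hs₀ ?_ ?_ ?_
    · intro s hs t ht
      refine HasDerivAt.const_mul _ ?_
      rw [hU] at ht
      have hQ := distSq_pos hs ht
      have hd : HasDerivAt (fun s => distSq s t) (2 * (s - t)) s := by
        have := (((((hasDerivAt_id s).const_mul 2).mul_const t).const_sub 1).add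
          ((hasDerivAt_id s).pow 2))
        refine this.congr_deriv ?_
        simp; ring
      have h1 := ((hd.sqrt hQ.ne').pow (n - 1)).inv (pow_ne_zero _ (Real.sqrt_pos.2 hQ).ne')
      have h2 : (fun s => 1 / Real.sqrt (distSq s t) ^ (n - 1)) =
        (fun s => Real.sqrt (distSq s t) ^ (n - 1))⁻¹ := by ext; simp
      rw [h2]
      refine h1.congr_deriv ?_
      set R := Real.sqrt (distSq s t)
      have hR0 : R ≠ 0 := (Real.sqrt_pos.2 hQ).ne'
      obtain ⟨m, rfl⟩ : ∃ m, n = m + 2 := ⟨n - 2, by omega⟩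
      change -(((m + 1 : ℕ) : ℝ) * R ^ m * (2 * (s - t) / (2 * R))) / (R ^ (m + 1)) ^ 2 =
        -((m + 1 : ℕ) : ℝ) * (s - t) / R ^ (m + 3)
      field_simp
      ring
    · refine ContinuousOn.mul (Continuous.continuousOn (by fun_prop)) ?_
      exact ContinuousOn.div continuousOn_const (hQc.pow _).continuousOn (fun p hp => pow_ne_zero _ (hQ0 p hp))
    · refine ContinuousOn.mul (Continuous.continuousOn (by fun_prop)) ?_
      exact ContinuousOn.div (Continuous.continuousOn (by fun_prop)) (hQc.pow _).continuousOn
        (fun p hp => pow_ne_zero _ (hQ0 p hp))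
  have hzero : ∀ s ∈ Ioo (-1 : ℝ) 1, axisInt n
      (fun t => -((n - 1 : ℕ) : ℝ) * (s - t) / Real.sqrt (distSq s t) ^ (n + 1)) = 0 := by
    intro s hs
    by_cases h0 : s = 0
    · subst h0
      have h1 := axisInt_const_mul n ((n - 1 : ℕ) : ℝ) (fun t => t)
      rw [axisInt_odd, mul_zero] at h1
      refine Eq.trans (axisInt_congr n (fun t _ => ?_)) h1
      simp [distSq]
    · have h1 : (2 * s) * axisInt n
        (fun t => -((n - 1 : ℕ) : ℝ) * (s - t) / Real.sqrt (distSq s t) ^ (n + 1)) =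
          ((n - 1 : ℕ) : ℝ) * (axisInt n (poissonProfile n s)) +
          (-((n - 1 : ℕ) : ℝ)) * axisInt n (fun t => 1 / Real.sqrt (distSq s t) ^ (n - 1)) := by
        rw [← axisInt_const_mul, ← axisInt_const_mul, ← axisInt_const_mul,
          ← axisInt_add n (F := fun t => ((n - 1 : ℕ) : ℝ) * poissonProfile n s t)
            (G := fun t => -((n - 1 : ℕ) : ℝ) * (1 / Real.sqrt (distSq s t) ^ (n - 1)))
            (continuousOn_const.mul (continuousOn_poissonProfile n hs))
            (continuousOn_const.mul (continuousOn_inv_dist _ hs))]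
        refine axisInt_congr n (fun t ht => ?_)
        have hQ := distSq_pos hs ht
        rw [poissonProfile]
        set R := Real.sqrt (distSq s t) with hR
        have hR0 : R ≠ 0 := (Real.sqrt_pos.2 hQ).ne'
        have hRR : R ^ 2 = 1 - 2 * s * t + s ^ 2 := (Real.sq_sqrt hQ.le)
        obtain ⟨m, rfl⟩ : ∃ m, n = m + 1 := ⟨n - 1, by omega⟩
        rw [Nat.add_sub_cancel]
        field_simp
        linear_combination (m * R ^ m) * hRR
      rw [axisInt_poissonProfile_eq n hn hs] at h1
      have h2 : (2 * s) ≠ 0 := mul_ne_zero two_ne_zero h0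
      have h3 : (2 * s) * axisInt n
        (fun t => -((n - 1 : ℕ) : ℝ) * (s - t) / Real.sqrt (distSq s t) ^ (n + 1)) = 0 := by
        rw [h1]; ring
      exact (mul_eq_zero.1 h3).resolve_left h2
  have hconst := isOpen_Ioo.is_const_of_deriv_eq_zero (isPreconnected_Ioo)
    (fun s hs => (hder s hs).differentiableAt.differentiableWithinAt)
    (fun s hs => by rw [(hder s hs).deriv, hzero s hs]; rfl) hs
    (show (0 : ℝ) ∈ Ioo (-1 : ℝ) 1 by norm_num)
  refine Eq.trans hconst ?_
  simp [hI, distSq]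

theorem axisInt_poissonProfile (n : ℕ) (hn : 2 ≤ n) {s : ℝ} (hs : s ∈ Ioo (-1 : ℝ) 1) :
    axisInt n (poissonProfile n s) = axisInt n (fun _ => 1) := by
  rw [axisInt_poissonProfile_eq n hn hs, axisInt_inv_dist n hn hs]

/-- From `2st = (1 + s²) - distSq s t`, which reduces the moment to the two integrals already known.
-/
theorem axisInt_mul_poissonProfile (n : ℕ) (hn : 2 ≤ n) {s : ℝ} (hs : s ∈ Ioo (-1 : ℝ) 1) :
    axisInt n (fun t => t * poissonProfile n s t) = s * axisInt n (fun _ => 1) := by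
  by_cases h0 : s = 0
  · subst h0
    rw [zero_mul]
    refine Eq.trans (axisInt_congr n (fun t _ => ?_)) (axisInt_odd n)
    simp [poissonProfile, distSq]
  · have h1 : (2 * s) * axisInt n (fun t => t * poissonProfile n s t) =
        (1 + s ^ 2) * axisInt n (poissonProfile n s) +
          (-(1 - s ^ 2)) * axisInt n (fun t => 1 / Real.sqrt (distSq s t) ^ (n - 1)) := by
      rw [← axisInt_const_mul, ← axisInt_const_mul, ← axisInt_const_mul,
          ← axisInt_add n (F := fun t => (1 + s ^ 2) * poissonProfile n s t)
            (G := fun t => -(1 - s ^ 2) * (1 / Real.sqrt (distSq s t) ^ (n - 1)))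
            (continuousOn_const.mul (continuousOn_poissonProfile n hs))
            (continuousOn_const.mul (continuousOn_inv_dist _ hs))]
      refine axisInt_congr n (fun t ht => ?_)
      have hQ := distSq_pos hs ht
      rw [poissonProfile]
      set R := Real.sqrt (distSq s t) with hR
      have hR0 : R ≠ 0 := (Real.sqrt_pos.2 hQ).ne'
      have hRR : R ^ 2 = 1 - 2 * s * t + s ^ 2 := (Real.sq_sqrt hQ.le)
      obtain ⟨m, rfl⟩ : ∃ m, n = m + 1 := ⟨n - 1, by omega⟩
      rw [Nat.add_sub_cancel]
      field_simp
      linear_combination ((1 - s ^ 2) * R ^ m) * hRR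
    rw [axisInt_poissonProfile n hn hs, axisInt_inv_dist n hn hs] at h1
    have h2 : (2 * s) ≠ 0 := mul_ne_zero two_ne_zero h0
    refine mul_left_cancel₀ h2 ?_
    rw [h1]; ring

/-- The Möbius substitution with parameter `r` turns the `s`-kernel into the one with parameter `u =
(s-r)/(1-rs)`, and all other factors leave a single power of `distSq (-r) τ`. For the factors `g`
needed here this power makes `g` affine in `τ`, as `hab` says, so the moments `1` and `u` of one
kernel suffice. -/
theorem axisInt_mul_poissonProfile_mul (n : ℕ) (hn : 2 ≤ n) {r s : ℝ} (hr : r ∈ Ioo (-1 : ℝ) 1)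
    (hs : s ∈ Ioo (-1 : ℝ) 1) {g : ℝ → ℝ} (hg : ContinuousOn g (Icc (-1) 1)) {a b : ℝ}
    (hab : ∀ τ ∈ Icc (-1 : ℝ) 1,
      g (((1 + r ^ 2) * τ + 2 * r) / distSq (-r) τ) * distSq (-r) τ = a + b * τ) :
    axisInt n (fun t => g t * (poissonProfile n r t * poissonProfile n s t)) =
      axisInt n (fun _ => 1) * (a * (1 - r * s) + b * (s - r)) /
        ((1 - r ^ 2) * (1 - r * s) ^ n) := by
  have hr' : -r ∈ Ioo (-1 : ℝ) 1 := ⟨by linarith [hr.2], by linarith [hr.1]⟩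
  have hr2 : 0 < 1 - r ^ 2 := by nlinarith [hr.1, hr.2]
  have hr2' : 0 < 1 - r * r := by nlinarith [hr.1, hr.2]
  have hs2 : 0 < 1 - s ^ 2 := by nlinarith [hs.1, hs.2]
  have hrs : 0 < 1 - r * s := by nlinarith [sq_nonneg (r - s)]
  set u := (s - r) / (1 - r * s) with hu
  have hus : 1 - u ^ 2 = (1 - r ^ 2) * (1 - s ^ 2) / (1 - r * s) ^ 2 := by
    rw [hu, div_pow, eq_div_iff (pow_ne_zero 2 hrs.ne'), sub_mul,
      div_mul_cancel₀ _ (pow_ne_zero 2 hrs.ne')]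
    ring
  have humem : u ∈ Ioo (-1 : ℝ) 1 := by
    have : 0 < 1 - u ^ 2 := by rw [hus]; positivity
    exact abs_lt.1 ((sq_lt_one_iff_abs_lt_one u).1 (by linarith))
  have hPu := continuousOn_poissonProfile n humem
  rw [axisInt_mobius n hn
    (F := fun t => g t * (poissonProfile n r t * poissonProfile n s t)) (hg.mul ((continuousOn_poissonProfile n hr).mul
    (continuousOn_poissonProfile n hs))) hr]
  have h1 : axisInt n (fun τ => ((1 - r ^ 2) / distSq (-r) τ) ^ n *
      (g (((1 + r ^ 2) * τ + 2 * r) / distSq (-r) τ) *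
        (poissonProfile n r (((1 + r ^ 2) * τ + 2 * r) / distSq (-r) τ) *
          poissonProfile n s (((1 + r ^ 2) * τ + 2 * r) / distSq (-r) τ)))) =
      axisInt n (fun τ => 1 / ((1 - r * s) ^ (n - 1) * (1 - r ^ 2)) *
        (a * poissonProfile n u τ + b * (τ * poissonProfile n u τ))) := by
    refine axisInt_congr n (fun τ hτ => ?_)
    have hQ := distSq_pos hr' hτ
    have hU := distSq_pos humem hτ
    have e : a * poissonProfile n u τ + b * (τ * poissonProfile n u τ) =
      (a + b * τ) * poissonProfile n u τ := by ring
    have h0 : distSq ((r - r) / (1 - r * r)) τ = 1 := by simp [distSq]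
    rw [e, ← hab τ hτ]
    generalize g (((1 + r ^ 2) * τ + 2 * r) / distSq (-r) τ) = G
    simp only [poissonProfile]
    rw [distSq_mobius hQ.ne' hr2'.ne', distSq_mobius hQ.ne' hrs.ne', h0, mul_one, ← hu, hus,
      Real.sqrt_div (sq_nonneg _), Real.sqrt_sq hr2'.le,
      Real.sqrt_div (mul_nonneg (sq_nonneg _) hU.le), Real.sqrt_mul (sq_nonneg _),
      Real.sqrt_sq hrs.le]
    set R := Real.sqrt (distSq (-r) τ) with hR
    have hR0 : R ≠ 0 := (Real.sqrt_pos.2 hQ).ne'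
    have hRR : distSq (-r) τ = R ^ 2 := (Real.sq_sqrt hQ.le).symm
    set V := Real.sqrt (distSq u τ) with hV
    have hV0 : V ≠ 0 := (Real.sqrt_pos.2 hU).ne'
    rw [hRR]
    obtain ⟨m, rfl⟩ : ∃ m, n = m + 1 := ⟨n - 1, by omega⟩
    rw [Nat.add_sub_cancel, show 1 - r ^ 2 = 1 - r * r by ring]
    clear_value R V
    have hc : 1 - r * r ≠ 0 := hr2'.ne'
    have hd : 1 - r * s ≠ 0 := hrs.ne'
    clear hus hr2' hr2 hrs hu h0
    generalize 1 - r * r = c at *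
    generalize 1 - r * s = d at *
    generalize 1 - s ^ 2 = f at *
    simp only [div_pow, mul_pow, ← pow_mul]
    field_simp
    ring
  refine Eq.trans h1 ?_
  rw [axisInt_const_mul, axisInt_add n (F := fun τ => a * poissonProfile n u τ)
    (G := fun τ => b * (τ * poissonProfile n u τ)) (continuousOn_const.mul hPu)
    (continuousOn_const.mul (continuousOn_id.mul hPu)), axisInt_const_mul, axisInt_const_mul,
    axisInt_poissonProfile n hn humem, axisInt_mul_poissonProfile n hn humem]
  obtain ⟨m, rfl⟩ : ∃ m, n = m + 1 := ⟨n - 1, by omega⟩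
  rw [Nat.add_sub_cancel, hu]
  have hc : 1 - r ^ 2 ≠ 0 := hr2.ne'
  have hd : 1 - r * s ≠ 0 := hrs.ne'
  generalize axisInt (m + 1) (fun _ => 1) = C
  generalize 1 - r ^ 2 = c at *
  generalize 1 - r * s = d at *
  field_simp
  ring

theorem axisInt_poissonProfile_sq (n : ℕ) (hn : 2 ≤ n) {r s : ℝ} (hr : r ∈ Ioo (-1 : ℝ) 1)
    (hs : s ∈ Ioo (-1 : ℝ) 1) :
    axisInt n (fun t => poissonProfile n r t * poissonProfile n s t) =
      axisInt n (fun _ => 1) * ((1 + r * s) / (1 - r * s) ^ n) := by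
  have hr2 : 1 - r ^ 2 ≠ 0 := by nlinarith [hr.1, hr.2]
  have h := axisInt_mul_poissonProfile_mul n hn hr hs (g := fun _ => 1) (a := 1 + r ^ 2)
    (b := 2 * r) continuousOn_const (fun τ _ => by unfold distSq; ring)
  simp only [one_mul] at h
  rw [h, mul_div_assoc]
  congr 1
  rw [show (1 + r ^ 2) * (1 - r * s) + 2 * r * (s - r) = (1 - r ^ 2) * (1 + r * s) by ring,
    mul_div_mul_left _ _ hr2]

theorem axisInt_mul_poissonProfile_sq (n : ℕ) (hn : 2 ≤ n) {r s : ℝ} (hr : r ∈ Ioo (-1 : ℝ) 1)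
    (hs : s ∈ Ioo (-1 : ℝ) 1) :
    axisInt n (fun t => t * (poissonProfile n r t * poissonProfile n s t)) =
      axisInt n (fun _ => 1) * ((r + s) / (1 - r * s) ^ n) := by
  have hr' : -r ∈ Ioo (-1 : ℝ) 1 := ⟨by linarith [hr.2], by linarith [hr.1]⟩
  have hr2 : 1 - r ^ 2 ≠ 0 := by nlinarith [hr.1, hr.2]
  have h := axisInt_mul_poissonProfile_mul n hn hr hs (g := fun t => t) (a := 2 * r)
    (b := 1 + r ^ 2) continuousOn_id (fun τ hτ => by
      rw [div_mul_cancel₀ _ (distSq_pos hr' hτ).ne']; ring)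
  rw [h, mul_div_assoc]
  congr 1
  rw [show 2 * r * (1 - r * s) + (1 + r ^ 2) * (s - r) = (1 - r ^ 2) * (r + s) by ring,
    mul_div_mul_left _ _ hr2]

/-! ### The Euler operator `D = q d/dq` on `(1-q)^(-n)`. -/

/-- Numerators of the derivatives of `(1-q)^(-n)` under `q d/dq`, as polynomials in `1-q`. -/
def eulerPoly (n : ℕ) : ℕ → Polynomial ℝ
  | 0 => 1
  | p + 1 => (1 - Polynomial.X) * (((n + p : ℕ) : ℝ) • eulerPoly n p -
      Polynomial.X * Polynomial.derivative (eulerPoly n p))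

/-- `(q d/dq)^p (1-q)^(-n)`. -/
def eulerPow (n p : ℕ) (q : ℝ) : ℝ := (eulerPoly n p).eval (1 - q) / (1 - q) ^ (n + p)

/-- With `y = 1 - q`, the operator `D` sends `A(y)/y^k` to `(1-y)(k A - y A')/y^(k+1)`; this is the
recursion of `eulerPoly`. -/
theorem hasDerivAt_eulerPow (n p : ℕ) {q : ℝ} (hq : q ∈ Ioo (0 : ℝ) 1) :
    HasDerivAt (eulerPow n p) (eulerPow n (p + 1) q / q) q := by
  have hy : 1 - q ≠ 0 := (sub_pos.2 hq.2).ne'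
  have h1 : HasDerivAt (fun q : ℝ => 1 - q) (-1) q := (hasDerivAt_id q).const_sub 1
  have h2 := ((eulerPoly n p).hasDerivAt (1 - q)).comp q h1
  refine (h2.div (h1.pow (n + p)) (pow_ne_zero _ hy)).congr_deriv ?_
  have hq0 : q ≠ 0 := hq.1.ne'
  simp only [eulerPow, eulerPoly, Polynomial.eval_mul, Polynomial.eval_sub, Polynomial.eval_one,
    Polynomial.eval_X, Polynomial.eval_smul, smul_eq_mul, Function.comp_apply, Pi.pow_apply,
    sub_sub_cancel]
  -- The power rule leaves the truncated exponent `n + p - 1`, so `n + p = 0` is separated.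
  rcases Nat.eq_zero_or_pos (n + p) with h0 | h0
  · have hn : n = 0 := by omega
    have hp : p = 0 := by omega
    subst hn hp
    simp [eulerPoly]
  · obtain ⟨m, hm⟩ : ∃ m, n + p = m + 1 := ⟨n + p - 1, by omega⟩
    rw [← add_assoc, hm, Nat.add_sub_cancel]
    generalize Polynomial.eval (1 - q) (eulerPoly n p) = A
    generalize Polynomial.eval (1 - q) (Polynomial.derivative (eulerPoly n p)) = B
    generalize 1 - q = y at *
    field_simp
    ring

/-- `D^i (D+1)^j (1-q)^(-n)` with `D = q d/dq`. -/
def eulerMix (n : ℕ) : ℕ → ℕ → ℝ → ℝ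
  | i, 0 => eulerPow n i
  | i, j + 1 => fun q => eulerMix n (i + 1) j q + eulerMix n i j q

theorem hasDerivAt_eulerMix (n i j : ℕ) {q : ℝ} (hq : q ∈ Ioo (0 : ℝ) 1) :
    HasDerivAt (eulerMix n i j) (eulerMix n (i + 1) j q / q) q := by
  induction j generalizing i with
  | zero => exact hasDerivAt_eulerPow n i hq
  | succ j ih =>
    refine ((ih (i + 1)).add (ih i)).congr_deriv ?_
    simp only [eulerMix]
    rw [add_div]

/-- `D^p` of `(1+q) (1-q)^(-n)` with `D = q d/dq`. -/
def eulerMass (n p : ℕ) (q : ℝ) : ℝ := eulerMix n p 0 q + q * eulerMix n 0 p q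

/-- The shift `D + 1` comes from `D(q u) = q (D + 1) u`. -/
theorem hasDerivAt_eulerMass (n p : ℕ) {q : ℝ} (hq : q ∈ Ioo (0 : ℝ) 1) :
    HasDerivAt (eulerMass n p) (eulerMass n (p + 1) q / q) q := by
  refine ((hasDerivAt_eulerMix n p 0 hq).add
    ((hasDerivAt_id q).mul (hasDerivAt_eulerMix n 0 p hq))).congr_deriv ?_
  have hq0 : q ≠ 0 := hq.1.ne'
  simp only [eulerMass, id]
  rw [show eulerMix n 0 (p + 1) q = eulerMix n 1 p q + eulerMix n 0 p q from rfl]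
  field_simp
  ring

/-- Each level is `r d/dr` of the one below, so an identity at level zero propagates. This allows an
integral identity to be differentiated arbitrarily often, in one variable at a time. -/
theorem tower_unique {H A : ℕ → ℝ → ℝ}
    (hH : ∀ i, ∀ r ∈ Ioo (0 : ℝ) 1, HasDerivAt (H i) (H (i + 1) r / r) r)
    (hA : ∀ i, ∀ r ∈ Ioo (0 : ℝ) 1, HasDerivAt (A i) (A (i + 1) r / r) r)
    (h0 : ∀ r ∈ Ioo (0 : ℝ) 1, H 0 r = A 0 r) (i : ℕ) :
    ∀ r ∈ Ioo (0 : ℝ) 1, H i r = A i r := by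
  induction i with
  | zero => exact h0
  | succ i ih =>
    intro r hr
    have h1 : H i =ᶠ[𝓝 r] A i := by
      filter_upwards [Ioo_mem_nhds hr.1 hr.2] with s hs using ih s hs
    have h2 := (hH i r hr).unique ((hA i r hr).congr_of_eventuallyEq h1)
    rwa [div_left_inj' hr.1.ne'] at h2

/-! ### Radial derivatives of the Poisson kernel and their inner products. -/

/-- `(r ∂_r)^j` applied to the Poisson kernel, as a function of `r` and of the first coordinate. -/
def poissonDeriv (n : ℕ) : ℕ → ℝ → ℝ → ℝ
  | 0 => poissonProfile n
  | j + 1 => fun r t => r * deriv (fun s => poissonDeriv n j s t) r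

/-- The pairs `(r, t)` at which the Poisson kernel is regular. -/
def regularSet : Set (ℝ × ℝ) := {p | 0 < distSq p.1 p.2}

theorem isOpen_regularSet : IsOpen regularSet :=
  isOpen_lt continuous_const (by unfold distSq; fun_prop)

theorem mem_regularSet {r t : ℝ} (hr : r ∈ Ioo (0 : ℝ) 1) (ht : t ∈ Icc (-1 : ℝ) 1) :
    (r, t) ∈ regularSet := distSq_pos ⟨by linarith [hr.1], hr.2⟩ ht

theorem contDiffOn_poissonDeriv (n j k : ℕ) :
    ContDiffOn ℝ k (Function.uncurry (poissonDeriv n j)) regularSet := by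
  induction j generalizing k with
  | zero =>
    have h1 : ContDiff ℝ k (fun p : ℝ × ℝ => distSq p.1 p.2) := by unfold distSq; fun_prop
    have h2 : ContDiff ℝ k (fun p : ℝ × ℝ => 1 - p.1 ^ 2) := by fun_prop
    have h3 : ContDiffOn ℝ k (fun p : ℝ × ℝ => Real.sqrt (distSq p.1 p.2)) regularSet :=
      h1.contDiffOn.sqrt (fun p hp => ne_of_gt hp)
    exact h2.contDiffOn.div (h3.pow (n + 1))
      (fun p hp => pow_ne_zero _ (Real.sqrt_pos.2 hp).ne')
  | succ j ih =>
    have h1 : ContDiffOn ℝ k (fun p : ℝ × ℝ =>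
        p.1 * fderiv ℝ (Function.uncurry (poissonDeriv n j)) p (1, 0)) regularSet := by
      refine ContDiffOn.mul contDiff_fst.contDiffOn ?_
      have h2 := (ih (k + 1)).fderiv_of_isOpen (m := k) isOpen_regularSet (by push_cast; rfl)
      exact h2.clm_apply contDiffOn_const
    refine h1.congr (fun p hp => ?_)
    have h3 : DifferentiableAt ℝ (Function.uncurry (poissonDeriv n j)) p :=
      ((ih 1).contDiffAt (isOpen_regularSet.mem_nhds hp)).differentiableAt (by norm_num)
    have h4 : HasDerivAt (fun s : ℝ => (s, p.2)) ((1, 0) : ℝ × ℝ) p.1 :=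
      (hasDerivAt_id p.1).prodMk (hasDerivAt_const p.1 p.2)
    have h5 : HasDerivAt (fun s : ℝ => poissonDeriv n j s p.2)
        (fderiv ℝ (Function.uncurry (poissonDeriv n j)) p (1, 0)) p.1 :=
      HasFDerivAt.comp_hasDerivAt (f := fun s : ℝ => (s, p.2)) p.1 h3.hasFDerivAt h4
    simp only [Function.uncurry, poissonDeriv]
    rw [h5.deriv]

theorem hasDerivAt_poissonDeriv (n j : ℕ) {r t : ℝ} (hr : r ≠ 0) (h : (r, t) ∈ regularSet) :
    HasDerivAt (fun s => poissonDeriv n j s t) (poissonDeriv n (j + 1) r t / r) r := by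
  have h3 : DifferentiableAt ℝ (Function.uncurry (poissonDeriv n j)) (r, t) :=
    ((contDiffOn_poissonDeriv n j 1).contDiffAt (isOpen_regularSet.mem_nhds h)).differentiableAt
      (by norm_num)
  have h4 : DifferentiableAt ℝ (fun s : ℝ => poissonDeriv n j s t) r :=
    DifferentiableAt.comp (f := fun s : ℝ => (s, t)) r h3 (by fun_prop)
  rw [poissonDeriv, mul_div_cancel_left₀ _ hr]
  exact h4.hasDerivAt

theorem contDiffAt_poissonDeriv (n j k : ℕ) {r : ℝ} (hr : r ∈ Ioo (0 : ℝ) 1) {t : ℝ}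
    (ht : t ∈ Icc (-1 : ℝ) 1) : ContDiffAt ℝ k (poissonDeriv n j r) t :=
  ContDiffAt.comp (f := fun t : ℝ => (r, t)) t
    ((contDiffOn_poissonDeriv n j k).contDiffAt
      (isOpen_regularSet.mem_nhds (mem_regularSet hr ht))) (by fun_prop)

/-- The profile of `(r ∂_r)^j P` in the polar angle. -/
def angleProfile (n j : ℕ) (r θ : ℝ) : ℝ := poissonDeriv n j r (Real.cos θ)

theorem contDiff_angleProfile (n j : ℕ) {r : ℝ} (hr : r ∈ Ioo (0 : ℝ) 1) :
    ContDiff ℝ 2 (angleProfile n j r) := by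
  rw [contDiff_iff_contDiffAt]
  intro θ
  exact (contDiffAt_poissonDeriv n j 2 hr (Real.cos_mem_Icc θ)).comp θ
    Real.contDiff_cos.contDiffAt

theorem continuousOn_angleProfile (n j : ℕ) (A : Set ℝ) :
    ContinuousOn (Function.uncurry (angleProfile n j)) (Ioo 0 1 ×ˢ A) := by
  have h1 := (contDiffOn_poissonDeriv n j 0).continuousOn
  exact h1.comp (f := fun p : ℝ × ℝ => (p.1, Real.cos p.2)) (by fun_prop)
    (fun p hp => mem_regularSet hp.1 (Real.cos_mem_Icc _))

theorem hasDerivAt_integral_angleProfile (n j : ℕ) {ψ : ℝ → ℝ} (hψ : Continuous ψ) {r : ℝ}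
    (hr : r ∈ Ioo (0 : ℝ) 1) :
    HasDerivAt (fun r => ∫ θ in (0 : ℝ)..Real.pi, angleProfile n j r θ * ψ θ)
      ((∫ θ in (0 : ℝ)..Real.pi, angleProfile n (j + 1) r θ * ψ θ) / r) r := by
  have h := hasDerivAt_integral_of_continuousOn (a := 0) (b := Real.pi) (s₀ := r)
    (U := Ioo 0 1) (G := fun r θ => angleProfile n j r θ * ψ θ)
    (G' := fun r θ => angleProfile n (j + 1) r θ / r * ψ θ) isOpen_Ioo hr
    (fun s hs θ _ => (hasDerivAt_poissonDeriv n j hs.1.ne'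
      (mem_regularSet hs (Real.cos_mem_Icc θ))).mul_const _)
    ((continuousOn_angleProfile n j _).mul (Continuous.continuousOn (by fun_prop)))
    (((continuousOn_angleProfile n (j + 1) _).div (by fun_prop)
      (fun p hp => hp.1.1.ne')).mul (Continuous.continuousOn (by fun_prop)))
  refine h.congr_deriv ?_
  rw [div_eq_mul_inv, ← intervalIntegral.integral_mul_const]
  congr 1
  ext θ
  ring

theorem mul_mem_Ioo {r s : ℝ} (hr : r ∈ Ioo (0 : ℝ) 1) (hs : s ∈ Ioo (0 : ℝ) 1) :
    r * s ∈ Ioo (0 : ℝ) 1 :=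
  ⟨mul_pos hr.1 hs.1, by nlinarith [hr.1, hr.2, hs.1, hs.2]⟩

theorem hasDerivAt_comp_mul {f : ℝ → ℝ} {f' r s : ℝ} (hr : r ≠ 0) (hs : s ≠ 0)
    (h : HasDerivAt f (f' / (r * s)) (r * s)) : HasDerivAt (fun r => f (r * s)) (f' / r) r := by
  refine (h.comp (h := fun r => r * s) r ((hasDerivAt_id r).mul_const s)).congr_deriv ?_
  field_simp

/-- The total weight `∫ sin^(n-1)`. -/
def totalWeight (n : ℕ) : ℝ := axisInt n (fun _ => 1)

theorem totalWeight_pos (n : ℕ) (hn : 2 ≤ n) : 0 < totalWeight n := by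
  rw [totalWeight, ← integral_sin_pow_mul_cos n hn continuousOn_const]
  refine intervalIntegral.intervalIntegral_pos_of_pos_on
    (Continuous.intervalIntegrable (by fun_prop) _ _) (fun θ hθ => ?_) Real.pi_pos
  exact mul_pos (pow_pos (Real.sin_pos_of_pos_of_lt_pi hθ.1 hθ.2) _) one_pos

/-- For `i = j = 0` this is `(1+q)/(1-q)^n` with `q = rs`. On functions of `rs` both `r∂_r` and
`s∂_s` act as `D`; one tower in `r` and then one in `s` raise the orders. -/
theorem integral_angleProfile_mul (n : ℕ) (hn : 2 ≤ n) (i j : ℕ) {r s : ℝ}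
    (hr : r ∈ Ioo (0 : ℝ) 1) (hs : s ∈ Ioo (0 : ℝ) 1) :
    ∫ θ in (0 : ℝ)..Real.pi, angleProfile n j s θ *
      (Real.sin θ ^ (n - 1) * angleProfile n i r θ) =
      totalWeight n * eulerMass n (i + j) (r * s) := by
  have hm : ∀ {x : ℝ}, x ∈ Ioo (0 : ℝ) 1 → x ∈ Ioo (-1 : ℝ) 1 := fun hx =>
    ⟨by linarith [hx.1], hx.2⟩
  have base : ∀ s ∈ Ioo (0 : ℝ) 1, ∀ r ∈ Ioo (0 : ℝ) 1,
      ∫ θ in (0 : ℝ)..Real.pi, angleProfile n 0 r θ *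
        (Real.sin θ ^ (n - 1) * angleProfile n 0 s θ) =
      totalWeight n * eulerMass n 0 (r * s) := by
    intro s hs r hr
    have h1 := integral_sin_pow_mul_cos n hn
      (F := fun t => poissonProfile n r t * poissonProfile n s t)
      ((continuousOn_poissonProfile n (hm hr)).mul (continuousOn_poissonProfile n (hm hs)))
    rw [axisInt_poissonProfile_sq n hn (hm hr) (hm hs)] at h1
    have e1 : eulerMass n 0 (r * s) = (1 + r * s) / (1 - r * s) ^ n := by
      simp [eulerMass, eulerMix, eulerPow, eulerPoly]
      ring
    rw [e1, totalWeight, ← h1]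
    congr 1
    ext θ
    simp only [angleProfile, poissonDeriv]
    ring
  have step1 : ∀ s ∈ Ioo (0 : ℝ) 1, ∀ r ∈ Ioo (0 : ℝ) 1,
      ∫ θ in (0 : ℝ)..Real.pi, angleProfile n i r θ *
        (Real.sin θ ^ (n - 1) * angleProfile n 0 s θ) =
      totalWeight n * eulerMass n i (r * s) := by
    intro s hs
    have hc := (contDiff_angleProfile n 0 hs).continuous
    exact tower_unique
      (H := fun i r => ∫ θ in (0 : ℝ)..Real.pi, angleProfile n i r θ *
        (Real.sin θ ^ (n - 1) * angleProfile n 0 s θ))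
      (A := fun i r => totalWeight n * eulerMass n i (r * s))
      (fun i r hr => hasDerivAt_integral_angleProfile n i (by fun_prop) hr)
      (fun i r hr => ((hasDerivAt_comp_mul hr.1.ne' hs.1.ne'
        (hasDerivAt_eulerMass n i (mul_mem_Ioo hr hs))).const_mul _).congr_deriv
          (by rw [mul_div_assoc])) (base s hs) i
  have hc := (contDiff_angleProfile n i hr).continuous
  exact tower_unique
      (H := fun j s => ∫ θ in (0 : ℝ)..Real.pi, angleProfile n j s θ *
        (Real.sin θ ^ (n - 1) * angleProfile n i r θ))
      (A := fun j s => totalWeight n * eulerMass n (i + j) (r * s))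
      (fun j s hs => hasDerivAt_integral_angleProfile n j (by fun_prop) hs)
      (fun j s hs => by
        have := hasDerivAt_eulerMass n (i + j) (mul_mem_Ioo hs hr)
        have h2 := (hasDerivAt_comp_mul hs.1.ne' hr.1.ne' this).const_mul (totalWeight n)
        simp_rw [mul_comm r]
        exact h2.congr_deriv (by rw [mul_div_assoc]; rfl))
      (fun s hs => by
        rw [add_zero, ← step1 s hs r hr]
        congr 1; ext θ; ring) j s hs

/-- Start from `(r + s) u(rs)` with `u = (1-q)^(-n)`. The operator `r∂_r` acts as `D + 1` on the `u`
in `r u(rs)` and as `D` on the one in `s u(rs)`, and `s∂_s` acts the other way round. -/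
theorem integral_cos_mul_angleProfile_mul (n : ℕ) (hn : 2 ≤ n) (i j : ℕ) {r s : ℝ}
    (hr : r ∈ Ioo (0 : ℝ) 1) (hs : s ∈ Ioo (0 : ℝ) 1) :
    ∫ θ in (0 : ℝ)..Real.pi, angleProfile n j s θ *
      (Real.sin θ ^ (n - 1) * (Real.cos θ * angleProfile n i r θ)) =
      totalWeight n * (r * eulerMix n j i (r * s) + s * eulerMix n i j (r * s)) := by
  have hm : ∀ {x : ℝ}, x ∈ Ioo (0 : ℝ) 1 → x ∈ Ioo (-1 : ℝ) 1 := fun hx =>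
    ⟨by linarith [hx.1], hx.2⟩
  have base : ∀ s ∈ Ioo (0 : ℝ) 1, ∀ r ∈ Ioo (0 : ℝ) 1,
      ∫ θ in (0 : ℝ)..Real.pi, angleProfile n 0 r θ *
        (Real.sin θ ^ (n - 1) * (Real.cos θ * angleProfile n 0 s θ)) =
      totalWeight n * (r * eulerMix n 0 0 (r * s) + s * eulerMix n 0 0 (r * s)) := by
    intro s hs r hr
    have h1 := integral_sin_pow_mul_cos n hn
      (F := fun t => t * (poissonProfile n r t * poissonProfile n s t))
      (continuousOn_id.mul ((continuousOn_poissonProfile n (hm hr)).mul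
        (continuousOn_poissonProfile n (hm hs))))
    rw [axisInt_mul_poissonProfile_sq n hn (hm hr) (hm hs)] at h1
    have e1 : eulerMix n 0 0 (r * s) = 1 / (1 - r * s) ^ n := by
      simp [eulerMix, eulerPow, eulerPoly]
    rw [← add_mul, e1, mul_one_div, totalWeight, ← h1]
    congr 1
    ext θ
    simp only [angleProfile, poissonDeriv]
    ring
  have step1 : ∀ s ∈ Ioo (0 : ℝ) 1, ∀ r ∈ Ioo (0 : ℝ) 1,
      ∫ θ in (0 : ℝ)..Real.pi, angleProfile n i r θ *
        (Real.sin θ ^ (n - 1) * (Real.cos θ * angleProfile n 0 s θ)) =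
      totalWeight n * (r * eulerMix n 0 i (r * s) + s * eulerMix n i 0 (r * s)) := by
    intro s hs
    have hc := (contDiff_angleProfile n 0 hs).continuous
    exact tower_unique
      (H := fun i r => ∫ θ in (0 : ℝ)..Real.pi, angleProfile n i r θ *
        (Real.sin θ ^ (n - 1) * (Real.cos θ * angleProfile n 0 s θ)))
      (A := fun i r => totalWeight n * (r * eulerMix n 0 i (r * s) + s * eulerMix n i 0 (r * s)))
      (fun i r hr => hasDerivAt_integral_angleProfile n i (by fun_prop) hr)
      (fun i r hr => by
        have h1 := hasDerivAt_comp_mul hr.1.ne' hs.1.ne'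
          (hasDerivAt_eulerMix n 0 i (mul_mem_Ioo hr hs))
        have h2 := hasDerivAt_comp_mul hr.1.ne' hs.1.ne'
          (hasDerivAt_eulerMix n i 0 (mul_mem_Ioo hr hs))
        refine ((((hasDerivAt_id r).mul h1).add (h2.const_mul s)).const_mul _).congr_deriv ?_
        have hr0 := hr.1.ne'
        rw [show eulerMix n 0 (i + 1) (r * s) = eulerMix n 1 i (r * s) + eulerMix n 0 i (r * s)
          from rfl]
        simp only [id, zero_add]
        field_simp
        ring) (base s hs) i
  have hc := (contDiff_angleProfile n i hr).continuous
  exact tower_unique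
      (H := fun j s => ∫ θ in (0 : ℝ)..Real.pi, angleProfile n j s θ *
        (Real.sin θ ^ (n - 1) * (Real.cos θ * angleProfile n i r θ)))
      (A := fun j s => totalWeight n *
        (r * eulerMix n j i (r * s) + s * eulerMix n i j (r * s)))
      (fun j s hs => hasDerivAt_integral_angleProfile n j (by fun_prop) hs)
      (fun j s hs => by
        have h1 := hasDerivAt_comp_mul hs.1.ne' hr.1.ne'
          (hasDerivAt_eulerMix n j i (mul_mem_Ioo hs hr))
        have h2 := hasDerivAt_comp_mul hs.1.ne' hr.1.ne'
          (hasDerivAt_eulerMix n i j (mul_mem_Ioo hs hr))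
        simp_rw [mul_comm r]
        refine (((h1.mul_const r).add ((hasDerivAt_id s).mul h2)).const_mul _).congr_deriv ?_
        have hs0 := hs.1.ne'
        rw [show eulerMix n i (j + 1) (s * r) = eulerMix n (i + 1) j (s * r) +
          eulerMix n i j (s * r) from rfl]
        simp only [id]
        field_simp
        ring)
      (fun s hs => by
        rw [← step1 s hs r hr]
        congr 1; ext θ; ring) j s hs

theorem poissonDeriv_one (n : ℕ) {r t : ℝ} (hr : r ∈ Ioo (0 : ℝ) 1) (ht : t ∈ Icc (-1 : ℝ) 1) :
    poissonDeriv n 1 r t = -2 * r ^ 2 / Real.sqrt (distSq r t) ^ (n + 1) -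
      (n + 1) * (r ^ 2 - r ^ 4) * (1 - t / r) / Real.sqrt (distSq r t) ^ (n + 3) := by
  have hQ : 0 < distSq r t := mem_regularSet hr ht
  have hr0 := hr.1.ne'
  have hd : HasDerivAt (fun s => distSq s t) (2 * (r - t)) r := by
    have := (((((hasDerivAt_id r).const_mul 2).mul_const t).const_sub 1).add
      ((hasDerivAt_id r).pow 2))
    refine this.congr_deriv ?_
    simp; ring
  have h1 := (((hasDerivAt_id r).pow 2).const_sub 1).div ((hd.sqrt hQ.ne').pow (n + 1))
    (pow_ne_zero _ (Real.sqrt_pos.2 hQ).ne')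
  have h2 : HasDerivAt (fun s => poissonDeriv n 0 s t) _ r := h1
  change r * deriv (fun s => poissonDeriv n 0 s t) r = _
  rw [h2.deriv]
  simp only [id, Pi.pow_apply]
  set R := Real.sqrt (distSq r t)
  have hR0 : R ≠ 0 := (Real.sqrt_pos.2 hQ).ne'
  rw [Nat.add_sub_cancel]
  push_cast
  field_simp
  ring

theorem poissonDeriv_two (n : ℕ) {r t : ℝ} (hr : r ∈ Ioo (0 : ℝ) 1) (ht : t ∈ Icc (-1 : ℝ) 1) :
    poissonDeriv n 2 r t = -4 * r ^ 2 / Real.sqrt (distSq r t) ^ (n + 1) +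
      (n + 1) * (2 * r ^ 3 * (r - t) - r * ((1 - 3 * r ^ 2) * (r - t) + (r - r ^ 3))) /
        Real.sqrt (distSq r t) ^ (n + 3) +
      (n + 1) * (n + 3) * (r ^ 2 - r ^ 4) * (r - t) ^ 2 / Real.sqrt (distSq r t) ^ (n + 5) := by
  have hQ : 0 < distSq r t := mem_regularSet hr ht
  have hr0 := hr.1.ne'
  have hd : HasDerivAt (fun s => distSq s t) (2 * (r - t)) r := by
    have := (((((hasDerivAt_id r).const_mul 2).mul_const t).const_sub 1).add
      ((hasDerivAt_id r).pow 2))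
    refine this.congr_deriv ?_
    simp; ring
  have hR := hd.sqrt hQ.ne'
  have hRne : Real.sqrt (distSq r t) ≠ 0 := (Real.sqrt_pos.2 hQ).ne'
  have h1 := ((((hasDerivAt_id r).pow 2).const_mul (-2)).div (hR.pow (n + 1))
    (pow_ne_zero _ hRne)).sub
    (((((hasDerivAt_id r).sub ((hasDerivAt_id r).pow 3)).const_mul ((n : ℝ) + 1)).mul
      ((hasDerivAt_id r).sub_const t)).div (hR.pow (n + 3)) (pow_ne_zero _ hRne))
  have hev : (fun s => poissonDeriv n 1 s t) =ᶠ[𝓝 r]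
      fun s => -2 * s ^ 2 / Real.sqrt (distSq s t) ^ (n + 1) -
        ((n : ℝ) + 1) * (s - s ^ 3) * (s - t) / Real.sqrt (distSq s t) ^ (n + 3) := by
    filter_upwards [Ioo_mem_nhds hr.1 hr.2] with s hs
    rw [poissonDeriv_one n hs ht]
    have := hs.1.ne'
    congr 2
    field_simp
  have h2 := HasDerivAt.congr_of_eventuallyEq (f₁ := fun s => poissonDeriv n 1 s t) h1 hev
  change r * deriv (fun s => poissonDeriv n 1 s t) r = _
  rw [h2.deriv]
  simp only [id, Pi.pow_apply, Pi.mul_apply, Pi.sub_apply]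
  set R := Real.sqrt (distSq r t)
  have hR0 : R ≠ 0 := hRne
  rw [Nat.add_sub_cancel, show n + 3 - 1 = n + 2 from rfl]
  push_cast
  field_simp
  ring

/-- Laplace's equation in polar form: the Poisson kernel is harmonic in the ball of dimension `n +
1`. -/
theorem lapTheta_angleProfile_zero (n : ℕ) (hn : 2 ≤ n) {r : ℝ} (hr : r ∈ Ioo (0 : ℝ) 1) (θ : ℝ) :
    lapTheta n (angleProfile n 0 r) θ = -(Real.sin θ ^ (n - 1) *
      (angleProfile n 2 r θ + ((n : ℝ) - 1) * angleProfile n 1 r θ)) := by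
  have hQ : ∀ θ, 0 < distSq r (Real.cos θ) := fun θ => mem_regularSet hr (Real.cos_mem_Icc θ)
  have hd : ∀ θ, HasDerivAt (fun θ => distSq r (Real.cos θ)) (2 * r * Real.sin θ) θ := by
    intro θ
    refine ((((Real.hasDerivAt_cos θ).const_mul (2 * r)).const_sub 1).add_const
      (r ^ 2)).congr_deriv ?_
    ring
  have hR := fun θ => (hd θ).sqrt (hQ θ).ne'
  have hRne : ∀ θ, Real.sqrt (distSq r (Real.cos θ)) ≠ 0 := fun θ => (Real.sqrt_pos.2 (hQ θ)).ne'
  have h1 : deriv (angleProfile n 0 r) = fun θ => -(((n : ℝ) + 1) * (1 - r ^ 2) * r) *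
      (Real.sin θ / Real.sqrt (distSq r (Real.cos θ)) ^ (n + 3)) := by
    ext θ
    have h := (hasDerivAt_const θ (1 - r ^ 2)).div ((hR θ).pow (n + 1))
      (pow_ne_zero _ (hRne θ))
    have h' : HasDerivAt (angleProfile n 0 r) _ θ := h
    rw [h'.deriv, Nat.add_sub_cancel]
    simp only [Pi.pow_apply]
    have := hRne θ
    generalize Real.sqrt (distSq r (Real.cos θ)) = R at *
    push_cast
    field_simp
    ring
  have h2 := ((Real.hasDerivAt_sin θ).div ((hR θ).pow (n + 3))
      (pow_ne_zero _ (hRne θ))).const_mul (-(((n : ℝ) + 1) * (1 - r ^ 2) * r))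
  have h2' := HasDerivAt.congr_of_eventuallyEq (f₁ := deriv (angleProfile n 0 r)) h2
    (Filter.Eventually.of_forall fun θ => congrFun h1 θ)
  rw [lapTheta, h2'.deriv, h1, angleProfile, angleProfile,
    poissonDeriv_one n hr (Real.cos_mem_Icc θ), poissonDeriv_two n hr (Real.cos_mem_Icc θ)]
  simp only [Pi.pow_apply, smul_eq_mul]
  have hr0 := hr.1.ne'
  have hne := hRne θ
  have hRR : Real.sqrt (distSq r (Real.cos θ)) ^ 2 = 1 - 2 * r * Real.cos θ + r ^ 2 :=
    Real.sq_sqrt (hQ θ).le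
  have hss : Real.sin θ ^ 2 = 1 - Real.cos θ ^ 2 := Real.sin_sq θ
  generalize Real.sqrt (distSq r (Real.cos θ)) = R at *
  generalize Real.sin θ = s at *
  generalize Real.cos θ = t at *
  obtain ⟨m, rfl⟩ : ∃ m, n = m + 2 := ⟨n - 2, by omega⟩
  rw [show m + 2 - 1 = m + 1 from rfl, Nat.add_sub_cancel, show m + 2 + 3 - 1 = m + 4 from rfl]
  -- By `R² = 1 - 2rt + r²` all terms get the denominator `R^(n+5)`; the rest is a polynomial
  -- identity.
  have hX : ∀ a b c : ℝ, a / R ^ (m + 2 + 1) + b / R ^ (m + 2 + 3) + c / R ^ (m + 2 + 5) =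
      (a * (1 - 2 * r * t + r ^ 2) ^ 2 + b * (1 - 2 * r * t + r ^ 2) + c) / R ^ (m + 2 + 5) := by
    intro a b c
    rw [← hRR]
    field_simp
    ring
  have e1 : s ^ (m + 1) * (-((((m + 2 : ℕ) : ℝ) + 1) * (1 - r ^ 2) * r) *
      ((t * R ^ (m + 2 + 3) - s * (((m + 2 + 3 : ℕ) : ℝ) * R ^ (m + 4) *
        (2 * r * s / (2 * R)))) / (R ^ (m + 2 + 3)) ^ 2)) +
      ((m + 1 : ℕ) : ℝ) * s ^ m * t * (-((((m + 2 : ℕ) : ℝ) + 1) * (1 - r ^ 2) * r) *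
        (s / R ^ (m + 2 + 3))) =
      s ^ (m + 1) * (0 / R ^ (m + 2 + 1) +
        (-((((m + 2 : ℕ) : ℝ) + 1) * (1 - r ^ 2) * r) * (((m + 2 : ℕ) : ℝ) * t)) / R ^ (m + 2 + 3) +
        ((((m + 2 : ℕ) : ℝ) + 1) * (1 - r ^ 2) * r * ((m + 2 + 3 : ℕ) : ℝ) * r * (1 - t ^ 2)) /
          R ^ (m + 2 + 5)) := by
    rw [← hss]
    push_cast
    field_simp
    ring
  have e2 : (-4 * r ^ 2 / R ^ (m + 2 + 1) + (((m + 2 : ℕ) : ℝ) + 1) *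
      (2 * r ^ 3 * (r - t) - r * ((1 - 3 * r ^ 2) * (r - t) + (r - r ^ 3))) / R ^ (m + 2 + 3) +
      (((m + 2 : ℕ) : ℝ) + 1) * (((m + 2 : ℕ) : ℝ) + 3) * (r ^ 2 - r ^ 4) * (r - t) ^ 2 /
        R ^ (m + 2 + 5) + (((m + 2 : ℕ) : ℝ) - 1) * (-2 * r ^ 2 / R ^ (m + 2 + 1) -
      (((m + 2 : ℕ) : ℝ) + 1) * (r ^ 2 - r ^ 4) * (1 - t / r) / R ^ (m + 2 + 3))) =
      ((-4 * r ^ 2 - 2 * r ^ 2 * (((m + 2 : ℕ) : ℝ) - 1)) / R ^ (m + 2 + 1) +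
      ((((m + 2 : ℕ) : ℝ) + 1) *
      (2 * r ^ 3 * (r - t) - r * ((1 - 3 * r ^ 2) * (r - t) + (r - r ^ 3))) -
        (((m + 2 : ℕ) : ℝ) - 1) * (((m + 2 : ℕ) : ℝ) + 1) * (r - r ^ 3) * (r - t)) /
          R ^ (m + 2 + 3) +
      ((((m + 2 : ℕ) : ℝ) + 1) * (((m + 2 : ℕ) : ℝ) + 3) * (r ^ 2 - r ^ 4) * (r - t) ^ 2) /
        R ^ (m + 2 + 5)) := by
    field_simp
    ring
  refine Eq.trans e1 ?_
  rw [e2, hX, hX]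
  refine Eq.trans (congrArg (s ^ (m + 1) * ·) (Eq.trans (congrArg (· / R ^ (m + 2 + 5)) ?_)
    (neg_div _ _))) (mul_neg _ _)
  push_cast
  ring

/-- For `j = 0` integration by parts puts the Laplacian on the undifferentiated kernel, where
Laplace's equation trades it for radial derivatives. To raise `j` the Laplacian is moved to the
fixed `r`-factor (`hsymm`), so that the integrand contains no `θ`-derivative of the factor being
differentiated in `s`. -/
theorem integral_deriv_angleProfile_mul (n : ℕ) (hn : 2 ≤ n) (i j : ℕ) {r s : ℝ}
    (hr : r ∈ Ioo (0 : ℝ) 1) (hs : s ∈ Ioo (0 : ℝ) 1) :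
    ∫ θ in (0 : ℝ)..Real.pi, Real.sin θ ^ (n - 1) *
      (deriv (angleProfile n i r) θ * deriv (angleProfile n j s) θ) =
      totalWeight n * (eulerMass n (i + j + 2) (r * s) +
        ((n : ℝ) - 1) * eulerMass n (i + j + 1) (r * s)) := by
  have hi := contDiff_angleProfile n i hr
  have hsymm : ∀ j, ∀ s ∈ Ioo (0 : ℝ) 1,
      -∫ θ in (0 : ℝ)..Real.pi, angleProfile n j s θ * lapTheta n (angleProfile n i r) θ =
      ∫ θ in (0 : ℝ)..Real.pi, Real.sin θ ^ (n - 1) *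
      (deriv (angleProfile n i r) θ * deriv (angleProfile n j s) θ) := by
    intro j s hs
    have := integral_lapTheta_mul n hn hi (contDiff_angleProfile n j hs)
    simp only [smul_eq_mul] at this
    simp_rw [mul_comm (angleProfile n j s _)]
    rw [this, neg_neg]
  have base : ∀ s ∈ Ioo (0 : ℝ) 1,
      -∫ θ in (0 : ℝ)..Real.pi, angleProfile n 0 s θ * lapTheta n (angleProfile n i r) θ =
      totalWeight n * (eulerMass n (i + 0 + 2) (r * s) +
        ((n : ℝ) - 1) * eulerMass n (i + 0 + 1) (r * s)) := by
    intro s hs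
    have h1 := integral_lapTheta_mul n hn (contDiff_angleProfile n 0 hs) hi
    simp only [smul_eq_mul] at h1
    have h0 := (contDiff_angleProfile n i hr).continuous
    have c1 := (contDiff_angleProfile n 1 hs).continuous
    have c2 := (contDiff_angleProfile n 2 hs).continuous
    rw [hsymm 0 s hs]
    simp_rw [mul_comm (deriv (angleProfile n i r) _)]
    rw [← neg_eq_iff_eq_neg.2 h1, ← intervalIntegral.integral_neg, mul_add, mul_left_comm,
      add_zero, ← integral_angleProfile_mul n hn i 2 hr hs,
      ← integral_angleProfile_mul n hn i 1 hr hs, ← intervalIntegral.integral_const_mul,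
      ← intervalIntegral.integral_add (Continuous.intervalIntegrable (by fun_prop) _ _)
        (Continuous.intervalIntegrable (by fun_prop) _ _)]
    congr 1
    ext θ
    rw [lapTheta_angleProfile_zero n hn hs]
    ring
  rw [← hsymm j s hs]
  exact tower_unique
      (H := fun j s => -∫ θ in (0 : ℝ)..Real.pi, angleProfile n j s θ *
        lapTheta n (angleProfile n i r) θ)
      (A := fun j s => totalWeight n * (eulerMass n (i + j + 2) (r * s) +
        ((n : ℝ) - 1) * eulerMass n (i + j + 1) (r * s)))
      (fun j s hs => (hasDerivAt_integral_angleProfile n j (continuous_lapTheta n hi)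
        hs).neg.congr_deriv (by rw [neg_div]))
      (fun j s hs => by
        have h1 := hasDerivAt_comp_mul hs.1.ne' hr.1.ne'
          (hasDerivAt_eulerMass n (i + j + 2) (mul_mem_Ioo hs hr))
        have h2 := hasDerivAt_comp_mul hs.1.ne' hr.1.ne'
          (hasDerivAt_eulerMass n (i + j + 1) (mul_mem_Ioo hs hr))
        simp_rw [mul_comm r]
        refine ((h1.add (h2.const_mul ((n : ℝ) - 1))).const_mul _).congr_deriv ?_
        rw [show i + (j + 1) + 2 = i + j + 2 + 1 by ring, show i + (j + 1) + 1 = i + j + 1 + 1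
          by ring]
        ring)
      base j s hs

/-! ### The wavelets as multiples of radial derivatives of the kernel. -/

theorem poissonKernel_eq (n : ℕ) (r : ℝ) (x : Sph n) : poissonKernel n r x =
    1 / (surf n).real univ * poissonProfile n r ((x : EuclideanSpace ℝ (Fin (n + 1))) 0) := by
  have h2 : ‖EuclideanSpace.single (0 : Fin (n + 1)) r - (x : EuclideanSpace ℝ (Fin (n + 1)))‖ =
      Real.sqrt (distSq r ((x : EuclideanSpace ℝ (Fin (n + 1))) 0)) := by
    have h3 := norm_add_smul_single n x 0 (-r)
    rw [norm_sub_rev, distSq, sub_eq_add_neg, show 1 - 2 * r *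
      (x : EuclideanSpace ℝ (Fin (n + 1))) 0 + r ^ 2 = 1 + 2 * -r *
      (x : EuclideanSpace ℝ (Fin (n + 1))) 0 + (-r) ^ 2 by ring, ← h3]
    congr 2
    ext i
    by_cases hi : i = 0 <;> simp [hi]
  rw [poissonKernel, h2, poissonProfile]

theorem iterate_scaledRadialDeriv (n m : ℕ) (ρ : ℝ) (x : Sph n) :
    ∀ r ∈ Ioo (0 : ℝ) 1, (scaledRadialDeriv n ρ)^[m] (poissonKernel n) r x =
      ρ ^ m * (1 / (surf n).real univ) *
        poissonDeriv n m r ((x : EuclideanSpace ℝ (Fin (n + 1))) 0) := by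
  induction m with
  | zero => intro r _; simp [poissonKernel_eq, poissonDeriv]
  | succ m ih =>
    intro r hr
    rw [Function.iterate_succ_apply']
    have hev : (fun s => (scaledRadialDeriv n ρ)^[m] (poissonKernel n) s x) =ᶠ[𝓝 r]
        fun s => ρ ^ m * (1 / (surf n).real univ) *
          poissonDeriv n m s ((x : EuclideanSpace ℝ (Fin (n + 1))) 0) := by
      filter_upwards [Ioo_mem_nhds hr.1 hr.2] with s hs using ih s hs
    have hd := (hasDerivAt_poissonDeriv n m hr.1.ne'
      (mem_regularSet hr (first_mem_Icc n x))).const_mul (ρ ^ m * (1 / (surf n).real univ))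
    have hr0 := hr.1.ne'
    rw [scaledRadialDeriv, hev.deriv_eq, hd.deriv]
    field_simp
    ring

/-! ### Asymptotics as `r → 1`. -/

/-- The rising factorial `n (n+1) ⋯ (n+p-1)`. -/
def rising (n p : ℕ) : ℝ := ∏ k ∈ Finset.range p, ((n + k : ℕ) : ℝ)

theorem rising_succ (n p : ℕ) : rising n (p + 1) = rising n p * ((n : ℝ) + p) := by
  rw [rising, Finset.prod_range_succ, ← rising, Nat.cast_add]

theorem rising_pos (n p : ℕ) (hn : 1 ≤ n) : 0 < rising n p :=
  Finset.prod_pos fun k _ => Nat.cast_pos.2 (by omega)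

theorem eval_zero_eulerPoly (n p : ℕ) : (eulerPoly n p).eval 0 = rising n p := by
  induction p with
  | zero => simp [eulerPoly, rising]
  | succ p ih => simp [eulerPoly, rising_succ, ih]; ring

theorem tendsto_one_sub : Tendsto (fun q : ℝ => 1 - q) (𝓝[<] 1) (𝓝 0) := by
  have : Tendsto (fun q : ℝ => 1 - q) (𝓝 1) (𝓝 (1 - 1)) :=
    (continuous_const.sub continuous_id).tendsto 1
  rw [sub_self] at this
  exact this.mono_left nhdsWithin_le_nhds

/-- Each `D` raises the order of the pole at `q = 1` by one, so `D + 1` and `D` have the same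
leading effect. -/
theorem tendsto_eulerMix (n i j : ℕ) :
    Tendsto (fun q : ℝ => (1 - q) ^ (n + (i + j)) * eulerMix n i j q) (𝓝[<] 1)
      (𝓝 (rising n (i + j))) := by
  induction j generalizing i with
  | zero =>
    have h1 : Tendsto (fun q : ℝ => (eulerPoly n i).eval (1 - q)) (𝓝[<] 1)
        (𝓝 ((eulerPoly n i).eval 0)) :=
      ((eulerPoly n i).continuous.tendsto 0).comp tendsto_one_sub
    rw [eval_zero_eulerPoly] at h1
    refine h1.congr' ?_
    filter_upwards [self_mem_nhdsWithin] with q hq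
    have : (1 - q) ^ (n + i) ≠ 0 := pow_ne_zero _ (sub_pos.2 hq).ne'
    simp only [eulerMix, eulerPow, add_zero]
    rw [mul_div_cancel₀ _ this]
  | succ j ih =>
    have h := (ih (i + 1)).add (tendsto_one_sub.mul (ih i))
    rw [zero_mul, add_zero, show i + 1 + j = i + (j + 1) by ring] at h
    refine h.congr fun q => ?_
    simp only [eulerMix]
    rw [← add_assoc i j 1, ← add_assoc n (i + j) 1, pow_succ]
    ring

/-- Second-order term: `(D+1)^j - D^j` has leading part `j D^(j-1)`. -/
theorem tendsto_eulerMix_sub (n p i j : ℕ) (hp : i + j = p + 1) :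
    Tendsto (fun q : ℝ => (1 - q) ^ (n + p) * (eulerMix n i j q - eulerMix n (p + 1) 0 q))
      (𝓝[<] 1) (𝓝 (j * rising n p)) := by
  induction j generalizing i with
  | zero =>
    rw [add_zero] at hp
    subst hp
    simp
  | succ j ih =>
    have hp' : i + j = p := by omega
    have h := (ih (i + 1) (by omega)).add (tendsto_eulerMix n i j)
    rw [hp'] at h
    have e : (j : ℝ) * rising n p + rising n p = ((j + 1 : ℕ) : ℝ) * rising n p := by
      push_cast; ring
    rw [e] at h
    refine h.congr fun q => ?_
    simp only [eulerMix]
    ring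

/-- Third-order term: the binomial coefficient of `D^(j-2)` in `(D+1)^j`. -/
theorem tendsto_eulerMix_sub_sub (n p i j : ℕ) (hp : i + j = p + 2) :
    Tendsto (fun q : ℝ => (1 - q) ^ (n + p) * (eulerMix n i j q - eulerMix n (p + 2) 0 q -
      j * eulerMix n (p + 1) 0 q)) (𝓝[<] 1) (𝓝 (j * (j - 1) / 2 * rising n p)) := by
  induction j generalizing i with
  | zero =>
    rw [add_zero] at hp
    subst hp
    simp
  | succ j ih =>
    have h := (ih (i + 1) (by omega)).add (tendsto_eulerMix_sub n p i j (by omega))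
    have e : (j : ℝ) * (j - 1) / 2 * rising n p + j * rising n p =
        ((j + 1 : ℕ) : ℝ) * (((j + 1 : ℕ) : ℝ) - 1) / 2 * rising n p := by
      push_cast; ring
    rw [e] at h
    refine h.congr fun q => ?_
    simp only [eulerMix]
    push_cast
    ring

theorem tendsto_eulerMass (n p : ℕ) :
    Tendsto (fun q : ℝ => (1 - q) ^ (n + p) * eulerMass n p q) (𝓝[<] 1)
      (𝓝 (2 * rising n p)) := by
  have hq : Tendsto (fun q : ℝ => q) (𝓝[<] 1) (𝓝 1) := nhdsWithin_le_nhds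
  have h := (tendsto_eulerMix n p 0).add (hq.mul (tendsto_eulerMix n 0 p))
  rw [add_zero, zero_add, one_mul, ← two_mul] at h
  refine h.congr fun q => ?_
  simp only [eulerMass]
  ring

theorem tendsto_sq_left : Tendsto (fun r : ℝ => r ^ 2) (𝓝[<] 1) (𝓝[<] 1) := by
  refine tendsto_nhdsWithin_iff.2 ⟨?_, ?_⟩
  · have : Tendsto (fun r : ℝ => r ^ 2) (𝓝 1) (𝓝 (1 ^ 2)) := (continuous_pow 2).tendsto 1
    rw [one_pow] at this
    exact this.mono_left nhdsWithin_le_nhds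
  · filter_upwards [Ioo_mem_nhdsLT (show (0 : ℝ) < 1 by norm_num)] with r hr
    exact pow_lt_one₀ hr.1.le hr.2 two_ne_zero

theorem tendsto_id_left : Tendsto (fun r : ℝ => r) (𝓝[<] 1) (𝓝 1) := nhdsWithin_le_nhds

/-- The mass, first moment and energy of the Poisson wavelet of order `m`, up to a common factor. -/
def waveletMass (n m : ℕ) (r : ℝ) : ℝ := eulerMass n (2 * m) (r ^ 2)

/-- The first moment of the Poisson wavelet. -/
def waveletMoment (n m : ℕ) (r : ℝ) : ℝ := 2 * r * eulerMix n m m (r ^ 2)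

/-- The energy of the Poisson wavelet. -/
def waveletEnergy (n m : ℕ) (r : ℝ) : ℝ :=
  eulerMass n (2 * m + 2) (r ^ 2) + ((n : ℝ) - 1) * eulerMass n (2 * m + 1) (r ^ 2)

theorem tendsto_waveletMass (n m : ℕ) :
    Tendsto (fun r : ℝ => (1 - r ^ 2) ^ (n + 2 * m) * waveletMass n m r) (𝓝[<] 1)
      (𝓝 (2 * rising n (2 * m))) :=
  (tendsto_eulerMass n (2 * m)).comp tendsto_sq_left

theorem tendsto_waveletMoment (n m : ℕ) :
    Tendsto (fun r : ℝ => (1 - r ^ 2) ^ (n + 2 * m) * waveletMoment n m r) (𝓝[<] 1)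
      (𝓝 (2 * rising n (2 * m))) := by
  have h := (tendsto_id_left.const_mul 2).mul ((tendsto_eulerMix n m m).comp tendsto_sq_left)
  rw [mul_one, ← two_mul m] at h
  refine h.congr fun r => ?_
  simp only [waveletMoment, Function.comp_apply]
  ring

theorem tendsto_waveletEnergy (n m : ℕ) :
    Tendsto (fun r : ℝ => (1 - r ^ 2) ^ (n + 2 * m + 2) * waveletEnergy n m r) (𝓝[<] 1)
      (𝓝 (2 * rising n (2 * m + 2))) := by
  have h := ((tendsto_eulerMass n (2 * m + 2)).comp tendsto_sq_left).add
    (((tendsto_one_sub.comp tendsto_sq_left).const_mul ((n : ℝ) - 1)).mul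
      ((tendsto_eulerMass n (2 * m + 1)).comp tendsto_sq_left))
  rw [mul_zero, zero_mul, add_zero] at h
  refine h.congr fun r => ?_
  simp only [waveletEnergy, Function.comp_apply]
  ring

/-- Put `k = m + 1` and let `a`, `b`, `c` be `D^(2k)`, `D^(2k-1)`, `D^(2k-2)` of `(1-q)^(-n)` at `q
= r²`. To the order needed, mass minus moment is `(1-r)² a - 2k r (1-r) b + k² c`. As `1 - r =
(1-r²)/(1+r)`, all three terms have the same order, and `1 + r → 2` produces the factor `1/4`. -/
theorem tendsto_waveletMass_sub_waveletMoment (n m : ℕ) :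
    Tendsto (fun r : ℝ => (1 - r ^ 2) ^ (n + 2 * m) *
      (waveletMass n (m + 1) r - waveletMoment n (m + 1) r)) (𝓝[<] 1)
      (𝓝 (rising n (2 * m + 2) / 4 - (m + 1) * rising n (2 * m + 1) +
        (m + 1) ^ 2 * rising n (2 * m))) := by
  have hs : Tendsto (fun r : ℝ => 1 / (1 + r)) (𝓝[<] 1) (𝓝 (1 / 2)) := by
    have := (tendsto_id_left.const_add 1)
    rw [one_add_one_eq_two] at this
    exact tendsto_const_nhds.div this two_ne_zero
  have h1 := (hs.pow 2).mul ((tendsto_eulerMix n (2 * m + 2) 0).comp tendsto_sq_left)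
  have h2 := ((tendsto_id_left.const_mul (2 * ((m : ℝ) + 1))).mul hs).mul
    ((tendsto_eulerMix n (2 * m + 1) 0).comp tendsto_sq_left)
  have h3 := (tendsto_id_left.pow 2).mul
    ((tendsto_eulerMix_sub_sub n (2 * m) 0 (2 * m + 2) (by ring)).comp tendsto_sq_left)
  have h4 := (tendsto_id_left.const_mul 2).mul
    ((tendsto_eulerMix_sub_sub n (2 * m) (m + 1) (m + 1) (by ring)).comp tendsto_sq_left)
  have h := ((h1.sub h2).add h3).sub h4
  refine (h.congr' ?_).trans (le_of_eq ?_)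
  · filter_upwards [Ioo_mem_nhdsLT (show (0 : ℝ) < 1 by norm_num)] with r hr
    have hr1 : 1 + r ≠ 0 := by linarith [hr.1]
    have e : (1 - r ^ 2) = (1 + r) * (1 - r) := by ring
    simp only [Function.comp_apply, waveletMass, waveletMoment, eulerMass, add_zero,
      show 2 * (m + 1) = 2 * m + 2 by ring]
    rw [← add_assoc n (2 * m) 2, ← add_assoc n (2 * m) 1, pow_succ _ (n + 2 * m), pow_add _ (n + 2 * m) 2]
    generalize eulerMix n (2 * m + 2) 0 (r ^ 2) = a
    generalize eulerMix n (2 * m + 1) 0 (r ^ 2) = b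
    generalize eulerMix n (m + 1) (m + 1) (r ^ 2) = c
    generalize eulerMix n 0 (2 * m + 2) (r ^ 2) = d
    generalize hW : (1 - r ^ 2) ^ (n + 2 * m) = W
    rw [e]
    field_simp
    push_cast
    ring
  · congr 1
    push_cast
    simp only [add_zero]
    ring

theorem tendsto_uncertainty_quotient (n m : ℕ) (hn : 2 ≤ n) (hm : 1 ≤ m) :
    (∀ᶠ r in 𝓝[<] (1 : ℝ), waveletMoment n m r ≠ 0) ∧
    Tendsto (fun r => Real.sqrt ((waveletMass n m r / waveletMoment n m r) ^ 2 - 1) *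
      Real.sqrt (waveletEnergy n m r / waveletMass n m r)) (𝓝[<] 1)
      (𝓝 (1 / 2 * Real.sqrt (F n m))) := by
  obtain ⟨m, rfl⟩ : ∃ k, m = k + 1 := ⟨m - 1, by omega⟩
  have hN := tendsto_waveletMass n (m + 1)
  have hM := tendsto_waveletMoment n (m + 1)
  have hE := tendsto_waveletEnergy n (m + 1)
  have hD := tendsto_waveletMass_sub_waveletMoment n m
  have hn1 : 1 ≤ n := by omega
  have c0 := rising_pos n (2 * m) hn1
  have c2 := rising_pos n (2 * (m + 1)) hn1
  have c4 := rising_pos n (2 * (m + 1) + 2) hn1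
  have hy : ∀ᶠ r in 𝓝[<] (1 : ℝ), 0 < 1 - r ^ 2 := by
    filter_upwards [tendsto_sq_left self_mem_nhdsWithin] with r hr
    exact sub_pos.2 hr
  have hpos : ∀ {k : ℕ} {f : ℝ → ℝ} {c : ℝ}, 0 < c →
      Tendsto (fun r : ℝ => (1 - r ^ 2) ^ k * f r) (𝓝[<] 1) (𝓝 c) →
      ∀ᶠ r in 𝓝[<] (1 : ℝ), 0 < f r := by
    intro k f c hc h
    filter_upwards [hy, h.eventually_const_lt hc] with r h1 h2
    exact (pos_iff_pos_of_mul_pos h2).1 (pow_pos h1 _)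
  have pN := hpos (by positivity) hN
  have pM := hpos (by positivity) hM
  have pE := hpos (by positivity) hE
  refine ⟨pM.mono fun r hr => hr.ne', ?_⟩
  -- The square of the uncertainty product is `(N-M)(N+M)E/(M²N)`; the powers of `1 - r²` in
  -- numerator and denominator agree.
  have hlim := ((hD.mul (hN.add hM)).mul hE).div ((hM.pow 2).mul hN) (by positivity)
  have hval : 1 / 2 * Real.sqrt (F n (m + 1)) = Real.sqrt ((rising n (2 * m + 2) / 4 -
      (m + 1) * rising n (2 * m + 1) + (m + 1) ^ 2 * rising n (2 * m)) *
        (2 * rising n (2 * (m + 1)) + 2 * rising n (2 * (m + 1))) *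
        (2 * rising n (2 * (m + 1) + 2)) /
        ((2 * rising n (2 * (m + 1))) ^ 2 * (2 * rising n (2 * (m + 1))))) := by
    have h4 : (1 / 2 : ℝ) = Real.sqrt (1 / 4) := by
      rw [show (1 / 4 : ℝ) = (1 / 2) ^ 2 by norm_num, Real.sqrt_sq (by norm_num)]
    rw [h4, ← Real.sqrt_mul (by norm_num)]
    congr 1
    rw [show 2 * (m + 1) = 2 * m + 2 by ring]
    simp only [rising_succ, F]
    have hn2 : (2 : ℝ) ≤ n := by exact_mod_cast hn
    have hm0 : (0 : ℝ) ≤ m := m.cast_nonneg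
    have a0 : (n : ℝ) + 2 * m ≠ 0 := by positivity
    have a1 : (n : ℝ) + (2 * m + 1) ≠ 0 := by positivity
    have a2 : (n : ℝ) + 2 * (m + 1) - 1 ≠ 0 := by
      have : 0 < (n : ℝ) + 2 * (m + 1) - 1 := by linarith
      exact this.ne'
    have a3 : (n : ℝ) + 2 * (m + 1) - 2 ≠ 0 := by
      have : 0 < (n : ℝ) + 2 * (m + 1) - 2 := by linarith
      exact this.ne'
    have := c0.ne'
    push_cast
    field_simp
    ring
  rw [hval]
  refine (hlim.sqrt).congr' ?_
  filter_upwards [hy, pN, pM, pE] with r h1 h2 h3 h4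
  rw [← Real.sqrt_mul' _ (div_pos h4 h2).le]
  congr 1
  simp only [Pi.div_apply]
  have := h1.ne'
  have := h2.ne'
  have := h3.ne'
  rw [show n + 2 * (m + 1) = n + 2 * m + 2 by ring]
  generalize 1 - r ^ 2 = y at *
  field_simp
  ring

/-! ### The function `F`: minimum, growth and small dimensions. -/

/-- In `x = n + 2m` the difference has the zeros `2n-1` and `2n-2`, that is `m = (n-1)/2` and `m =
(n-2)/2`, of which exactly one is an integer. -/
theorem F_sub_minimum {n : ℕ} (hn : 2 ≤ n) {m : ℕ} (hm : 1 ≤ m) :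
    F n m - (n : ℝ) * (n - 1) * (2 * n - 1) / (2 * n - 3) =
      ((n : ℝ) + 2 * m - 2 * n + 1) * ((n : ℝ) + 2 * m - 2 * n + 2) *
        ((n : ℝ) + 2 * m - n / (2 * n - 3)) / ((n + 2 * m - 1) * (n + 2 * m - 2)) := by
  have hn2 : (2 : ℝ) ≤ n := by exact_mod_cast hn
  have hm1 : (1 : ℝ) ≤ m := by exact_mod_cast hm
  have h1 : 2 * (n : ℝ) - 3 ≠ 0 := by
    have : 0 < 2 * (n : ℝ) - 3 := by linarith
    exact this.ne'
  have h2 : (n : ℝ) + 2 * m - 1 ≠ 0 := by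
    have : 0 < (n : ℝ) + 2 * m - 1 := by linarith
    exact this.ne'
  have h3 : (n : ℝ) + 2 * m - 2 ≠ 0 := by
    have : 0 < (n : ℝ) + 2 * m - 2 := by linarith
    exact this.ne'
  have hg : (n : ℝ) / (2 * n - 3) * (2 * n - 3) = n := div_mul_cancel₀ _ h1
  have e : (n : ℝ) * (n - 1) * (2 * n - 1) / (2 * n - 3) =
      (n - 1) * (2 * n - 1) * (n / (2 * n - 3)) := by ring
  rw [e]
  generalize (n : ℝ) / (2 * n - 3) = g at *
  unfold F
  rw [eq_div_iff (mul_ne_zero h2 h3), sub_mul, div_mul_cancel₀ _ (mul_ne_zero h2 h3)]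
  linear_combination (-(n : ℝ) * (n + 2 * m) ^ 2 + (3 * n - 2) * (n + 2 * m)) * hg

theorem minimum_le_F {n : ℕ} (hn : 2 ≤ n) {m : ℕ} (hm : 1 ≤ m) :
    (n : ℝ) * (n - 1) * (2 * n - 1) / (2 * n - 3) ≤ F n m := by
  have hn2 : (2 : ℝ) ≤ n := by exact_mod_cast hn
  have hm1 : (1 : ℝ) ≤ m := by exact_mod_cast hm
  rw [← sub_nonneg, F_sub_minimum hn hm]
  have h1 : (n : ℝ) / (2 * n - 3) ≤ n := by
    rw [div_le_iff₀ (by linarith)]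
    nlinarith
  -- Integrality is essential: for real `m` strictly between the two zeros the product is negative.
  have h2 : 0 ≤ ((n : ℝ) + 2 * m - 2 * n + 1) * ((n : ℝ) + 2 * m - 2 * n + 2) := by
    have : (0 : ℤ) ≤ ((n : ℤ) + 2 * m - 2 * n + 1) * ((n : ℤ) + 2 * m - 2 * n + 2) := by
      rcases le_or_gt 0 ((n : ℤ) + 2 * m - 2 * n + 1) with h | h
      · exact mul_nonneg h (by omega)
      · exact mul_nonneg_of_nonpos_of_nonpos h.le (by omega)
    exact_mod_cast this
  exact div_nonneg (mul_nonneg h2 (by linarith)) (mul_nonneg (by linarith) (by linarith))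

theorem F_half {n : ℕ} (hn : 5 ≤ n) :
    F n ((n - 1) / 2) = (n : ℝ) * (n - 1) * (2 * n - 1) / (2 * n - 3) := by
  rw [← sub_eq_zero, F_sub_minimum (by omega) (by omega)]
  rcases Nat.even_or_odd' n with ⟨k, rfl | rfl⟩
  · have h : (((2 * k - 1) / 2 : ℕ) : ℝ) = k - 1 := by
      rw [show (2 * k - 1) / 2 = k - 1 by omega, Nat.cast_sub (by omega), Nat.cast_one]
    rw [h]
    push_cast
    ring
  · have h : (((2 * k + 1 - 1) / 2 : ℕ) : ℝ) = k := by
      rw [show (2 * k + 1 - 1) / 2 = k by omega]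
    rw [h]
    push_cast
    ring

theorem isLeast_half_sqrt_F {n : ℕ} (hn : 5 ≤ n) :
    IsLeast ((fun m => 1 / 2 * Real.sqrt (F n m)) '' {m : ℕ | 1 ≤ m}) (minValue n) := by
  refine ⟨⟨(n - 1) / 2, show 1 ≤ (n - 1) / 2 by omega, ?_⟩, ?_⟩
  · simp only [minValue, F_half hn]
  · rintro _ ⟨m, hm, rfl⟩
    have := minimum_le_F (n := n) (by omega) hm
    simp only [minValue]
    gcongr

/-- The radicand equals `n² + n/(2n-3)` with `n/(2n-3) ≤ 2`, so its root lies between `n` and `n +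
2/n`. -/
theorem minValue_sub_mem {n : ℕ} (hn : 2 ≤ n) :
    minValue n - (n : ℝ) / 2 ∈ Icc 0 ((n : ℝ)⁻¹) := by
  have hn2 : (2 : ℝ) ≤ n := by exact_mod_cast hn
  have hpos : 0 < 2 * (n : ℝ) - 3 := by linarith
  have e : (n : ℝ) * (n - 1) * (2 * n - 1) / (2 * n - 3) = (n : ℝ) ^ 2 + n / (2 * n - 3) := by
    rw [div_eq_iff hpos.ne', add_mul, div_mul_cancel₀ _ hpos.ne']
    ring
  have h1 : 0 ≤ (n : ℝ) / (2 * n - 3) := by positivity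
  have h2 : (n : ℝ) / (2 * n - 3) ≤ 2 := by
    rw [div_le_iff₀ hpos]; linarith
  have h3 : (n : ℝ) ≤ Real.sqrt ((n : ℝ) ^ 2 + n / (2 * n - 3)) :=
    Real.le_sqrt_of_sq_le (by linarith)
  have h4 : Real.sqrt ((n : ℝ) ^ 2 + n / (2 * n - 3)) ≤ n + 2 * (n : ℝ)⁻¹ := by
    refine Real.sqrt_le_iff.2 ⟨by positivity, ?_⟩
    have : (n : ℝ) * (n : ℝ)⁻¹ = 1 := mul_inv_cancel₀ (by linarith)
    nlinarith [sq_nonneg ((n : ℝ)⁻¹)]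
  rw [minValue, e]
  constructor <;> linarith

theorem tendsto_minValue_sub : Tendsto (fun n : ℕ => minValue n - (n : ℝ) / 2) atTop (𝓝 0) := by
  refine squeeze_zero' ?_ ?_ (tendsto_inv_atTop_nhds_zero_nat (𝕜 := ℝ))
  · filter_upwards [eventually_ge_atTop 2] with n hn using (minValue_sub_mem hn).1
  · filter_upwards [eventually_ge_atTop 2] with n hn using (minValue_sub_mem hn).2

theorem isEquivalent_minValue :
    Asymptotics.IsEquivalent atTop minValue (fun n : ℕ => (n : ℝ) / 2) := by
  have h := (Asymptotics.isLittleO_one_iff ℝ).2 tendsto_minValue_sub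
  refine h.trans (Asymptotics.isLittleO_const_left.2 (Or.inr ?_))
  exact tendsto_norm_atTop_atTop.comp
    (tendsto_natCast_atTop_atTop.atTop_div_const (by norm_num))

theorem strictMonoOn_half_sqrt_F {n : ℕ} (hn : n = 2 ∨ n = 3 ∨ n = 4) :
    StrictMonoOn (fun m => 1 / 2 * Real.sqrt (F n m)) {m : ℕ | 1 ≤ m} := by
  refine strictMonoOn_of_lt_add_one ordConnected_Ici (fun m _ hm _ => ?_)
  obtain ⟨k, rfl⟩ : ∃ k, m = k + 1 := ⟨m - 1, (Nat.sub_add_cancel hm).symm⟩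
  have hk : (0 : ℝ) ≤ k := k.cast_nonneg
  have key : 0 ≤ F n (k + 1) ∧ F n (k + 1) < F n (k + 1 + 1) := by
    rcases hn with rfl | rfl | rfl
    all_goals
      unfold F
      push_cast
      constructor
      · apply div_nonneg <;> nlinarith [mul_nonneg hk hk, mul_nonneg hk (mul_nonneg hk hk)]
      -- With `m = k + 1` and denominators cleared, the difference is a polynomial in `k ≥ 0` whose
      -- expanded form is visibly positive.
      · rw [div_lt_div_iff₀ (by nlinarith) (by nlinarith), ← sub_pos]
        ring_nf
        positivity
  have := Real.sqrt_lt_sqrt key.1 key.2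
  linarith

/-! ### The limit for the wavelets and the assembly of the theorem. -/

theorem surf_real_univ_pos (n : ℕ) : 0 < (surf n).real univ := by
  rw [surf, Measure.toSphere_real_apply_univ]
  refine mul_pos (by simp; positivity) ?_
  exact ENNReal.toReal_pos (measure_ball_pos _ _ one_pos).ne' measure_ball_lt_top.ne

theorem exp_neg_mem_Ioo {ρ : ℝ} (hρ : 0 < ρ) : Real.exp (-ρ) ∈ Ioo (0 : ℝ) 1 :=
  ⟨Real.exp_pos _, Real.exp_lt_one_iff.2 (neg_lt_zero.2 hρ)⟩

/-- The profile of a multiple of `(r ∂_r)^m P`. -/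
def waveletProfile (n m : ℕ) (c r t : ℝ) : ℂ := ((c * poissonDeriv n m r t : ℝ) : ℂ)

theorem wavelet_eq (n m : ℕ) {ρ : ℝ} (hρ : 0 < ρ) (x : Sph n) :
    wavelet n m ρ x = waveletProfile n m (ρ ^ m * (1 / (surf n).real univ)) (Real.exp (-ρ))
      ((x : EuclideanSpace ℝ (Fin (n + 1))) 0) := by
  rw [wavelet, waveletProfile, iterate_scaledRadialDeriv n m ρ x _
    (exp_neg_mem_Ioo hρ)]

theorem contMDiff_wavelet (n m : ℕ) {ρ : ℝ} (hρ : 0 < ρ) :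
    ContMDiff (𝓡 n) 𝓘(ℝ, ℂ) 2 (wavelet n m ρ) := by
  have h := contMDiff_zonal n (F := fun t => ρ ^ m * (1 / (surf n).real univ) *
    poissonDeriv n m (Real.exp (-ρ)) t) (fun t ht => contDiffAt_const.mul
      (contDiffAt_poissonDeriv n m 2 (exp_neg_mem_Ioo hρ) ht))
  have e : wavelet n m ρ = _ := funext (wavelet_eq n m hρ)
  rw [e]
  exact h

theorem massInt_waveletProfile (n m : ℕ) (hn : 2 ≤ n) (c : ℝ) {r : ℝ} (hr : r ∈ Ioo (0 : ℝ) 1) :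
    massInt n (fun θ => waveletProfile n m c r (Real.cos θ)) =
      c ^ 2 * totalWeight n * waveletMass n m r := by
  have h := integral_angleProfile_mul n hn m m hr hr
  rw [waveletMass, two_mul, sq r, mul_assoc, ← h, ← intervalIntegral.integral_const_mul, massInt]
  congr 1
  ext θ
  simp only [waveletProfile, Complex.norm_real, Real.norm_eq_abs, sq_abs, angleProfile]
  ring

theorem momentInt_waveletProfile (n m : ℕ) (hn : 2 ≤ n) (c : ℝ) {r : ℝ} (hr : r ∈ Ioo (0 : ℝ) 1) :
    momentInt n (fun θ => waveletProfile n m c r (Real.cos θ)) =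
      c ^ 2 * totalWeight n * waveletMoment n m r := by
  have h := integral_cos_mul_angleProfile_mul n hn m m hr hr
  rw [waveletMoment, sq r, two_mul, add_mul, mul_assoc, ← h,
    ← intervalIntegral.integral_const_mul, momentInt]
  congr 1
  ext θ
  simp only [waveletProfile, Complex.norm_real, Real.norm_eq_abs, sq_abs, angleProfile]
  ring

theorem energyInt_waveletProfile (n m : ℕ) (hn : 2 ≤ n) (c : ℝ) {r : ℝ} (hr : r ∈ Ioo (0 : ℝ) 1) :
    energyInt n (fun θ => waveletProfile n m c r (Real.cos θ)) =
      c ^ 2 * totalWeight n * waveletEnergy n m r := by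
  have h := integral_deriv_angleProfile_mul n hn m m hr hr
  rw [waveletEnergy, sq r, two_mul, mul_assoc, ← h, ← intervalIntegral.integral_const_mul,
    energyInt]
  congr 1
  ext θ
  have hd : HasDerivAt (fun θ => waveletProfile n m c r (Real.cos θ))
      ((c * deriv (angleProfile n m r) θ : ℝ) : ℂ) θ :=
    ((hasDerivAt_of_contDiff_two (contDiff_angleProfile n m hr) θ).const_mul c).ofReal_comp
  rw [hd.deriv]
  simp only [Complex.norm_real, Real.norm_eq_abs, sq_abs]
  ring

theorem tendsto_exp_neg_left : Tendsto (fun ρ : ℝ => Real.exp (-ρ)) (𝓝[>] 0) (𝓝[<] 1) := by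
  refine tendsto_nhdsWithin_iff.2 ⟨?_, ?_⟩
  · have : Tendsto (fun ρ : ℝ => Real.exp (-ρ)) (𝓝 0) (𝓝 (Real.exp (-0))) :=
      (Real.continuous_exp.comp continuous_neg).tendsto 0
    rw [neg_zero, Real.exp_zero] at this
    exact this.mono_left nhdsWithin_le_nhds
  · filter_upwards [self_mem_nhdsWithin] with ρ hρ
    exact (exp_neg_mem_Ioo hρ).2

/-- The prefactor `ρ^m / Σ_n` and the total weight enter all three integrals as one nonzero factor
and cancel. -/
theorem uncertainty_wavelet (n m : ℕ) (hn : 2 ≤ n) {ρ : ℝ} (hρ : 0 < ρ) :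
    (firstMoment n (wavelet n m ρ) ≠ 0 ↔ waveletMoment n m (Real.exp (-ρ)) ≠ 0) ∧
    uncertainty n (wavelet n m ρ) =
      Real.sqrt ((waveletMass n m (Real.exp (-ρ)) / waveletMoment n m (Real.exp (-ρ))) ^ 2 - 1) *
      Real.sqrt (waveletEnergy n m (Real.exp (-ρ)) / waveletMass n m (Real.exp (-ρ))) := by
  have hr : Real.exp (-ρ) ∈ Ioo (0 : ℝ) 1 :=
    exp_neg_mem_Ioo hρ
  obtain ⟨h1, h2⟩ := uncertainty_zonal n hn (contMDiff_wavelet n m hρ) (wavelet_eq n m hρ)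
  have hc : (ρ ^ m * (1 / (surf n).real univ)) ^ 2 * totalWeight n ≠ 0 := by
    have := surf_real_univ_pos n
    have := totalWeight_pos n hn
    positivity
  rw [massInt_waveletProfile n m hn _ hr, momentInt_waveletProfile n m hn _ hr,
    energyInt_waveletProfile n m hn _ hr, mul_div_mul_left _ _ hc, mul_div_mul_left _ _ hc] at h2
  rw [momentInt_waveletProfile n m hn _ hr, mul_ne_zero_iff_left hc] at h1
  exact ⟨h1, h2⟩

theorem eventually_isAdmissible_wavelet (n m : ℕ) (hn : 2 ≤ n) (hm : 1 ≤ m) :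
    ∀ᶠ ρ in 𝓝[>] (0 : ℝ), IsAdmissible n (wavelet n m ρ) := by
  filter_upwards [self_mem_nhdsWithin,
    tendsto_exp_neg_left.eventually (tendsto_uncertainty_quotient n m hn hm).1] with ρ hρ h
  exact ⟨contMDiff_wavelet n m hρ, ⟨_, wavelet_eq n m hρ⟩, (uncertainty_wavelet n m hn hρ).1.2 h⟩

theorem tendsto_uncertainty_wavelet (n m : ℕ) (hn : 2 ≤ n) (hm : 1 ≤ m) :
    Tendsto (fun ρ : ℝ => uncertainty n (wavelet n m ρ)) (𝓝[>] 0)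
      (𝓝 (1 / 2 * Real.sqrt (F n m))) := by
  refine ((tendsto_uncertainty_quotient n m hn hm).2.comp tendsto_exp_neg_left).congr' ?_
  filter_upwards [self_mem_nhdsWithin] with ρ hρ using (uncertainty_wavelet n m hn hρ).2.symm

end PoissonWavelet

end

theorem mainTheorem2 :
    ∃ L : ℕ → ℕ → ℝ,
      -- `L n m` is the limit of the uncertainty product of `g_ρ^m` as `ρ → 0`
      (∀ n m : ℕ, 2 ≤ n → 1 ≤ m →
        (∀ᶠ ρ in 𝓝[>] (0 : ℝ),
          PoissonWavelet.IsAdmissible n (PoissonWavelet.wavelet n m ρ)) ∧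
        Tendsto (fun ρ : ℝ => PoissonWavelet.uncertainty n (PoissonWavelet.wavelet n m ρ))
          (𝓝[>] 0) (𝓝 (L n m)) ∧
        L n m = 1 / 2 * Real.sqrt (PoissonWavelet.F n m)) ∧
      -- the minimum over `m` for `n ≥ 5`, and where it is attained
      (∀ n : ℕ, 5 ≤ n →
        IsLeast (L n '' {m : ℕ | 1 ≤ m}) (PoissonWavelet.minValue n) ∧
        1 ≤ (n - 1) / 2 ∧ L n ((n - 1) / 2) = PoissonWavelet.minValue n) ∧
      -- behaviour of the minimum as `n → ∞`
      Asymptotics.IsEquivalent atTop PoissonWavelet.minValue (fun n : ℕ => (n : ℝ) / 2) ∧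
      Tendsto (fun n : ℕ => PoissonWavelet.minValue n - (n : ℝ) / 2) atTop (𝓝 0) ∧
      -- `n / 2` is the optimal lower bound for the uncertainty product of zonal functions
      (∀ n : ℕ, 2 ≤ n →
        IsGLB {u : ℝ | ∃ f : PoissonWavelet.Sph n → ℂ,
          PoissonWavelet.IsAdmissible n f ∧ PoissonWavelet.uncertainty n f = u} ((n : ℝ) / 2)) ∧
      -- small dimensions
      (∀ n : ℕ, n = 2 ∨ n = 3 ∨ n = 4 → StrictMonoOn (L n) {m : ℕ | 1 ≤ m}) := by
  -- The limit is named by its closed form, so the claims about minimum and monotonicity concern `F`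
  -- alone.
  refine ⟨fun n m => 1 / 2 * Real.sqrt (PoissonWavelet.F n m), fun n m hn hm =>
    ⟨PoissonWavelet.eventually_isAdmissible_wavelet n m hn hm,
      PoissonWavelet.tendsto_uncertainty_wavelet n m hn hm, rfl⟩, fun n hn =>
    ⟨PoissonWavelet.isLeast_half_sqrt_F hn, by omega, ?_⟩,
    PoissonWavelet.isEquivalent_minValue, PoissonWavelet.tendsto_minValue_sub,
    PoissonWavelet.isGLB_uncertainty, fun n hn => PoissonWavelet.strictMonoOn_half_sqrt_F hn⟩
  simp only [PoissonWavelet.minValue, PoissonWavelet.F_half hn]
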